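/- Let $\mathbb R_+^2=[0,\infty)^2$, let $\alpha>0$, let $S_\alpha=\{z: 0\le z_1,\ 0\le z_2\le\alpha z_1\}$, and consider for $x\in\mathbb R^2_+$, $t\ge 0$ the system $$\omega_t+\mathbf u\cdot\nabla\omega=\frac{\rho}{x_1},\qquad \rho_t+\mathbf u\cdot\nabla\rho=0,\qquad \mathbf u=(-x_1Q,\;x_2Q),\qquad Q(\mathbf x,t)=\iint_{\mathbf x+S_\alpha}\frac{y_1y_2}{|\mathbf y|^4}\,\omega(\mathbf y,t)\,d\mathbf y .$$ Let $\mathcal X$ be the class of restrictions to $\mathbb R_+^2$ of compactly supported $C^1$ functions on $\mathbb R^2$ with support in $\{x_1>0\}$. A smooth solution on $[0,T)$ is a pair $\omega,\rho\in C([0,T),\mathcal X)$ satisfying the system pointwise (continuity in time is in the $C^1$ norm, with supports in a common compact subset of $\{x_1>0\}$ on each $[0,T']\subset[0,T)$). For parameters $b_0,p_0,p_1,\delta,\phi_0,\phi_1$ with $$p_0+p_1=1,\quad 0<p_0<\tfrac12,\quad 0<\delta<1,\quad 0<b_0<\delta,\quad 0<\phi_0<\phi_1, \qquad (*)$$ let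 $D_0$ be the set of $\mathbf x$ with either $b_0<x_1\le\delta$ and $0\le x_2\le 2\alpha(x_1-b_0)$, or $\delta<x_1<4$ and $0\le x_2\le 2\alpha x_1$. Initial data $\omega_0,\rho_0\in\mathcal X$ are called suitably prepared if $\omega_0\ge0$, $0\le\rho_0\le1$, $\operatorname{supp}\omega_0,\operatorname{supp}\rho_0\subset(0,4)\times[0,\infty)$, and on $D_0$: $\ \phi_0x_1^{-p_0}<\omega_0<\phi_1x_1^{-p_1}$ where $x_1<1$; $\ \phi_0<\omega_0$ where $1\le x_1<3$; $\ \omega_0<\phi_1$ where $1\le x_1<4$; $\ \rho_0=1$ where $x_1<3$. **Theorem.** For every $\alpha>0$ there are $p_0,p_1,\delta,\phi_0,\phi_1$ satisfying the conditions in $(*)$ not involving $b_0$, such that for every $M<\phi_1$ there is $b_0\in(0,\delta)$ with the following property. For all suitably prepared $\omega_0,\rho_0$ there is a unique maximal smooth solution $(\omega,\rho)$ with these initial data, its lifespan $T_s$ satisfies $0<T_s<\infty$, and $$\lim_{t\to T_s}\|\omega(\cdot,t)\|_{L^\infty(\mathbb R_+^2)}=\infty .$$ Moreover there are $T^*\ge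 T_s$ and a smooth, positive, strictly decreasing function $b:[0,T^*)\to(0,\infty)$ with $b(0)=b_0$ and $\lim_{t\to T^*}b(t)=0$ such that for all $t\in[0,T_s)$ $$\phi_0x_1^{-p_0}<\omega(x_1,0,t)\qquad (b(t)<x_1<1),$$ and, provided $\omega_0\le M$ on $D_0\cap\{x_1\ge1\}$, also $$\omega(x_1,0,t)<\phi_1x_1^{-p_1}\qquad (b(t)<x_1<1).$$ -/

import Mathlib

open Set Filter Topology MeasureTheory
open scoped ENNReal

namespace BoussinesqModel

/-- The closed quadrant `[0, ∞)²`. Functions on the quadrant are represented by functions on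
`ℝ × ℝ` of which only the values on `quadrant` are ever used. -/
def quadrant : Set (ℝ × ℝ) := {x | 0 ≤ x.1 ∧ 0 ≤ x.2}

/-- The sector `{0 ≤ z₁, 0 ≤ z₂ ≤ α z₁}`. -/
def sector (α : ℝ) : Set (ℝ × ℝ) := {z | 0 ≤ z.1 ∧ 0 ≤ z.2 ∧ z.2 ≤ α * z.1}

/-- `Q(x) = ∬_{x + S_α} y₁ y₂ / |y|⁴ f(y) dy`, with `|y|` the Euclidean norm. -/
noncomputable def Q (α : ℝ) (f : ℝ × ℝ → ℝ) (x : ℝ × ℝ) : ℝ :=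
  ∫ y in {y : ℝ × ℝ | y - x ∈ sector α}, y.1 * y.2 / (y.1 ^ 2 + y.2 ^ 2) ^ 2 * f y

/-- The velocity field `u = (-x₁ Q, x₂ Q)` generated by the vorticity `f`. -/
noncomputable def velocity (α : ℝ) (f : ℝ × ℝ → ℝ) (x : ℝ × ℝ) : ℝ × ℝ :=
  (-(x.1 * Q α f x), x.2 * Q α f x)

/-- The class `𝒳`: restrictions to the quadrant of compactly supported `C¹` functions on the
plane whose support lies in the open half-plane `{x₁ > 0}`. -/
def MemX (f : ℝ × ℝ → ℝ) : Prop :=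
  ∃ g : ℝ × ℝ → ℝ, ContDiff ℝ 1 g ∧ HasCompactSupport g ∧ tsupport g ⊆ {x | 0 < x.1} ∧
    EqOn f g quadrant

/-- `f ∈ C([0, T), 𝒳)`: every `f t` belongs to `𝒳`, the map `t ↦ f t` is continuous for the
`C¹` norm on the quadrant, and on each `[0, T'] ⊆ [0, T)` the supports stay in a fixed compact
subset of `{x₁ > 0}` (this is continuity for the usual topology on spaces of compactly supported
functions). -/
structure ContinuousInX (T : ℝ) (f : ℝ → ℝ × ℝ → ℝ) : Prop where
  mem : ∀ t ∈ Ico 0 T, MemX (f t)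
  tendsto : ∀ t ∈ Ico 0 T, TendstoUniformlyOn f (f t) (𝓝[Ico 0 T] t) quadrant
  tendsto_fderiv : ∀ t ∈ Ico 0 T,
    TendstoUniformlyOn (fun s => fderivWithin ℝ (f s) quadrant) (fderivWithin ℝ (f t) quadrant)
      (𝓝[Ico 0 T] t) quadrant
  supp : ∀ T' ∈ Ico 0 T, ∃ K : Set (ℝ × ℝ), IsCompact K ∧ K ⊆ {x | 0 < x.1} ∧
    ∀ t ∈ Icc 0 T', ∀ x ∈ quadrant, x ∉ K → f t x = 0

/-- `(ω, ρ)` is a classical solution on `[0, T)` of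
`ω_t + u·∇ω = ρ / x₁`, `ρ_t + u·∇ρ = 0` with initial data `(ω₀, ρ₀)`.
The term `ρ / x₁` vanishes near `x₁ = 0`, in agreement with division by zero giving `0`. -/
structure IsSolution (α : ℝ) (ω₀ ρ₀ : ℝ × ℝ → ℝ) (T : ℝ) (ω ρ : ℝ → ℝ × ℝ → ℝ) : Prop where
  continuous_ω : ContinuousInX T ω
  continuous_ρ : ContinuousInX T ρ
  initial_ω : EqOn (ω 0) ω₀ quadrant
  initial_ρ : EqOn (ρ 0) ρ₀ quadrant
  eq_ω : ∀ t ∈ Ico 0 T, ∀ x ∈ quadrant,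
    HasDerivWithinAt (fun s => ω s x)
      (ρ t x / x.1 - fderivWithin ℝ (ω t) quadrant x (velocity α (ω t) x)) (Ici 0) t
  eq_ρ : ∀ t ∈ Ico 0 T, ∀ x ∈ quadrant,
    HasDerivWithinAt (fun s => ρ s x)
      (-fderivWithin ℝ (ρ t) quadrant x (velocity α (ω t) x)) (Ici 0) t

/-- `(ω, ρ)` is the solution with initial data `(ω₀, ρ₀)`, and `T` is its lifespan: it solves the
system on `[0, T)`, and every solution with the same data lives on a time interval contained in
`[0, T)` and coincides there with `(ω, ρ)`. -/
structure IsMaximalSolution (α : ℝ) (ω₀ ρ₀ : ℝ × ℝ → ℝ) (T : ℝ) (ω ρ : ℝ → ℝ × ℝ → ℝ) :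
    Prop where
  isSolution : IsSolution α ω₀ ρ₀ T ω ρ
  maximal : ∀ (T' : ℝ) (ω' ρ' : ℝ → ℝ × ℝ → ℝ), IsSolution α ω₀ ρ₀ T' ω' ρ' →
    T' ≤ T ∧ ∀ t ∈ Ico 0 T', EqOn (ω' t) (ω t) quadrant ∧ EqOn (ρ' t) (ρ t) quadrant

/-- The region `D₀`. -/
def D₀ (α b₀ δ : ℝ) : Set (ℝ × ℝ) :=
  {x | 0 ≤ x.2 ∧ ((b₀ < x.1 ∧ x.1 ≤ δ ∧ x.2 ≤ 2 * α * (x.1 - b₀)) ∨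
    (δ < x.1 ∧ x.1 < 4 ∧ x.2 ≤ 2 * α * x.1))}

/-- Suitably prepared initial data. -/
structure SuitablyPrepared (α b₀ p₀ p₁ δ φ₀ φ₁ : ℝ) (ω₀ ρ₀ : ℝ × ℝ → ℝ) : Prop where
  memX_ω : MemX ω₀
  memX_ρ : MemX ρ₀
  nonneg_ω : ∀ x ∈ quadrant, 0 ≤ ω₀ x
  nonneg_ρ : ∀ x ∈ quadrant, 0 ≤ ρ₀ x
  lower : ∀ x ∈ D₀ α b₀ δ, x.1 < 1 → φ₀ * x.1 ^ (-p₀) < ω₀ x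
  lower' : ∀ x ∈ D₀ α b₀ δ, 1 ≤ x.1 → x.1 < 3 → φ₀ < ω₀ x
  upper : ∀ x ∈ D₀ α b₀ δ, x.1 < 1 → ω₀ x < φ₁ * x.1 ^ (-p₁)
  upper' : ∀ x ∈ D₀ α b₀ δ, 1 ≤ x.1 → x.1 < 4 → ω₀ x < φ₁
  ρ_eq_one : ∀ x ∈ D₀ α b₀ δ, x.1 < 3 → ρ₀ x = 1
  supp_ω : closure (Function.support ω₀ ∩ quadrant) ⊆ {x | 0 < x.1 ∧ x.1 < 4}
  supp_ρ : closure (Function.support ρ₀ ∩ quadrant) ⊆ {x | 0 < x.1 ∧ x.1 < 4}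
  ρ_le_one : ∀ x ∈ quadrant, ρ₀ x ≤ 1

end BoussinesqModel

/-! Along a particle path x₁' = -x₁Q, x₂' = x₂Q, the density ρ is constant and ω' = ρ/x₁. Suppose
that behind a front x₁ = b(t), in a wedge-like region, x₁^(-p₀) ≤ ω ≤ Φ x₁^(-p₁) up to factors of
two. Keeping in Q only a rectangle of size comparable to x₁ gives Q ≥ c x₁^(-p₀) for x₁ ≤ 1.
Integrating the kernel in y₂ first gives Q ≤ 8Φ x₁^(-p₁). Since p₀ + p₁ = 1, along a path
(x₁^(-p₀))' = p₀ Q x₁^(-p₀) ≤ 8p₀Φ/x₁ ≤ 1/x₁ and (Φ x₁^(-p₁))' = p₁Φ Q x₁^(-p₁) ≥ p₁Φc/x₁ ≥ 1/x₁,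
provided Φ is large compared with 1/c and p₀ is small compared with 1/Φ. As ω' = 1/x₁ where ρ = 1
and ω' ≤ 1/x₁ everywhere, both bounds propagate without loss (`Barrier.strong_lower`,
`Barrier.strong_upper`).

The front solves b' = -c b^(1-p₀), so it moves left no faster than the particles just behind it, and
no particle enters the region from outside (`Barrier.mem_region`). The region is stable under adding
the sector, so the bounds on Q use only values of ω in the region and the argument closes by
continuity in time (`Barrier.strongBounds_of_lt`). Because p₀ > 0, the front reaches 0 at a finite
time τ. A smooth solution at time τ would vanish near x₁ = 0, contrary to the lower bound; hence the
lifespan is at most τ (`Barrier.lifespan_le`). A small b₀ makes τ small, so little happens to the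
right of x₁ = 1 in the meantime.

Well-posedness rests on the regularising effect of Q: for a continuous compactly supported integrand
the sector integral is C¹, so a merely continuous ω generates a C¹ flow. After cutting off all
coefficients, the representation of ω along paths is a contraction in an exponentially weighted
supremum norm (`CutData.exists_fixedPoint`). Cut-off and original solutions agree while the supports
stay where the cutoff equals one (`CutSol.isSolution`, `CutSol.eq_of_isSolution`).

If ω is bounded, Q is at most logarithmic in 1/x₁, the supports stay away from x₁ = 0 and the
solution extends (`IsSolution.exists_extension`). So ω is unbounded at a finite lifespan. Since ω
does not decrease along paths, its supremum is monotone in time, and unboundedness becomes a limit.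
-/

namespace BoussinesqModel

/-! ### Flows of globally Lipschitz vector fields. -/

section ODE

variable {E : Type*} [NormedAddCommGroup E]

/-- A jointly continuous time-dependent vector field which is globally Lipschitz in space. -/
structure LipField (f : ℝ → E → E) (K C : ℝ) : Prop where
  cont : Continuous fun q : ℝ × E => f q.1 q.2
  lip : ∀ t x y, ‖f t x - f t y‖ ≤ K * ‖x - y‖
  bdd : ∀ t, ‖f t 0‖ ≤ C
  K_nonneg : 0 ≤ K
  C_nonneg : 0 ≤ C

theorem abs_integral_exp_mul_abs_le {l : ℝ} (hl : 0 < l) (t : ℝ) :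
    |∫ s in (0 : ℝ)..t, Real.exp (l * |s|)| ≤ Real.exp (l * |t|) / l := by
  have key : ∀ u : ℝ, 0 ≤ u → |∫ s in (0 : ℝ)..u, Real.exp (l * |s|)| ≤ Real.exp (l * u) / l := by
    intro u hu
    have h1 : ∫ s in (0 : ℝ)..u, Real.exp (l * |s|) = ∫ s in (0 : ℝ)..u, Real.exp (l * s) := by
      refine intervalIntegral.integral_congr fun s hs => ?_
      rw [uIcc_of_le hu] at hs
      simp only [abs_of_nonneg hs.1]
    have h2 : ∫ s in (0 : ℝ)..u, Real.exp (l * s) = (Real.exp (l * u) - 1) / l := by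
      rw [intervalIntegral.integral_comp_mul_left (fun s => Real.exp s) hl.ne']
      simp [integral_exp, div_eq_inv_mul]
    rw [h1, h2, abs_of_nonneg]
    · gcongr; linarith
    · exact div_nonneg (by linarith [Real.add_one_le_exp (l * u), mul_nonneg hl.le hu]) hl.le
  rcases le_total 0 t with ht | ht
  · rw [abs_of_nonneg ht]; exact key t ht
  · rw [abs_of_nonpos ht]
    have h3 := key (-t) (by linarith)
    have h4 : ∫ s in (0 : ℝ)..(-t), Real.exp (l * |s|) =
        - ∫ s in (0 : ℝ)..t, Real.exp (l * |s|) := by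
      have := intervalIntegral.integral_comp_neg (a := 0) (b := t)
        (fun s : ℝ => Real.exp (l * |s|))
      simp only [abs_neg, neg_zero] at this
      rw [this, intervalIntegral.integral_symm]
    rwa [h4, abs_neg] at h3

theorem LipField.norm_le {f : ℝ → E → E} {K C : ℝ} (hf : LipField f K C) (t : ℝ) (x : E) :
    ‖f t x‖ ≤ C + K * ‖x‖ := by
  have h1 := hf.lip t x 0
  have h2 := hf.bdd t
  have h3 : ‖f t x‖ ≤ ‖f t x - f t 0‖ + ‖f t 0‖ := by
    simpa using norm_add_le (f t x - f t 0) (f t 0)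
  rw [sub_zero] at h1
  linarith

variable [NormedSpace ℝ E]

/-- Picard iteration in the supremum norm weighted by exp(-l|s|) contracts on the whole line at
once, so no gluing of local solutions is needed. The unknown is the bounded function w with Z =
exp(l|s|) w. -/
theorem LipField.exists_solution_zero [CompleteSpace E] {f : ℝ → E → E} {K C : ℝ}
    (hf : LipField f K C) (x : E) :
    ∃ Z : ℝ → E, Z 0 = x ∧ ∀ s, HasDerivAt Z (f s (Z s)) s := by
  -- The contraction factor is K / l, so this choice makes it at most 1/2.
  set l : ℝ := 2 * K + 1 with hl
  have hl0 : 0 < l := by have := hf.K_nonneg; linarith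
  have hexp : Continuous fun s : ℝ => Real.exp (l * |s|) := by fun_prop
  have hfc : ∀ g : ℝ → E, Continuous g → Continuous fun s => f s (g s) := fun g hg =>
    hf.cont.comp (continuous_id.prodMk hg)
  let Z : (BoundedContinuousFunction ℝ E) → ℝ → E := fun w s => Real.exp (l * |s|) • w s
  have hZ : ∀ w, Continuous (Z w) := fun w => hexp.smul w.continuous
  let P : (BoundedContinuousFunction ℝ E) → ℝ → E := fun w s => x + ∫ r in (0 : ℝ)..s, f r (Z w r)
  have hP : ∀ w, Continuous (P w) := fun w =>
    continuous_const.add (intervalIntegral.continuous_primitive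
      (fun a b => (hfc _ (hZ w)).intervalIntegrable a b) 0)
  have hint : ∀ (g : ℝ → E) (B : ℝ), Continuous g → (∀ r, ‖g r‖ ≤ B * Real.exp (l * |r|)) →
      ∀ s, ‖∫ r in (0 : ℝ)..s, g r‖ ≤ B * (Real.exp (l * |s|) / l) := by
    intro g B hg hB s
    have hB0 : 0 ≤ B := by
      have := (norm_nonneg _).trans (hB 0)
      simpa using this
    calc ‖∫ r in (0 : ℝ)..s, g r‖ ≤ |∫ r in (0 : ℝ)..s, B * Real.exp (l * |r|)| :=
          intervalIntegral.norm_integral_le_abs_of_norm_le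
            (Eventually.of_forall fun r => hB r) ((hexp.const_mul B |>.intervalIntegrable _ _))
      _ ≤ _ := by
          rw [intervalIntegral.integral_const_mul, abs_mul, abs_of_nonneg hB0]
          exact mul_le_mul_of_nonneg_left (abs_integral_exp_mul_abs_le hl0 s) hB0
  have hone : ∀ r : ℝ, 1 ≤ Real.exp (l * |r|) := fun r =>
    Real.one_le_exp (mul_nonneg hl0.le (abs_nonneg r))
  have hbd : ∀ w s, ‖Real.exp (-(l * |s|)) • P w s‖ ≤ ‖x‖ + (C + K * ‖w‖) / l := by
    intro w s
    have h1 : ‖∫ r in (0 : ℝ)..s, f r (Z w r)‖ ≤ (C + K * ‖w‖) * (Real.exp (l * |s|) / l) := by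
      refine hint _ _ (hfc _ (hZ w)) (fun r => (hf.norm_le _ _).trans ?_) s
      have h2 : ‖Z w r‖ ≤ Real.exp (l * |r|) * ‖w‖ := by
        simp only [Z, norm_smul, Real.norm_eq_abs, Real.abs_exp]
        exact mul_le_mul_of_nonneg_left (w.norm_coe_le_norm r) (Real.exp_pos _).le
      have h3 := mul_le_mul_of_nonneg_left h2 hf.K_nonneg
      have h4 := mul_le_mul_of_nonneg_left (hone r) hf.C_nonneg
      nlinarith
    rw [norm_smul, Real.norm_eq_abs, Real.abs_exp, Real.exp_neg,
      inv_mul_le_iff₀ (Real.exp_pos _)]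
    calc ‖P w s‖ ≤ ‖x‖ + (C + K * ‖w‖) * (Real.exp (l * |s|) / l) :=
          (norm_add_le _ _).trans (by gcongr)
      _ ≤ Real.exp (l * |s|) * ‖x‖ + (C + K * ‖w‖) * (Real.exp (l * |s|) / l) := by
          gcongr; exact le_mul_of_one_le_left (norm_nonneg _) (hone s)
      _ = _ := by ring
  let Φ : (BoundedContinuousFunction ℝ E) → (BoundedContinuousFunction ℝ E) := fun w =>
    BoundedContinuousFunction.ofNormedAddCommGroup (fun s => Real.exp (-(l * |s|)) • P w s)
      ((by fun_prop : Continuous fun s : ℝ => Real.exp (-(l * |s|))).smul (hP w)) _ (hbd w)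
  have hΦ : ContractingWith (1 / 2) Φ := by
    refine ⟨by norm_num, LipschitzWith.of_dist_le_mul fun w w' => ?_⟩
    rw [BoundedContinuousFunction.dist_le (by positivity)]
    intro s
    have h1 : P w s - P w' s = ∫ r in (0 : ℝ)..s, (f r (Z w r) - f r (Z w' r)) := by
      rw [intervalIntegral.integral_sub ((hfc _ (hZ w)).intervalIntegrable _ _)
        ((hfc _ (hZ w')).intervalIntegrable _ _)]
      simp only [P]; abel
    have h2 : ‖P w s - P w' s‖ ≤ (K * dist w w') * (Real.exp (l * |s|) / l) := by
      rw [h1]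
      refine hint _ _ ((hfc _ (hZ w)).sub (hfc _ (hZ w'))) (fun r => (hf.lip _ _ _).trans ?_) s
      have : ‖Z w r - Z w' r‖ ≤ Real.exp (l * |r|) * dist w w' := by
        simp only [Z, ← smul_sub, norm_smul, Real.norm_eq_abs, Real.abs_exp, ← dist_eq_norm]
        exact mul_le_mul_of_nonneg_left (w.dist_coe_le_dist r) (Real.exp_pos _).le
      calc K * ‖Z w r - Z w' r‖ ≤ K * (Real.exp (l * |r|) * dist w w') :=
            mul_le_mul_of_nonneg_left this hf.K_nonneg
        _ = _ := by ring
    change dist (Real.exp (-(l * |s|)) • P w s) (Real.exp (-(l * |s|)) • P w' s) ≤ _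
    rw [dist_eq_norm, ← smul_sub, norm_smul, Real.norm_eq_abs, Real.abs_exp, Real.exp_neg,
      inv_mul_le_iff₀ (Real.exp_pos _)]
    refine h2.trans ?_
    have h3 : K / l ≤ 1 / 2 := by rw [div_le_iff₀ hl0]; linarith
    have h4 : 0 ≤ dist w w' * Real.exp (l * |s|) := by positivity
    calc (K * dist w w') * (Real.exp (l * |s|) / l)
        = (K / l) * (dist w w' * Real.exp (l * |s|)) := by ring
      _ ≤ (1 / 2) * (dist w w' * Real.exp (l * |s|)) := by gcongr
      _ = _ := by push_cast; ring
  let w := ContractingWith.fixedPoint Φ hΦ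
  have hw : Φ w = w := hΦ.fixedPoint_isFixedPt
  have hZP : Z w = P w := by
    funext s
    have : w s = Real.exp (-(l * |s|)) • P w s := by
      conv_lhs => rw [← hw]
      rfl
    simp only [Z]
    rw [this, smul_smul, ← Real.exp_add]; simp
  refine ⟨Z w, by rw [hZP]; simp [P], fun s => ?_⟩
  have hd : HasDerivAt (P w) (f s (Z w s)) s :=
    (intervalIntegral.integral_hasDerivAt_right ((hfc _ (hZ w)).intervalIntegrable _ _)
      ((hfc _ (hZ w)).stronglyMeasurableAtFilter _ _) (hfc _ (hZ w)).continuousAt).const_add x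
  rwa [← hZP] at hd

theorem LipField.exists_solution [CompleteSpace E] {f : ℝ → E → E} {K C : ℝ}
    (hf : LipField f K C) (t : ℝ) (x : E) :
    ∃ Z : ℝ → E, Z t = x ∧ ∀ s, HasDerivAt Z (f s (Z s)) s := by
  have hg : LipField (fun s => f (s + t)) K C :=
    ⟨hf.cont.comp (by fun_prop : Continuous fun q : ℝ × E => (q.1 + t, q.2)),
      fun s => hf.lip _, fun s => hf.bdd _, hf.K_nonneg, hf.C_nonneg⟩
  obtain ⟨Z, hZ0, hZ⟩ := hg.exists_solution_zero x
  refine ⟨fun s => Z (s - t), by simpa using hZ0, fun s => ?_⟩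
  have h := (hZ (s - t)).scomp s ((hasDerivAt_id s).sub_const t)
  simpa [Function.comp_def] using h

theorem gronwall_right {D D' : ℝ → E} {K ε a b : ℝ} (hab : a ≤ b)
    (hD : ∀ s ∈ Icc a b, HasDerivWithinAt D (D' s) (Icc a b) s)
    (hb : ∀ s ∈ Icc a b, ‖D' s‖ ≤ K * ‖D s‖ + ε) :
    ‖D b‖ ≤ gronwallBound ‖D a‖ K ε (b - a) :=
  norm_le_gronwallBound_of_norm_deriv_right_le
    (fun s hs => (hD s hs).continuousWithinAt)
    (fun s hs => (hD s ⟨hs.1, hs.2.le⟩).mono_of_mem_nhdsWithin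
      (Icc_mem_nhdsGE_of_mem hs)) le_rfl
    (fun s hs => hb s ⟨hs.1, hs.2.le⟩) b ⟨hab, le_rfl⟩

theorem gronwall_left {D D' : ℝ → E} {K ε a b : ℝ} (hab : a ≤ b)
    (hD : ∀ s ∈ Icc a b, HasDerivWithinAt D (D' s) (Icc a b) s)
    (hb : ∀ s ∈ Icc a b, ‖D' s‖ ≤ K * ‖D s‖ + ε) :
    ‖D a‖ ≤ gronwallBound ‖D b‖ K ε (b - a) := by
  have hm : ∀ s ∈ Icc a b, a + b - s ∈ Icc a b := fun s hs =>
    ⟨by linarith [hs.2], by linarith [hs.1]⟩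
  have := gronwall_right (D := fun s => D (a + b - s)) (D' := fun s => -D' (a + b - s))
    (K := K) (ε := ε) hab
    (fun s hs => by
      have h := (hD (a + b - s) (hm s hs)).scomp s
        (((hasDerivWithinAt_id s (Icc a b)).const_sub (a + b))) (fun r hr => hm r hr)
      simpa [Function.comp_def] using h)
    (fun s hs => by simpa using hb _ (hm s hs))
  simpa using this

theorem gronwall_abs {D D' : ℝ → E} {K ε t : ℝ} (s : ℝ)
    (hD : ∀ r ∈ uIcc s t, HasDerivWithinAt D (D' r) (uIcc s t) r)
    (hb : ∀ r ∈ uIcc s t, ‖D' r‖ ≤ K * ‖D r‖ + ε) :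
    ‖D s‖ ≤ gronwallBound ‖D t‖ K ε |s - t| := by
  rcases le_total s t with h | h
  · rw [uIcc_of_le h] at hD hb
    rw [abs_of_nonpos (by linarith), neg_sub]
    exact gronwall_left h hD hb
  · rw [uIcc_of_ge h] at hD hb
    rw [abs_of_nonneg (by linarith)]
    exact gronwall_right h hD hb

/-- Uniqueness, allowing the solutions to be defined only between the two times. -/
theorem LipField.eq_of_solution {f : ℝ → E → E} {K C : ℝ} (hf : LipField f K C) {Y Z : ℝ → E}
    {s t : ℝ} (hY : ∀ r ∈ uIcc s t, HasDerivWithinAt Y (f r (Y r)) (uIcc s t) r)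
    (hZ : ∀ r ∈ uIcc s t, HasDerivWithinAt Z (f r (Z r)) (uIcc s t) r) (h : Y t = Z t) :
    Y s = Z s := by
  have := gronwall_abs (D := fun r => Y r - Z r) (K := K) (ε := 0) s
    (fun r hr => (hY r hr).sub (hZ r hr)) (fun r _ => by simpa using hf.lip r _ _)
  simp only [h, sub_self, norm_zero, gronwallBound_ε0_δ0] at this
  exact sub_eq_zero.mp (norm_le_zero_iff.mp this)

open Classical in
/-- `flow f s t x` is the position at time `s` of the trajectory of `f` through `(t, x)`. -/
noncomputable def flow (f : ℝ → E → E) (s t : ℝ) (x : E) : E :=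
  -- For a `LipField` on a complete space a trajectory always exists, so the default `x` is never
  -- used there.
  if h : ∃ Z : ℝ → E, Z t = x ∧ ∀ s, HasDerivAt Z (f s (Z s)) s then h.choose s else x

section

variable [CompleteSpace E] {f : ℝ → E → E} {K C : ℝ}

theorem LipField.flow_spec (hf : LipField f K C) (t : ℝ) (x : E) :
    flow f t t x = x ∧ ∀ s, HasDerivAt (fun s => flow f s t x) (f s (flow f s t x)) s := by
  have h := hf.exists_solution t x
  have h1 : (fun s => flow f s t x) = h.choose := by funext s; simp [flow, dif_pos h]
  have h2 : ∀ s, flow f s t x = h.choose s := fun s => congrFun h1 s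
  refine ⟨by rw [h2]; exact h.choose_spec.1, fun s => ?_⟩
  rw [h1, h2]; exact h.choose_spec.2 s

theorem LipField.flow_self (hf : LipField f K C) (t : ℝ) (x : E) : flow f t t x = x :=
  (hf.flow_spec t x).1

theorem LipField.hasDerivAt_flow (hf : LipField f K C) (s t : ℝ) (x : E) :
    HasDerivAt (fun s => flow f s t x) (f s (flow f s t x)) s :=
  (hf.flow_spec t x).2 s

theorem LipField.eq_flow (hf : LipField f K C) {Y : ℝ → E} {s t : ℝ}
    (hY : ∀ r ∈ uIcc s t, HasDerivWithinAt Y (f r (Y r)) (uIcc s t) r) :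
    Y s = flow f s t (Y t) :=
  hf.eq_of_solution hY (fun r _ => (hf.hasDerivAt_flow r t (Y t)).hasDerivWithinAt)
    (hf.flow_self t _).symm

theorem LipField.flow_flow (hf : LipField f K C) (s r t : ℝ) (x : E) :
    flow f s r (flow f r t x) = flow f s t x :=
  (hf.eq_flow (Y := fun s => flow f s t x)
    fun r _ => (hf.hasDerivAt_flow r t x).hasDerivWithinAt).symm

/-- Joint continuity of the flow in times, initial point and a parameter. -/
theorem continuous_flow_param {P : Type*} [TopologicalSpace P] {F : P → ℝ → E → E}
    (hF : ∀ p, LipField (F p) K C) (hc : Continuous fun q : P × ℝ × E => F q.1 q.2.1 q.2.2) :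
    Continuous fun q : P × ℝ × ℝ × E => flow (F q.1) q.2.1 q.2.2.1 q.2.2.2 := by
  rw [continuous_iff_continuousAt]
  rintro ⟨p₀, s₀, t₀, x₀⟩
  set Z₀ : ℝ → E := fun s => flow (F p₀) s t₀ x₀ with hZ₀
  have hZ₀d : ∀ s, HasDerivAt Z₀ (F p₀ s (Z₀ s)) s := fun s => (hF p₀).hasDerivAt_flow s t₀ x₀
  have hZ₀c : Continuous Z₀ := continuous_iff_continuousAt.2 fun s => (hZ₀d s).continuousAt
  set R : ℝ := |s₀| + |t₀| + 1 with hR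
  set J : Set ℝ := Icc (-R) R with hJ
  -- The fields are close only along the reference trajectory `Z₀` over the compact time interval
  -- `J`. This suffices for Gronwall, since the distance from `Z₀` is controlled by the common
  -- Lipschitz constant.
  have hsmall : ∀ ε > 0, ∀ᶠ p in 𝓝 p₀, ∀ r ∈ J, ‖F p r (Z₀ r) - F p₀ r (Z₀ r)‖ < ε := by
    intro ε hε
    refine isCompact_Icc.eventually_forall_of_forall_eventually fun r _ => ?_
    have hcont : Continuous fun q : P × ℝ => ‖F q.1 q.2 (Z₀ q.2) - F p₀ q.2 (Z₀ q.2)‖ := by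
      refine ((hc.comp (by fun_prop : Continuous fun q : P × ℝ => (q.1, q.2, Z₀ q.2))).sub
        (hc.comp (by fun_prop : Continuous fun q : P × ℝ => (p₀, q.2, Z₀ q.2)))).norm
    have := (hcont.tendsto (p₀, r)).eventually_lt_const (u := ε) (by simpa using hε)
    exact this
  have hmain : ∀ ε > 0, ∀ᶠ q : P × ℝ × ℝ × E in 𝓝 (p₀, s₀, t₀, x₀),
      ‖flow (F q.1) q.2.1 q.2.2.1 q.2.2.2 - Z₀ q.2.1‖ ≤
        gronwallBound ‖q.2.2.2 - Z₀ q.2.2.1‖ K ε |q.2.1 - q.2.2.1| := by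
    intro ε hε
    have e1 : ∀ᶠ q : P × ℝ × ℝ × E in 𝓝 (p₀, s₀, t₀, x₀), ∀ r ∈ J,
        ‖F q.1 r (Z₀ r) - F p₀ r (Z₀ r)‖ < ε :=
      (continuous_fst.tendsto (p₀, s₀, t₀, x₀)).eventually (hsmall ε hε)
    have e2 : ∀ᶠ q : P × ℝ × ℝ × E in 𝓝 (p₀, s₀, t₀, x₀), q.2.1 ∈ J :=
      (by fun_prop : Continuous fun q : P × ℝ × ℝ × E => q.2.1).continuousAt.eventually
        (Icc_mem_nhds (by simp only [hR]; linarith [neg_abs_le s₀, abs_nonneg t₀])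
          (by simp only [hR]; linarith [le_abs_self s₀, abs_nonneg t₀]))
    have e3 : ∀ᶠ q : P × ℝ × ℝ × E in 𝓝 (p₀, s₀, t₀, x₀), q.2.2.1 ∈ J :=
      (by fun_prop : Continuous fun q : P × ℝ × ℝ × E => q.2.2.1).continuousAt.eventually
        (Icc_mem_nhds (by simp only [hR]; linarith [neg_abs_le t₀, abs_nonneg s₀])
          (by simp only [hR]; linarith [le_abs_self t₀, abs_nonneg s₀]))
    filter_upwards [e1, e2, e3] with q h1 h2 h3
    obtain ⟨p, s, t, x⟩ := q
    have hsub : uIcc s t ⊆ J := uIcc_subset_Icc h2 h3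
    have := gronwall_abs (D := fun r => flow (F p) r t x - Z₀ r) (K := K) (ε := ε) (t := t) s
      (fun r _ => (((hF p).hasDerivAt_flow r t x).sub (hZ₀d r)).hasDerivWithinAt)
      (fun r hr => by
        calc ‖F p r (flow (F p) r t x) - F p₀ r (Z₀ r)‖
            ≤ ‖F p r (flow (F p) r t x) - F p r (Z₀ r)‖ + ‖F p r (Z₀ r) - F p₀ r (Z₀ r)‖ :=
              norm_sub_le_norm_sub_add_norm_sub _ _ _
          _ ≤ _ := add_le_add ((hF p).lip _ _ _) (h1 r (hsub hr)).le)
    simpa [(hF p).flow_self] using this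
  have hgb : ∀ η > 0, ∃ ε > 0, gronwallBound ε K ε (|s₀ - t₀| + 1) < η := by
    intro η hη
    have hcont : ContinuousAt (fun ε : ℝ => gronwallBound ε K ε (|s₀ - t₀| + 1)) 0 := by
      by_cases hK : K = 0
      · simp only [hK, gronwallBound_K0]; fun_prop
      · simp only [gronwallBound_of_K_ne_0 hK]; fun_prop
    have h0 : gronwallBound 0 K 0 (|s₀ - t₀| + 1) = 0 := by simp [gronwallBound_ε0_δ0]
    have := hcont.eventually_lt_const (u := η) (by simpa [h0] using hη)
    obtain ⟨ε, hε, h⟩ := Metric.eventually_nhds_iff.1 this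
    exact ⟨ε / 2, by linarith, h (by
      rw [Real.dist_eq, sub_zero, abs_of_pos (half_pos hε)]; linarith)⟩
  have hKn : 0 ≤ K := (hF p₀).K_nonneg
  rw [ContinuousAt, Metric.tendsto_nhds]
  intro η hη
  obtain ⟨ε, hε, hεη⟩ := hgb (η / 2) (by linarith)
  have f1 : ∀ᶠ q : P × ℝ × ℝ × E in 𝓝 (p₀, s₀, t₀, x₀), ‖q.2.2.2 - Z₀ q.2.2.1‖ < ε := by
    have hcont : Continuous fun q : P × ℝ × ℝ × E => ‖q.2.2.2 - Z₀ q.2.2.1‖ := by fun_prop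
    refine (hcont.tendsto (p₀, s₀, t₀, x₀)).eventually_lt_const ?_
    simpa [hZ₀, (hF p₀).flow_self] using hε
  have f2 : ∀ᶠ q : P × ℝ × ℝ × E in 𝓝 (p₀, s₀, t₀, x₀), |q.2.1 - q.2.2.1| < |s₀ - t₀| + 1 := by
    have hcont : Continuous fun q : P × ℝ × ℝ × E => |q.2.1 - q.2.2.1| := by fun_prop
    exact (hcont.tendsto (p₀, s₀, t₀, x₀)).eventually_lt_const (by simp)
  have f3 : ∀ᶠ q : P × ℝ × ℝ × E in 𝓝 (p₀, s₀, t₀, x₀), ‖Z₀ q.2.1 - Z₀ s₀‖ < η / 2 := by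
    have hcont : Continuous fun q : P × ℝ × ℝ × E => ‖Z₀ q.2.1 - Z₀ s₀‖ := by fun_prop
    exact (hcont.tendsto (p₀, s₀, t₀, x₀)).eventually_lt_const (by simp; linarith)
  filter_upwards [hmain ε hε, f1, f2, f3] with q h1 h2 h3 h4
  rw [dist_eq_norm]
  have hmono : gronwallBound ‖q.2.2.2 - Z₀ q.2.2.1‖ K ε |q.2.1 - q.2.2.1| ≤
      gronwallBound ε K ε (|s₀ - t₀| + 1) := by
    refine (gronwallBound_mono (norm_nonneg _) hε.le hKn h3.le).trans ?_
    unfold gronwallBound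
    split_ifs
    · linarith
    · gcongr
  calc ‖flow (F q.1) q.2.1 q.2.2.1 q.2.2.2 - Z₀ s₀‖
      ≤ ‖flow (F q.1) q.2.1 q.2.2.1 q.2.2.2 - Z₀ q.2.1‖ + ‖Z₀ q.2.1 - Z₀ s₀‖ :=
        norm_sub_le_norm_sub_add_norm_sub _ _ _
    _ < η := by linarith

theorem LipField.continuous_flow (hf : LipField f K C) :
    Continuous fun q : ℝ × ℝ × E => flow f q.1 q.2.1 q.2.2 :=
  (continuous_flow_param (F := fun _ : Unit => f) (fun _ => hf)
    (hf.cont.comp (by fun_prop : Continuous fun q : Unit × ℝ × E => (q.2.1, q.2.2)))).comp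
    (by fun_prop : Continuous fun q : ℝ × ℝ × E => ((), q.1, q.2.1, q.2.2))

end

end ODE

end BoussinesqModel

namespace BoussinesqModel

/-! ### Differentiability of the flow in the initial point. -/

section SmoothFlow

variable {E : Type*} [NormedAddCommGroup E] [NormedSpace ℝ E]

/-- A vector field which is continuously differentiable in space with bounded derivative `f'`. -/
structure SmoothField (f : ℝ → E → E) (f' : ℝ → E → E →L[ℝ] E) (K C : ℝ) : Prop where
  cont : Continuous fun q : ℝ × E => f q.1 q.2
  deriv : ∀ t x, HasFDerivAt (f t) (f' t x) x
  cont' : Continuous fun q : ℝ × E => f' q.1 q.2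
  bound : ∀ t x, ‖f' t x‖ ≤ K
  bdd : ∀ t, ‖f t 0‖ ≤ C

variable {f : ℝ → E → E} {f' : ℝ → E → E →L[ℝ] E} {K C : ℝ}

theorem SmoothField.lipField (hf : SmoothField f f' K C) : LipField f K C where
  cont := hf.cont
  lip t x y := Convex.norm_image_sub_le_of_norm_hasFDerivWithin_le
    (fun z _ => (hf.deriv t z).hasFDerivWithinAt) (fun z _ => hf.bound t z) convex_univ
    (mem_univ y) (mem_univ x)
  bdd := hf.bdd
  K_nonneg := (norm_nonneg _).trans (hf.bound 0 0)
  C_nonneg := (norm_nonneg _).trans (hf.bdd 0)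

/-- The derivative of the field averaged over a segment. -/
noncomputable def meanDeriv (f' : ℝ → E → E →L[ℝ] E) (s : ℝ) (x y : E) : E →L[ℝ] E :=
  ∫ θ in (0 : ℝ)..1, f' s (x + θ • (y - x))

theorem SmoothField.continuous_meanDeriv (hf : SmoothField f f' K C) :
    Continuous fun q : ℝ × E × E => meanDeriv f' q.1 q.2.1 q.2.2 := by
  refine intervalIntegral.continuous_parametric_intervalIntegral_of_continuous' ?_ 0 1
  exact hf.cont'.comp (by fun_prop : Continuous fun q : (ℝ × E × E) × ℝ =>
    (q.1.1, q.1.2.1 + q.2 • (q.1.2.2 - q.1.2.1)))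

theorem SmoothField.continuous_meanDeriv_comp (hf : SmoothField f f' K C) {X : Type*}
    [TopologicalSpace X] {a : X → ℝ} {b c : X → E} (ha : Continuous a) (hb : Continuous b)
    (hc : Continuous c) : Continuous fun q => meanDeriv f' (a q) (b q) (c q) :=
  hf.continuous_meanDeriv.comp (ha.prodMk (hb.prodMk hc))

theorem SmoothField.norm_meanDeriv_le (hf : SmoothField f f' K C) (s : ℝ) (x y : E) :
    ‖meanDeriv f' s x y‖ ≤ K := by
  have := intervalIntegral.norm_integral_le_of_norm_le_const (a := 0) (b := 1) (C := K)
    (f := fun θ : ℝ => f' s (x + θ • (y - x))) (fun θ _ => hf.bound _ _)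
  simpa [meanDeriv] using this

theorem SmoothField.sub_eq_meanDeriv [CompleteSpace E] (hf : SmoothField f f' K C) (s : ℝ)
    (x y : E) : f s y - f s x = meanDeriv f' s x y (y - x) := by
  have hc : Continuous fun θ : ℝ => f' s (x + θ • (y - x)) :=
    hf.cont'.comp (by fun_prop : Continuous fun θ : ℝ => (s, x + θ • (y - x)))
  have h1 : ∀ θ : ℝ, HasDerivAt (fun θ : ℝ => f s (x + θ • (y - x)))
      (f' s (x + θ • (y - x)) (y - x)) θ := by
    intro θ
    refine (hf.deriv s _).comp_hasDerivAt θ ?_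
    simpa using ((hasDerivAt_id θ).smul_const (y - x)).const_add x
  have h2 := intervalIntegral.integral_eq_sub_of_hasDerivAt (a := 0) (b := 1) (fun θ _ => h1 θ)
    ((hc.clm_apply continuous_const).intervalIntegrable 0 1)
  rw [meanDeriv, ContinuousLinearMap.intervalIntegral_apply (hc.intervalIntegrable 0 1), h2]
  simp

theorem lipField_comp_left {A : ℝ → E →L[ℝ] E} (hA : Continuous A) (hK : ∀ s, ‖A s‖ ≤ K) :
    LipField (fun s (W : E →L[ℝ] E) => (A s).comp W) K 0 where
  cont := (hA.comp continuous_fst).clm_comp continuous_snd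
  lip t x y := by
    rw [← ContinuousLinearMap.comp_sub]
    exact (ContinuousLinearMap.opNorm_comp_le _ _).trans
      (mul_le_mul_of_nonneg_right (hK t) (norm_nonneg _))
  bdd t := by simp
  K_nonneg := (norm_nonneg _).trans (hK 0)
  C_nonneg := le_rfl

variable [CompleteSpace E]

/-- The operator relating the difference of two trajectories to the difference of their
initial points. -/
noncomputable def flowSlope (f : ℝ → E → E) (f' : ℝ → E → E →L[ℝ] E) (s t : ℝ) (x y : E) :
    E →L[ℝ] E :=
  flow (fun r (W : E →L[ℝ] E) => (meanDeriv f' r (flow f r t x) (flow f r t y)).comp W) s t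
    (ContinuousLinearMap.id ℝ E)

theorem SmoothField.slope_field (hf : SmoothField f f' K C) (t : ℝ) (x y : E) :
    LipField (fun r (W : E →L[ℝ] E) =>
      (meanDeriv f' r (flow f r t x) (flow f r t y)).comp W) K 0 := by
  have hfl := hf.lipField.continuous_flow
  exact lipField_comp_left (hf.continuous_meanDeriv_comp continuous_id
    (hfl.comp (by fun_prop : Continuous fun r : ℝ => (r, t, x)))
    (hfl.comp (by fun_prop : Continuous fun r : ℝ => (r, t, y))))
    fun s => hf.norm_meanDeriv_le _ _ _

theorem SmoothField.continuous_flowSlope (hf : SmoothField f f' K C) :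
    Continuous fun q : ℝ × ℝ × E × E => flowSlope f f' q.1 q.2.1 q.2.2.1 q.2.2.2 := by
  have hfl := hf.lipField.continuous_flow
  have h := continuous_flow_param (P := ℝ × E × E)
    (F := fun p r (W : E →L[ℝ] E) =>
      (meanDeriv f' r (flow f r p.1 p.2.1) (flow f r p.1 p.2.2)).comp W)
    (fun p => hf.slope_field p.1 p.2.1 p.2.2) (by
      refine Continuous.clm_comp (hf.continuous_meanDeriv_comp (by fun_prop) ?_ ?_)
        (by fun_prop)
      · exact hfl.comp (by fun_prop : Continuous fun q : (ℝ × E × E) × ℝ × (E →L[ℝ] E) =>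
          (q.2.1, q.1.1, q.1.2.1))
      · exact hfl.comp (by fun_prop : Continuous fun q : (ℝ × E × E) × ℝ × (E →L[ℝ] E) =>
          (q.2.1, q.1.1, q.1.2.2)))
  exact h.comp (by fun_prop : Continuous fun q : ℝ × ℝ × E × E =>
    (((q.2.1, q.2.2.1, q.2.2.2), q.1, q.2.1, ContinuousLinearMap.id ℝ E) :
      (ℝ × E × E) × ℝ × ℝ × (E →L[ℝ] E)))

/-- By the mean value formula, the difference of two trajectories solves exactly a linear equation
whose coefficient is the averaged derivative between them. Uniqueness identifies it with the linear
flow applied to the initial difference. -/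
theorem SmoothField.flow_sub_flow (hf : SmoothField f f' K C) (s t : ℝ) (x y : E) :
    flow f s t y - flow f s t x = flowSlope f f' s t x y (y - x) := by
  have hL := hf.slope_field t x y
  have hW : ∀ r, HasDerivAt (fun r => flowSlope f f' r t x y (y - x))
      (meanDeriv f' r (flow f r t x) (flow f r t y) (flowSlope f f' r t x y (y - x))) r := by
    intro r
    have h := hL.hasDerivAt_flow r t (ContinuousLinearMap.id ℝ E)
    simpa [flowSlope] using h.clm_apply (hasDerivAt_const r (y - x))
  have hg : LipField (fun r (v : E) => meanDeriv f' r (flow f r t x) (flow f r t y) v) K 0 := by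
    refine ⟨?_, fun s u v => ?_, fun s => by simp, hf.lipField.K_nonneg, le_rfl⟩
    · exact Continuous.clm_apply (hf.continuous_meanDeriv_comp continuous_fst
        (hf.lipField.continuous_flow.comp
          (by fun_prop : Continuous fun q : ℝ × E => (q.1, t, x)))
        (hf.lipField.continuous_flow.comp
          (by fun_prop : Continuous fun q : ℝ × E => (q.1, t, y)))) (by fun_prop)
    · rw [← map_sub]
      exact ContinuousLinearMap.le_of_opNorm_le _ (hf.norm_meanDeriv_le _ _ _) _
  refine hg.eq_of_solution (Y := fun s => flow f s t y - flow f s t x)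
    (Z := fun r => flowSlope f f' r t x y (y - x)) (s := s) (t := t) (fun r _ => ?_)
    (fun r _ => (hW r).hasDerivWithinAt) ?_
  · have h := ((hf.lipField.hasDerivAt_flow r t y).sub
      (hf.lipField.hasDerivAt_flow r t x)).hasDerivWithinAt (s := uIcc s t)
    rwa [hf.sub_eq_meanDeriv] at h
  · simp [hf.lipField.flow_self, flowSlope, hL.flow_self]

/-- The slope operator represents the increment exactly and is continuous in both points, so its
value on the diagonal is the derivative; no remainder of a variational equation has to be estimated.
-/
theorem SmoothField.hasFDerivAt_flow (hf : SmoothField f f' K C) (s t : ℝ) (x : E) :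
    HasFDerivAt (flow f s t) (flowSlope f f' s t x x) x := by
  rw [hasFDerivAt_iff_isLittleO]
  have hc : Continuous fun y => flowSlope f f' s t x y - flowSlope f f' s t x x :=
    (hf.continuous_flowSlope.comp (by fun_prop : Continuous fun y => (s, t, x, y))).sub
      continuous_const
  rw [Asymptotics.isLittleO_iff]
  intro ε hε
  have h := (hc.norm.tendsto x).eventually_lt_const (u := ε) (by simpa using hε)
  filter_upwards [h] with y hy
  rw [hf.flow_sub_flow, ← sub_apply]
  exact ContinuousLinearMap.le_of_opNorm_le _ hy.le _

end SmoothFlow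

end BoussinesqModel

namespace BoussinesqModel

/-! ### Sector integrals gain one derivative. -/

section SectorIntegral

/-- The integral of `g` over the translated sector `x + S_α`. -/
noncomputable def sectorIntegral (α : ℝ) (g : ℝ × ℝ → ℝ) (x : ℝ × ℝ) : ℝ :=
  ∫ y in {y : ℝ × ℝ | y - x ∈ sector α}, g y

theorem isClosed_translate_sector (α : ℝ) (x : ℝ × ℝ) :
    IsClosed {y : ℝ × ℝ | y - x ∈ sector α} := by
  have : {y : ℝ × ℝ | y - x ∈ sector α} =
      {y | 0 ≤ (y - x).1} ∩ ({y | 0 ≤ (y - x).2} ∩ {y | (y - x).2 ≤ α * (y - x).1}) := rfl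
  rw [this]
  exact (isClosed_le (by fun_prop) (by fun_prop)).inter
    ((isClosed_le (by fun_prop) (by fun_prop)).inter (isClosed_le (by fun_prop) (by fun_prop)))

theorem measurableSet_translate_sector (α : ℝ) (x : ℝ × ℝ) :
    MeasurableSet {y : ℝ × ℝ | y - x ∈ sector α} :=
  (isClosed_translate_sector α x).measurableSet

theorem integral_Ici_eq_intervalIntegral {h : ℝ → ℝ} {R : ℝ} (hh : ∀ s, R < s → h s = 0) (a : ℝ) :
    ∫ s in Ici a, h s = ∫ s in a..R, h s := by
  rw [integral_Ici_eq_integral_Ioi]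
  rcases le_total a R with haR | haR
  · rw [intervalIntegral.integral_of_le haR]
    refine setIntegral_eq_of_subset_of_forall_sdiff_eq_zero measurableSet_Ioi
      (fun s hs => hs.1) (fun s hs => hh s ?_)
    by_contra hle
    exact hs.2 ⟨hs.1, not_lt.1 hle⟩
  · rw [intervalIntegral.integral_of_ge haR,
      setIntegral_eq_zero_of_forall_eq_zero (t := Ioi a) (fun s hs => hh s (haR.trans_lt hs)),
      setIntegral_eq_zero_of_forall_eq_zero (t := Ioc R a) (fun s hs => hh s hs.1), neg_zero]

/-- Integration over `[ξ, R] × [ζ, R]`, with the second variable outermost. -/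
noncomputable def cornerIntegral (h : ℝ × ℝ → ℝ) (R : ℝ) (p : ℝ × ℝ) : ℝ :=
  ∫ τ in p.2..R, ∫ σ in p.1..R, h (σ, τ)

/-- The shear σ = y₁ - y₂/α, τ = y₂ turns the translated sector into a translated quadrant. On the
support σ ≤ R + R/α, which gives the upper limit of integration. -/
theorem sectorIntegral_eq_cornerIntegral {α : ℝ} (hα : 0 < α) {g : ℝ × ℝ → ℝ} (hg : Continuous g)
    {R : ℝ} (hR : 0 ≤ R) (hs : ∀ y : ℝ × ℝ, R < |y.1| ∨ R < |y.2| → g y = 0) (x : ℝ × ℝ) :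
    sectorIntegral α g x =
      cornerIntegral (fun p => g (p.1 + p.2 / α, p.2)) (R + R / α) (x.1 - x.2 / α, x.2) := by
  have hcs : HasCompactSupport g := by
    refine HasCompactSupport.intro (isCompact_Icc.prod isCompact_Icc :
      IsCompact (Icc (-R) R ×ˢ Icc (-R) R)) fun y hy => hs y ?_
    by_contra hcon
    push Not at hcon
    exact hy ⟨abs_le.1 hcon.1, abs_le.1 hcon.2⟩
  have hint : Integrable g := hg.integrable_of_hasCompactSupport hcs
  have hR' : R ≤ R + R / α := le_add_of_nonneg_right (by positivity)
  have hms := measurableSet_translate_sector α x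
  rw [sectorIntegral, ← integral_indicator hms, Measure.volume_eq_prod,
    integral_prod_symm _ (by rw [← Measure.volume_eq_prod]; exact hint.indicator hms)]
  have hind : ∀ σ τ : ℝ, indicator {y : ℝ × ℝ | y - x ∈ sector α} g (σ + τ / α, τ) =
      indicator (Ici x.2) (fun τ => indicator (Ici (x.1 - x.2 / α))
        (fun σ => g (σ + τ / α, τ)) σ) τ := by
    intro σ τ
    have hiff : (σ + τ / α, τ) ∈ {y : ℝ × ℝ | y - x ∈ sector α} ↔
        τ ∈ Ici x.2 ∧ σ ∈ Ici (x.1 - x.2 / α) := by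
      simp only [sector, mem_ofPred_eq, Prod.fst_sub, Prod.snd_sub, mem_Ici]
      have e : α * (σ + τ / α - x.1) = α * (σ - (x.1 - x.2 / α)) + (τ - x.2) := by
        field_simp; ring
      rw [e]
      constructor
      · rintro ⟨h1, h2, h3⟩
        refine ⟨by linarith, ?_⟩
        have : 0 ≤ α * (σ - (x.1 - x.2 / α)) := by linarith
        have := nonneg_of_mul_nonneg_right this hα
        linarith
      · rintro ⟨h1, h2⟩
        have h4 : x.2 / α ≤ τ / α := by gcongr
        exact ⟨by linarith, by linarith, by
          have := mul_nonneg hα.le (sub_nonneg.2 h2); linarith⟩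
    by_cases h1 : τ ∈ Ici x.2 <;> by_cases h2 : σ ∈ Ici (x.1 - x.2 / α) <;>
      simp [indicator, hiff, h1, h2]
  have hinner : ∀ τ : ℝ, ∫ σ, indicator {y : ℝ × ℝ | y - x ∈ sector α} g (σ, τ) =
      indicator (Ici x.2) (fun τ => ∫ σ in (x.1 - x.2 / α)..(R + R / α), g (σ + τ / α, τ)) τ := by
    intro τ
    rw [← integral_add_right_eq_self _ (τ / α)]
    simp_rw [hind]
    by_cases h1 : τ ∈ Ici x.2
    · simp only [indicator_of_mem h1]
      rw [integral_indicator measurableSet_Ici]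
      refine integral_Ici_eq_intervalIntegral (fun s hs' => hs _ ?_) _
      by_contra hcon
      push Not at hcon
      obtain ⟨h3, h4⟩ := hcon
      have h5 : -(R / α) ≤ τ / α := by
        rw [← neg_div]; have := (abs_le.1 h4).1; gcongr
      have := (abs_le.1 h3).2
      linarith
    · simp [indicator_of_notMem h1]
  simp_rw [hinner]
  rw [integral_indicator measurableSet_Ici]
  refine integral_Ici_eq_intervalIntegral (fun s hs' => ?_) _
  have : ∀ σ : ℝ, g (σ + s / α, s) = 0 := fun σ =>
    hs _ (Or.inr ((hR'.trans_lt hs').trans_le (le_abs_self _)))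
  simp [this]

variable {h : ℝ → ℝ × ℝ → ℝ} {R : ℝ}

theorem continuous_integral_snd (hh : Continuous fun q : ℝ × ℝ × ℝ => h q.1 q.2) :
    Continuous fun q : ℝ × ℝ × ℝ => ∫ τ in q.2.2..R, h q.1 (q.2.1, τ) := by
  have := intervalIntegral.continuous_parametric_primitive_of_continuous (μ := volume) (a₀ := R)
    (f := fun (q : ℝ × ℝ) τ => h q.1 (q.2, τ))
    (hh.comp (by fun_prop : Continuous fun q : (ℝ × ℝ) × ℝ => (q.1.1, q.1.2, q.2)))
  have h2 := (this.comp (by fun_prop : Continuous fun q : ℝ × ℝ × ℝ => ((q.1, q.2.1), q.2.2))).neg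
  refine h2.congr fun q => ?_
  simp [intervalIntegral.integral_symm R]

theorem continuous_integral_fst (hh : Continuous fun q : ℝ × ℝ × ℝ => h q.1 q.2) :
    Continuous fun q : ℝ × ℝ × ℝ => ∫ σ in q.2.1..R, h q.1 (σ, q.2.2) :=
  (continuous_integral_snd (h := fun t p => h t (p.2, p.1))
    (hh.comp (by fun_prop : Continuous fun q : ℝ × ℝ × ℝ => (q.1, q.2.2, q.2.1)))).comp
    (by fun_prop : Continuous fun q : ℝ × ℝ × ℝ => (q.1, q.2.2, q.2.1))

theorem cornerIntegral_swap {h : ℝ × ℝ → ℝ} (hh : Continuous h) (p : ℝ × ℝ) :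
    cornerIntegral h R p = ∫ σ in p.1..R, ∫ τ in p.2..R, h (σ, τ) := by
  have : IntegrableOn (Function.uncurry fun τ σ => h (σ, τ)) (uIcc p.2 R ×ˢ uIcc p.1 R)
      (volume.prod volume) := by
    refine ContinuousOn.integrableOn_compact (isCompact_uIcc.prod isCompact_uIcc) ?_
    exact (hh.comp (by fun_prop : Continuous fun q : ℝ × ℝ => (q.2, q.1))).continuousOn
  exact intervalIntegral_intervalIntegral_swap
    (this.mono_set (prod_mono uIoc_subset_uIcc uIoc_subset_uIcc))

/-- The derivative of `cornerIntegral`. -/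
noncomputable def cornerDeriv (h : ℝ × ℝ → ℝ) (R : ℝ) (p : ℝ × ℝ) : ℝ × ℝ →L[ℝ] ℝ :=
  -((∫ τ in p.2..R, h (p.1, τ)) • ContinuousLinearMap.fst ℝ ℝ ℝ +
    (∫ σ in p.1..R, h (σ, p.2)) • ContinuousLinearMap.snd ℝ ℝ ℝ)

theorem hasDerivAt_integral_left {u : ℝ → ℝ} (hu : Continuous u) (a : ℝ) :
    HasDerivAt (fun a => ∫ s in a..R, u s) (-u a) a :=
  intervalIntegral.integral_hasDerivAt_left (hu.intervalIntegrable _ _)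
    (hu.stronglyMeasurableAtFilter _ _) hu.continuousAt

/-- Each partial derivative is minus a one-dimensional integral over an edge, by the fundamental
theorem after Fubini. Both are continuous for merely continuous `h`, so they combine to a Fréchet
derivative. This is the regularity gain behind the local theory. -/
theorem hasFDerivAt_cornerIntegral {h : ℝ × ℝ → ℝ} (hh : Continuous h) (p : ℝ × ℝ) :
    HasFDerivAt (cornerIntegral h R) (cornerDeriv h R p) p := by
  have c1 := continuous_integral_fst (R := R) (h := fun _ => h) (hh.comp continuous_snd)
  have c2 := continuous_integral_snd (R := R) (h := fun _ => h) (hh.comp continuous_snd)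
  have hc1 : Continuous fun q : ℝ × ℝ => ∫ σ in q.1..R, h (σ, q.2) :=
    c1.comp (by fun_prop : Continuous fun q : ℝ × ℝ => ((0 : ℝ), q))
  have hc2 : Continuous fun q : ℝ × ℝ => ∫ τ in q.2..R, h (q.1, τ) :=
    c2.comp (by fun_prop : Continuous fun q : ℝ × ℝ => ((0 : ℝ), q))
  have key := hasStrictFDerivAt_uncurry_coprod (𝕜 := ℝ) (u := p)
    (f := fun a b => cornerIntegral h R (a, b))
    (f₁ := fun a b => -(∫ τ in b..R, h (a, τ)) • ContinuousLinearMap.id ℝ ℝ)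
    (f₂ := fun a b => -(∫ σ in a..R, h (σ, b)) • ContinuousLinearMap.id ℝ ℝ)
    (Eventually.of_forall fun v => by
      have := hasDerivAt_integral_left (R := R)
        (u := fun σ => ∫ τ in v.2..R, h (σ, τ))
        (hc2.comp (by fun_prop : Continuous fun σ : ℝ => (σ, v.2))) v.1
      simp_rw [cornerIntegral_swap hh]
      refine this.hasFDerivAt.congr_fderiv ?_
      ext; simp [Function.HasUncurry.uncurry])
    (Eventually.of_forall fun v => by
      have := hasDerivAt_integral_left (R := R)
        (u := fun τ => ∫ σ in v.1..R, h (σ, τ))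
        (hc1.comp (by fun_prop : Continuous fun τ : ℝ => (v.1, τ))) v.2
      refine this.hasFDerivAt.congr_fderiv ?_
      ext; simp [Function.HasUncurry.uncurry])
    ((hc2.neg.smul continuous_const).continuousAt)
    ((hc1.neg.smul continuous_const).continuousAt)
  refine key.hasFDerivAt.congr_fderiv ?_
  ext <;> simp [cornerDeriv, Function.HasUncurry.uncurry]

/-- The derivative of `sectorIntegral` for a density supported in `[-R, R]²`. -/
noncomputable def sectorDeriv (α R : ℝ) (g : ℝ × ℝ → ℝ) (x : ℝ × ℝ) : ℝ × ℝ →L[ℝ] ℝ :=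
  (cornerDeriv (fun p => g (p.1 + p.2 / α, p.2)) (R + R / α) (x.1 - x.2 / α, x.2)).comp
    ((ContinuousLinearMap.fst ℝ ℝ ℝ - α⁻¹ • ContinuousLinearMap.snd ℝ ℝ ℝ).prod
      (ContinuousLinearMap.snd ℝ ℝ ℝ))

theorem hasFDerivAt_sectorIntegral {α : ℝ} (hα : 0 < α) {g : ℝ × ℝ → ℝ} (hg : Continuous g)
    {R : ℝ} (hR : 0 ≤ R) (hs : ∀ y : ℝ × ℝ, R < |y.1| ∨ R < |y.2| → g y = 0) (x : ℝ × ℝ) :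
    HasFDerivAt (sectorIntegral α g) (sectorDeriv α R g x) x := by
  have e : sectorIntegral α g = cornerIntegral (fun p => g (p.1 + p.2 / α, p.2)) (R + R / α) ∘
      ((ContinuousLinearMap.fst ℝ ℝ ℝ - α⁻¹ • ContinuousLinearMap.snd ℝ ℝ ℝ).prod
      (ContinuousLinearMap.snd ℝ ℝ ℝ)) := by
    funext x
    rw [sectorIntegral_eq_cornerIntegral hα hg hR hs]
    simp [div_eq_inv_mul]
  rw [e]
  refine HasFDerivAt.comp x ?_ (ContinuousLinearMap.hasFDerivAt _)
  have := hasFDerivAt_cornerIntegral (R := R + R / α) (h := fun p => g (p.1 + p.2 / α, p.2))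
    (hg.comp (by fun_prop)) (x.1 - x.2 / α, x.2)
  simpa [div_eq_inv_mul] using this

theorem continuous_sectorDeriv {α R : ℝ} {g : ℝ → ℝ × ℝ → ℝ}
    (hg : Continuous fun q : ℝ × ℝ × ℝ => g q.1 q.2) :
    Continuous fun q : ℝ × ℝ × ℝ => sectorDeriv α R (g q.1) q.2 := by
  have hh : Continuous fun q : ℝ × ℝ × ℝ => g q.1 (q.2.1 + q.2.2 / α, q.2.2) :=
    hg.comp (by fun_prop : Continuous fun q : ℝ × ℝ × ℝ => (q.1, q.2.1 + q.2.2 / α, q.2.2))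
  have c1 := (continuous_integral_fst (R := R + R / α)
    (h := fun t p => g t (p.1 + p.2 / α, p.2)) hh).comp
    (by fun_prop : Continuous fun q : ℝ × ℝ × ℝ => (q.1, q.2.1 - q.2.2 / α, q.2.2))
  have c2 := (continuous_integral_snd (R := R + R / α)
    (h := fun t p => g t (p.1 + p.2 / α, p.2)) hh).comp
    (by fun_prop : Continuous fun q : ℝ × ℝ × ℝ => (q.1, q.2.1 - q.2.2 / α, q.2.2))
  exact ((c2.smul continuous_const).add (c1.smul continuous_const)).neg.clm_comp continuous_const

theorem continuous_sectorIntegral {α : ℝ} (hα : 0 < α) {R : ℝ} (hR : 0 ≤ R) {g : ℝ → ℝ × ℝ → ℝ}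
    (hg : Continuous fun q : ℝ × ℝ × ℝ => g q.1 q.2)
    (hs : ∀ t, ∀ y : ℝ × ℝ, R < |y.1| ∨ R < |y.2| → g t y = 0) :
    Continuous fun q : ℝ × ℝ × ℝ => sectorIntegral α (g q.1) q.2 := by
  have hgt : ∀ t, Continuous (g t) := fun t => hg.comp (by fun_prop : Continuous fun y => (t, y))
  have e : (fun q : ℝ × ℝ × ℝ => sectorIntegral α (g q.1) q.2) = fun q : ℝ × ℝ × ℝ =>
      cornerIntegral (fun p => g q.1 (p.1 + p.2 / α, p.2)) (R + R / α)
        (q.2.1 - q.2.2 / α, q.2.2) := by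
    funext q
    exact sectorIntegral_eq_cornerIntegral hα (hgt _) hR (hs _) _
  rw [e]
  have hh : Continuous fun q : ℝ × ℝ × ℝ => g q.1 (q.2.1 + q.2.2 / α, q.2.2) :=
    hg.comp (by fun_prop : Continuous fun q : ℝ × ℝ × ℝ => (q.1, q.2.1 + q.2.2 / α, q.2.2))
  have c1 := continuous_integral_fst (R := R + R / α)
    (h := fun t p => g t (p.1 + p.2 / α, p.2)) hh
  have c := intervalIntegral.continuous_parametric_primitive_of_continuous (μ := volume)
    (a₀ := R + R / α) (f := fun (q : ℝ × ℝ) τ => ∫ σ in q.2..(R + R / α), g q.1 (σ + τ / α, τ))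
    (c1.comp (by fun_prop : Continuous fun q : (ℝ × ℝ) × ℝ => (q.1.1, q.1.2, q.2)))
  have h2 := (c.comp (by fun_prop :
    Continuous fun q : ℝ × ℝ × ℝ => ((q.1, q.2.1 - q.2.2 / α), q.2.2))).neg
  refine h2.congr fun q => ?_
  simp [cornerIntegral, intervalIntegral.integral_symm (R + R / α)]

/-- Edge integrals are bounded by `B` times an edge length, which grows linearly in x. The growth is
harmless later because the velocity carries a compactly supported factor. -/
theorem norm_sectorDeriv_le {α : ℝ} (hα : 0 < α) {R : ℝ} (hR : 0 ≤ R) {g : ℝ × ℝ → ℝ} {B : ℝ}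
    (hB : ∀ y, |g y| ≤ B) (x : ℝ × ℝ) :
    ‖sectorDeriv α R g x‖ ≤ B * (2 * (1 + α⁻¹) ^ 2 * (R + ‖x‖)) := by
  have hB0 : 0 ≤ B := (abs_nonneg _).trans (hB 0)
  have hx1 : |x.1| ≤ ‖x‖ := norm_fst_le x
  have hx2 : |x.2| ≤ ‖x‖ := norm_snd_le x
  have ha : 0 ≤ α⁻¹ := inv_nonneg.2 hα.le
  have hb : |x.2 / α| ≤ α⁻¹ * ‖x‖ := by
    rw [div_eq_inv_mul, abs_mul, abs_of_nonneg ha]; gcongr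
  have hbase : ∀ (a b : ℝ) (c : ℝ → ℝ × ℝ), |∫ τ in a..b, g (c τ)| ≤ B * |b - a| := fun a b c =>
    intervalIntegral.norm_integral_le_of_norm_le_const (f := fun τ => g (c τ)) (fun _ _ => hB _)
  have i1 : |∫ τ in x.2..(R + R / α), g (x.1 - x.2 / α + τ / α, τ)| ≤
      B * ((1 + α⁻¹) * (R + ‖x‖)) := by
    refine (hbase _ _ _).trans ?_
    gcongr
    refine (abs_sub _ _).trans ?_
    rw [abs_of_nonneg (by positivity : 0 ≤ R + R / α), div_eq_inv_mul]
    nlinarith [mul_nonneg ha (norm_nonneg x)]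
  have i2 : |∫ σ in (x.1 - x.2 / α)..(R + R / α), g (σ + x.2 / α, x.2)| ≤
      B * ((1 + α⁻¹) * (R + ‖x‖)) := by
    refine (hbase _ _ _).trans ?_
    gcongr
    refine (abs_sub _ _).trans ?_
    have := abs_sub x.1 (x.2 / α)
    rw [abs_of_nonneg (by positivity : 0 ≤ R + R / α), div_eq_inv_mul R]
    nlinarith
  have hM : 0 ≤ B * ((1 + α⁻¹) * (R + ‖x‖)) := by positivity
  refine ContinuousLinearMap.opNorm_le_bound _ (by positivity) fun v => ?_
  have hv1 : |v.1| ≤ ‖v‖ := norm_fst_le v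
  have hv2 : |v.2| ≤ ‖v‖ := norm_snd_le v
  have hw : |v.1 - α⁻¹ * v.2| ≤ (1 + α⁻¹) * ‖v‖ := by
    refine (abs_sub _ _).trans ?_
    rw [abs_mul, abs_of_nonneg ha, add_mul, one_mul]; gcongr
  have e : sectorDeriv α R g x v =
      -((∫ τ in x.2..(R + R / α), g (x.1 - x.2 / α + τ / α, τ)) * (v.1 - α⁻¹ * v.2) +
        (∫ σ in (x.1 - x.2 / α)..(R + R / α), g (σ + x.2 / α, x.2)) * v.2) := by
    simp [sectorDeriv, cornerDeriv]
  rw [e, Real.norm_eq_abs, abs_neg]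
  calc _ ≤ B * ((1 + α⁻¹) * (R + ‖x‖)) * ((1 + α⁻¹) * ‖v‖) +
        B * ((1 + α⁻¹) * (R + ‖x‖)) * ((1 + α⁻¹) * ‖v‖) := by
        refine (abs_add_le _ _).trans ?_
        rw [abs_mul, abs_mul]
        have : |v.2| ≤ (1 + α⁻¹) * ‖v‖ := by nlinarith [mul_nonneg ha (norm_nonneg v)]
        gcongr
    _ = _ := by ring

end SectorIntegral

end BoussinesqModel

namespace BoussinesqModel

/-! ### The cut-off problem: velocity fields and dependence of the paths on the vorticity. -/

section CutSystem

theorem HasCompactSupport.exists_radius {F : Type*} [Zero F] {k : ℝ × ℝ → F}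
    (hk : HasCompactSupport k) :
    ∃ R : ℝ, 0 ≤ R ∧ ∀ y : ℝ × ℝ, R < ‖y‖ → k y = 0 := by
  obtain ⟨R, hR⟩ := hk.isCompact.isBounded.subset_closedBall (0 : ℝ × ℝ)
  refine ⟨max R 0, le_max_right _ _, fun y hy => image_eq_zero_of_notMem_tsupport fun h => ?_⟩
  have := hR h
  rw [mem_closedBall_zero_iff] at this
  exact absurd (this.trans (le_max_left _ _)) (not_le.2 hy)

/-- Truncation to the interval `[-N, N]`. -/
noncomputable def clip (N r : ℝ) : ℝ := max (-N) (min r N)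

theorem continuous_clip (N : ℝ) : Continuous (clip N) := by unfold clip; fun_prop

theorem abs_clip_le {N : ℝ} (hN : 0 ≤ N) (r : ℝ) : |clip N r| ≤ N :=
  abs_le.2 ⟨le_max_left _ _, max_le (by linarith) (min_le_right _ _)⟩

theorem abs_clip_sub_clip_le (N r s : ℝ) : |clip N r - clip N s| ≤ |r - s| := by
  have h1 := abs_max_sub_max_le_max (-N) (min r N) (-N) (min s N)
  have h2 := abs_min_sub_min_le_max r N s N
  simp only [sub_self, abs_zero] at h1 h2
  exact h1.trans (max_le (abs_nonneg _) (h2.trans (max_le le_rfl (abs_nonneg _))))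

theorem clip_of_abs_le {N r : ℝ} (h : |r| ≤ N) : clip N r = r := by
  rw [clip, min_eq_left (abs_le.1 h).2, max_eq_right (abs_le.1 h).1]

/-- The data of the Cauchy problem with all coefficients cut off to compact sets: `k` is the
kernel, `m` the vector by which the nonlocal quantity is multiplied to get the velocity, `c` the
coefficient in front of the density, `T` the final time, `N` the truncation level. -/
structure CutData where
  α : ℝ
  α_pos : 0 < α
  k : ℝ × ℝ → ℝ
  k_cont : Continuous k
  k_supp : HasCompactSupport k
  k_zero : ∀ y, y ∉ quadrant → k y = 0
  m : ℝ × ℝ → ℝ × ℝ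
  m_smooth : ContDiff ℝ 1 m
  m_supp : HasCompactSupport m
  c : ℝ × ℝ → ℝ
  c_smooth : ContDiff ℝ 1 c
  c_supp : HasCompactSupport c
  w₀ : ℝ × ℝ → ℝ
  w₀_smooth : ContDiff ℝ 1 w₀
  w₀_supp : HasCompactSupport w₀
  r₀ : ℝ × ℝ → ℝ
  r₀_smooth : ContDiff ℝ 1 r₀
  r₀_supp : HasCompactSupport r₀
  T : ℝ
  T_nonneg : 0 ≤ T
  N : ℝ
  N_nonneg : 0 ≤ N

namespace CutData

variable (S : CutData)

/-- Projection of the time to `[0, T]`. -/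
noncomputable def clamp (t : ℝ) : ℝ := max 0 (min t S.T)

theorem continuous_clamp : Continuous S.clamp := by unfold clamp; fun_prop

theorem clamp_mem (t : ℝ) : S.clamp t ∈ Icc 0 S.T :=
  ⟨le_max_left _ _, max_le S.T_nonneg (min_le_right _ _)⟩

theorem clamp_of_mem {t : ℝ} (ht : t ∈ Icc 0 S.T) : S.clamp t = t := by
  rw [clamp, min_eq_left ht.2, max_eq_right ht.1]

/-- The density of the nonlocal term. -/
noncomputable def density (v : ℝ → ℝ × ℝ → ℝ) (t : ℝ) (y : ℝ × ℝ) : ℝ :=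
  S.k y * clip S.N (v (S.clamp t) y)

/-- The nonlocal term. -/
noncomputable def q (v : ℝ → ℝ × ℝ → ℝ) (t : ℝ) (x : ℝ × ℝ) : ℝ :=
  sectorIntegral S.α (S.density v t) x

/-- The velocity field. -/
noncomputable def field (v : ℝ → ℝ × ℝ → ℝ) (t : ℝ) (x : ℝ × ℝ) : ℝ × ℝ :=
  S.q v t x • S.m x

/-- Joint continuity in time and space. -/
def Cont (v : ℝ → ℝ × ℝ → ℝ) : Prop := Continuous fun p : ℝ × ℝ × ℝ => v p.1 p.2

theorem continuous_density {v : ℝ → ℝ × ℝ → ℝ} (hv : Cont v) : Cont (S.density v) := by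
  have h1 : Continuous fun p : ℝ × ℝ × ℝ => v (S.clamp p.1) p.2 :=
    Continuous.comp (g := fun p : ℝ × ℝ × ℝ => v p.1 p.2) hv
      ((S.continuous_clamp.comp continuous_fst).prodMk continuous_snd)
  exact (S.k_cont.comp continuous_snd).mul ((continuous_clip _).comp h1)

theorem abs_density_le (v : ℝ → ℝ × ℝ → ℝ) (t : ℝ) (y : ℝ × ℝ) :
    |S.density v t y| ≤ |S.k y| * S.N := by
  rw [density, abs_mul]
  exact mul_le_mul_of_nonneg_left (abs_clip_le S.N_nonneg _) (abs_nonneg _)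

theorem integrable_k : Integrable S.k := S.k_cont.integrable_of_hasCompactSupport S.k_supp

theorem exists_radius_density : ∃ R : ℝ, 0 ≤ R ∧ ∀ (v : ℝ → ℝ × ℝ → ℝ) (t : ℝ) (y : ℝ × ℝ),
    R < |y.1| ∨ R < |y.2| → S.density v t y = 0 := by
  obtain ⟨R, hR, h⟩ := HasCompactSupport.exists_radius S.k_supp
  refine ⟨R, hR, fun v t y hy => ?_⟩
  have : R < ‖y‖ := by
    rcases hy with hy | hy
    · exact hy.trans_le (norm_fst_le y)
    · exact hy.trans_le (norm_snd_le y)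
  simp [density, h y this]

theorem integrable_density {v : ℝ → ℝ × ℝ → ℝ} (hv : Cont v) (t : ℝ) :
    Integrable (S.density v t) := by
  refine Continuous.integrable_of_hasCompactSupport
    (Continuous.comp (g := fun p : ℝ × ℝ × ℝ => S.density v p.1 p.2) (S.continuous_density hv)
      (by fun_prop : Continuous fun y => (t, y))) ?_
  exact S.k_supp.mul_right

theorem abs_q_le (v : ℝ → ℝ × ℝ → ℝ) (t : ℝ) (x : ℝ × ℝ) :
    |S.q v t x| ≤ S.N * ∫ y, |S.k y| := by
  have h1 : |S.q v t x| ≤ ∫ y in {y : ℝ × ℝ | y - x ∈ sector S.α}, |S.k y| * S.N :=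
    norm_integral_le_of_norm_le (f := S.density v t) ((S.integrable_k.abs.mul_const _).integrableOn)
      (Eventually.of_forall fun y => S.abs_density_le v t y)
  refine h1.trans ((setIntegral_le_integral (S.integrable_k.abs.mul_const _)
    (Eventually.of_forall fun y => mul_nonneg (abs_nonneg _) S.N_nonneg)).trans ?_)
  rw [integral_mul_const, mul_comm]

/-- The kernel `k` vanishes off the quadrant, so closeness is required only on the quadrant, where
alone solutions of the original system are determined. -/
theorem abs_q_sub_le {v v' : ℝ → ℝ × ℝ → ℝ} (hv : Cont v) (hv' : Cont v') (t : ℝ) {A : ℝ}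
    (h : ∀ y ∈ quadrant, |v (S.clamp t) y - v' (S.clamp t) y| ≤ A) (x : ℝ × ℝ) :
    |S.q v t x - S.q v' t x| ≤ A * ∫ y, |S.k y| := by
  have hA : 0 ≤ A := (abs_nonneg _).trans (h 0 ⟨le_rfl, le_rfl⟩)
  rw [q, q, sectorIntegral, sectorIntegral, ← integral_sub (S.integrable_density hv t).integrableOn
    (S.integrable_density hv' t).integrableOn]
  have h1 : |∫ y in {y : ℝ × ℝ | y - x ∈ sector S.α}, (S.density v t y - S.density v' t y)| ≤
      ∫ y in {y : ℝ × ℝ | y - x ∈ sector S.α}, |S.k y| * A := by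
    refine norm_integral_le_of_norm_le (f := fun y => S.density v t y - S.density v' t y)
      ((S.integrable_k.abs.mul_const _).integrableOn) ?_
    refine Eventually.of_forall fun y => ?_
    rw [density, density, ← mul_sub, Real.norm_eq_abs, abs_mul]
    by_cases hy : y ∈ quadrant
    · exact mul_le_mul_of_nonneg_left ((abs_clip_sub_clip_le _ _ _).trans (h y hy)) (abs_nonneg _)
    · simp [S.k_zero y hy]
  refine h1.trans ((setIntegral_le_integral (S.integrable_k.abs.mul_const _)
    (Eventually.of_forall fun y => mul_nonneg (abs_nonneg _) hA)).trans ?_)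
  rw [integral_mul_const, mul_comm]

/-- A radius for the support of the density. -/
noncomputable def R : ℝ := S.exists_radius_density.choose

/-- The derivative of the velocity field. -/
noncomputable def field' (v : ℝ → ℝ × ℝ → ℝ) (t : ℝ) (x : ℝ × ℝ) : ℝ × ℝ →L[ℝ] ℝ × ℝ :=
  S.q v t x • fderiv ℝ S.m x + (sectorDeriv S.α S.R (S.density v t) x).smulRight (S.m x)

theorem hasFDerivAt_q {v : ℝ → ℝ × ℝ → ℝ} (hv : Cont v) (t : ℝ) (x : ℝ × ℝ) :
    HasFDerivAt (S.q v t) (sectorDeriv S.α S.R (S.density v t) x) x :=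
  hasFDerivAt_sectorIntegral S.α_pos
    (Continuous.comp (g := fun p : ℝ × ℝ × ℝ => S.density v p.1 p.2) (S.continuous_density hv)
      (by fun_prop : Continuous fun y => (t, y)))
    S.exists_radius_density.choose_spec.1 (S.exists_radius_density.choose_spec.2 v t) x

theorem continuous_q {v : ℝ → ℝ × ℝ → ℝ} (hv : Cont v) : Cont (S.q v) :=
  continuous_sectorIntegral S.α_pos S.exists_radius_density.choose_spec.1
    (S.continuous_density hv) (S.exists_radius_density.choose_spec.2 v)

/-- The truncation `clip` bounds the density independently of `v`. The constants must be uniform in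
`v` for the fixed point argument. -/
theorem exists_smoothField : ∃ K C : ℝ, ∀ v : ℝ → ℝ × ℝ → ℝ, Cont v →
    SmoothField (S.field v) (S.field' v) K C := by
  obtain ⟨Ck, hCk⟩ := S.k_cont.bounded_above_of_compact_support S.k_supp
  obtain ⟨Cm, hCm⟩ := S.m_smooth.continuous.bounded_above_of_compact_support S.m_supp
  obtain ⟨Cd, hCd⟩ := (S.m_smooth.continuous_fderiv one_ne_zero).bounded_above_of_compact_support
    (S.m_supp.fderiv ℝ)
  obtain ⟨Rm, hRm0, hRm⟩ := HasCompactSupport.exists_radius S.m_supp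
  have hR := S.exists_radius_density.choose_spec.1
  have hCk0 : 0 ≤ Ck := (norm_nonneg _).trans (hCk 0)
  have hCm0 : 0 ≤ Cm := (norm_nonneg _).trans (hCm 0)
  have hCd0 : 0 ≤ Cd := (norm_nonneg _).trans (hCd 0)
  have hN := S.N_nonneg
  have hint : 0 ≤ ∫ y, |S.k y| := integral_nonneg fun y => abs_nonneg _
  have hαi : 0 ≤ S.α⁻¹ := inv_nonneg.2 S.α_pos.le
  refine ⟨(S.N * ∫ y, |S.k y|) * Cd +
    (Ck * S.N) * (2 * (1 + S.α⁻¹) ^ 2 * (S.R + Rm)) * Cm, (S.N * ∫ y, |S.k y|) * Cm,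
    fun v hv => ⟨?_, fun t x => ?_, ?_, fun t x => ?_, fun t => ?_⟩⟩
  · exact Continuous.smul (S.continuous_q hv) (S.m_smooth.continuous.comp continuous_snd)
  · have hm : HasFDerivAt S.m (fderiv ℝ S.m x) x :=
      (S.m_smooth.differentiable one_ne_zero x).hasFDerivAt
    exact (S.hasFDerivAt_q hv t x).smul hm
  · refine Continuous.add ?_ ?_
    · exact Continuous.smul (S.continuous_q hv)
        ((S.m_smooth.continuous_fderiv one_ne_zero).comp continuous_snd)
    · have h1 := continuous_sectorDeriv (α := S.α) (R := S.R) (g := S.density v)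
        (S.continuous_density hv)
      have h2 : Continuous fun p : ℝ × ℝ × ℝ => S.m p.2 := S.m_smooth.continuous.comp continuous_snd
      exact ((ContinuousLinearMap.smulRightL ℝ (ℝ × ℝ) (ℝ × ℝ)).continuous.comp h1).clm_apply h2
  · refine (norm_add_le _ _).trans (add_le_add ?_ ?_)
    · rw [norm_smul]
      exact mul_le_mul (S.abs_q_le v t x) (hCd x) (norm_nonneg _) (by positivity)
    · rw [ContinuousLinearMap.norm_smulRight_apply]
      -- The derivative of the nonlocal term grows with x, but it is multiplied by `m`, which
      -- vanishes outside the ball of radius `Rm`.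
      rcases le_or_gt ‖x‖ Rm with hx | hx
      · refine mul_le_mul ?_ (hCm x) (norm_nonneg _) ?_
        · refine (norm_sectorDeriv_le S.α_pos hR (B := Ck * S.N) (fun y => ?_) x).trans ?_
          · exact (S.abs_density_le v t y).trans (mul_le_mul_of_nonneg_right (hCk y) hN)
          · have : S.R = S.exists_radius_density.choose := rfl
            gcongr
            rw [this]
        · have : 0 ≤ S.R := hR
          positivity
      · have : 0 ≤ S.R := hR
        rw [hRm x hx, norm_zero, mul_zero]
        positivity
  · rw [field, norm_smul]
    exact mul_le_mul (S.abs_q_le v t 0) (hCm 0) (norm_nonneg _) (by positivity)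

/-- A bound for the derivative of the velocity field. -/
noncomputable def K : ℝ := S.exists_smoothField.choose

/-- A bound for the velocity field at the origin. -/
noncomputable def C : ℝ := S.exists_smoothField.choose_spec.choose

theorem smoothField {v : ℝ → ℝ × ℝ → ℝ} (hv : Cont v) :
    SmoothField (S.field v) (S.field' v) S.K S.C :=
  S.exists_smoothField.choose_spec.choose_spec v hv

/-- The trajectories of the velocity field generated by `v`. -/
noncomputable def path (v : ℝ → ℝ × ℝ → ℝ) (s t : ℝ) (x : ℝ × ℝ) : ℝ × ℝ :=
  flow (S.field v) s t x

theorem continuous_path {v : ℝ → ℝ × ℝ → ℝ} (hv : Cont v) :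
    Continuous fun p : ℝ × ℝ × ℝ × ℝ => S.path v p.1 p.2.1 p.2.2 :=
  (S.smoothField hv).lipField.continuous_flow

theorem K_nonneg : 0 ≤ S.K :=
  (S.smoothField (v := fun _ _ => 0) continuous_const).lipField.K_nonneg

theorem exists_field_sub_le : ∃ B : ℝ, 0 ≤ B ∧ ∀ v v' : ℝ → ℝ × ℝ → ℝ, Cont v → Cont v' →
    ∀ (t A : ℝ), (∀ y ∈ quadrant, |v (S.clamp t) y - v' (S.clamp t) y| ≤ A) →
    ∀ x, ‖S.field v t x - S.field v' t x‖ ≤ A * B := by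
  obtain ⟨Cm, hCm⟩ := S.m_smooth.continuous.bounded_above_of_compact_support S.m_supp
  have hint : 0 ≤ ∫ y, |S.k y| := integral_nonneg fun y => abs_nonneg _
  refine ⟨(∫ y, |S.k y|) * Cm, mul_nonneg hint ((norm_nonneg _).trans (hCm 0)),
    fun v v' hv hv' t A h x => ?_⟩
  have hA : 0 ≤ A := (abs_nonneg _).trans (h 0 ⟨le_rfl, le_rfl⟩)
  rw [field, field, ← sub_smul, norm_smul, ← mul_assoc]
  exact mul_le_mul (S.abs_q_sub_le hv hv' t h x) (hCm x) (norm_nonneg _) (by positivity)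

/-- The factor 1 / l is the point: a difference growing like exp(l r) integrates to exp(l t) / l,
while `B` does not depend on `l`. A large `l` therefore gives a contraction on the whole of [0, T].
-/
theorem exists_path_sub_le : ∃ B : ℝ, 0 ≤ B ∧ ∀ v v' : ℝ → ℝ × ℝ → ℝ, Cont v → Cont v' →
    ∀ (l A t : ℝ), 0 < l → 0 ≤ A → t ∈ Icc 0 S.T →
    (∀ r ∈ Icc 0 t, ∀ y ∈ quadrant, |v r y - v' r y| ≤ A * Real.exp (l * r)) →
    ∀ s ∈ Icc 0 t, ∀ x, ‖S.path v s t x - S.path v' s t x‖ ≤ A * B / l * Real.exp (l * t) := by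
  obtain ⟨B, hB0, hB⟩ := S.exists_field_sub_le
  refine ⟨B * Real.exp (S.K * S.T), by positivity,
    fun v v' hv hv' l A t hl hA ht h s hs x => ?_⟩
  have hf := (S.smoothField hv).lipField
  have hf' := (S.smoothField hv').lipField
  have hK := S.K_nonneg
  have hKl : 0 < l + S.K := by linarith
  -- reverse time and weight with an exponential
  set D : ℝ → ℝ × ℝ := fun r => S.path v (t - r) t x - S.path v' (t - r) t x with hD
  have hDd : ∀ r, HasDerivAt D (-(S.field v (t - r) (S.path v (t - r) t x) -
      S.field v' (t - r) (S.path v' (t - r) t x))) r := by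
    intro r
    have h1 := ((hf.hasDerivAt_flow (t - r) t x).sub (hf'.hasDerivAt_flow (t - r) t x)).scomp r
      ((hasDerivAt_id r).const_sub t)
    simpa [Function.comp_def, hD, path] using h1
  have hGd : ∀ r, HasDerivAt (fun r => Real.exp (l * r) • D r)
      (Real.exp (l * r) • (-(S.field v (t - r) (S.path v (t - r) t x) -
      S.field v' (t - r) (S.path v' (t - r) t x))) + (Real.exp (l * r) * l) • D r) r := by
    intro r
    have h1 : HasDerivAt (fun r : ℝ => Real.exp (l * r)) (Real.exp (l * r) * l) r := by
      simpa using ((hasDerivAt_id r).const_mul l).exp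
    exact h1.smul (hDd r)
  have hDn : ∀ r ∈ Icc 0 t, ‖S.field v (t - r) (S.path v (t - r) t x) -
      S.field v' (t - r) (S.path v' (t - r) t x)‖ ≤
      S.K * ‖D r‖ + A * Real.exp (l * (t - r)) * B := by
    intro r hr
    have hr' : t - r ∈ Icc 0 t := ⟨by linarith [hr.2], by linarith [hr.1]⟩
    calc _ ≤ ‖S.field v (t - r) (S.path v (t - r) t x) -
              S.field v (t - r) (S.path v' (t - r) t x)‖ +
            ‖S.field v (t - r) (S.path v' (t - r) t x) -
              S.field v' (t - r) (S.path v' (t - r) t x)‖ :=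
          norm_sub_le_norm_sub_add_norm_sub _ _ _
      _ ≤ _ := by
          refine add_le_add (hf.lip _ _ _) (hB v v' hv hv' _ _ ?_ _)
          rw [S.clamp_of_mem ⟨hr'.1, hr'.2.trans ht.2⟩]
          exact h _ hr'
  -- In reversed time the weight exp(l r) cancels the forcing exp(l (t - r)) down to the constant
  -- exp(l t), at the price of raising the Gronwall rate from `K` to `l + K`.
  have hgr := gronwall_right (D := fun r => Real.exp (l * r) • D r)
    (a := 0) (b := t - s) (K := l + S.K) (ε := A * B * Real.exp (l * t))
    (by linarith [hs.2]) (fun r _ => (hGd r).hasDerivWithinAt) (fun r hr => by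
      have hr' : r ∈ Icc 0 t := ⟨hr.1, by linarith [hr.2, hs.1]⟩
      refine (norm_add_le _ _).trans ?_
      rw [norm_smul, norm_smul, norm_smul, norm_neg, Real.norm_eq_abs, Real.norm_eq_abs,
        Real.abs_exp, abs_mul, Real.abs_exp, abs_of_pos hl]
      have h1 := mul_le_mul_of_nonneg_left (hDn r hr') (Real.exp_pos (l * r)).le
      have h2 : Real.exp (l * r) * Real.exp (l * (t - r)) = Real.exp (l * t) := by
        rw [← Real.exp_add]; ring_nf
      have h3 : Real.exp (l * r) * (S.K * ‖D r‖ + A * Real.exp (l * (t - r)) * B) =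
          S.K * (Real.exp (l * r) * ‖D r‖) + A * B * Real.exp (l * t) := by
        rw [← h2]; ring
      rw [h3] at h1
      linarith)
  have hD0 : D 0 = 0 := by
    simp only [hD, sub_zero, path, hf.flow_self, hf'.flow_self, sub_self]
  simp only [hD0, smul_zero, norm_zero, sub_zero, gronwallBound_of_K_ne_0 hKl.ne'] at hgr
  have hDs : D (t - s) = S.path v s t x - S.path v' s t x := by simp [hD]
  rw [hDs, norm_smul, Real.norm_eq_abs, Real.abs_exp, zero_mul, zero_add] at hgr
  have hts : t - s ≤ S.T := by linarith [hs.1, ht.2]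
  have h4 : Real.exp ((l + S.K) * (t - s)) - 1 ≤
      Real.exp (l * (t - s)) * Real.exp (S.K * S.T) := by
    rw [add_mul, Real.exp_add]
    have : Real.exp (S.K * (t - s)) ≤ Real.exp (S.K * S.T) := by gcongr
    have := mul_le_mul_of_nonneg_left this (Real.exp_pos (l * (t - s))).le
    linarith
  have h5 : A * B * Real.exp (l * t) / (l + S.K) ≤ A * B * Real.exp (l * t) / l := by
    gcongr; linarith
  have h6 : Real.exp (l * (t - s)) * ‖S.path v s t x - S.path v' s t x‖ ≤
      Real.exp (l * (t - s)) * (A * B * Real.exp (l * t) / l * Real.exp (S.K * S.T)) := by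
    refine hgr.trans ?_
    calc A * B * Real.exp (l * t) / (l + S.K) * (Real.exp ((l + S.K) * (t - s)) - 1)
        ≤ A * B * Real.exp (l * t) / (l + S.K) *
          (Real.exp (l * (t - s)) * Real.exp (S.K * S.T)) :=
          mul_le_mul_of_nonneg_left h4 (by positivity)
      _ ≤ A * B * Real.exp (l * t) / l * (Real.exp (l * (t - s)) * Real.exp (S.K * S.T)) :=
          mul_le_mul_of_nonneg_right h5 (by positivity)
      _ = _ := by ring
  have h7 := le_of_mul_le_mul_left h6 (Real.exp_pos _)
  refine h7.trans_eq ?_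
  ring

end CutData

end CutSystem

end BoussinesqModel

namespace BoussinesqModel

/-! ### Representation along paths, its fixed point, and the transport equations. -/

section Transport

variable {E : Type*} [NormedAddCommGroup E] [NormedSpace ℝ E]

/-- Moving the spatial argument along a curve changes the time derivative by the spatial
derivative in the direction of the velocity. -/
theorem hasDerivWithinAt_along_sub {A : Set E} (hA : Convex ℝ A) {v : ℝ → E → ℝ}
    {G : ℝ → E → E →L[ℝ] ℝ} {I : Set ℝ} {t : ℝ} {X : ℝ → E} {U : E}
    (hX : HasDerivWithinAt X U I t) (hXA : ∀ s ∈ I, X s ∈ A) (ht : t ∈ I)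
    (hd : ∀ s ∈ I, ∀ y ∈ A, HasFDerivWithinAt (v s) (G s y) A y)
    (hc : Tendsto (fun p : ℝ × E => G p.1 p.2) (𝓝[I] t ×ˢ 𝓝[A] (X t)) (𝓝 (G t (X t)))) :
    HasDerivWithinAt (fun s => v s (X s) - v s (X t)) (G t (X t) U) I t := by
  have hXt : Tendsto X (𝓝[I] t) (𝓝 (X t)) := hX.continuousWithinAt
  have hmem : ∀ᶠ s in 𝓝[I] t, s ∈ I := self_mem_nhdsWithin
  have h1 : (fun s => v s (X s) - v s (X t) - G t (X t) (X s - X t)) =o[𝓝[I] t]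
      fun s => X s - X t := by
    rw [Asymptotics.isLittleO_iff]
    intro ε hε
    obtain ⟨pa, hpa, pb, hpb, hab⟩ := eventually_prod_iff.1
      ((Metric.tendsto_nhds.1 hc) ε hε)
    obtain ⟨r, hr, hball⟩ := Metric.mem_nhdsWithin_iff.1 hpb
    filter_upwards [hpa, hmem, hXt (Metric.ball_mem_nhds _ hr)] with s hs hsI hsr
    have hseg : segment ℝ (X t) (X s) ⊆ Metric.ball (X t) r ∩ A :=
      ((convex_ball _ _).inter hA).segment_subset ⟨Metric.mem_ball_self hr, hXA t ht⟩
        ⟨hsr, hXA s hsI⟩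
    exact Convex.norm_image_sub_le_of_norm_hasFDerivWithin_le'
      (fun z hz => (hd s hsI z (hseg hz).2).mono fun z hz => (hseg hz).2)
      (fun z hz => by simpa [dist_eq_norm] using (hab hs (hball (hseg hz))).le)
      (convex_segment _ _) (left_mem_segment _ _ _) (right_mem_segment _ _ _)
  have h3 : (fun s => X s - X t) =O[𝓝[I] t] fun s => s - t := by
    simpa [Function.comp_def] using hX.hasFDerivWithinAt.isBigO_sub
  have h4 := h1.trans_isBigO h3
  have h5 := ((G t (X t)).hasFDerivAt.comp_hasDerivWithinAt t hX)
  rw [hasDerivWithinAt_iff_isLittleO] at h5 ⊢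
  refine (h4.add h5).congr_left fun s => ?_
  simp [map_sub]

theorem hasFDerivAt_intervalIntegral_of_continuous [ProperSpace E] {F : E → ℝ → ℝ}
    {F' : E → ℝ → E →L[ℝ] ℝ} (hF : Continuous fun p : E × ℝ => F p.1 p.2)
    (hF' : Continuous fun p : E × ℝ => F' p.1 p.2)
    (hd : ∀ x s, HasFDerivAt (fun x => F x s) (F' x s) x) (a b : ℝ) (x : E) :
    HasFDerivAt (fun x => ∫ s in a..b, F x s) (∫ s in a..b, F' x s) x := by
  obtain ⟨B, hB⟩ := ((isCompact_closedBall x 1).prod (isCompact_uIcc (a := a) (b := b))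
    ).exists_bound_of_continuousOn hF'.continuousOn
  have hFx : ∀ y, Continuous (F y) := fun y => hF.comp (by fun_prop : Continuous fun s => (y, s))
  refine intervalIntegral.hasFDerivAt_integral_of_dominated_of_fderiv_le (bound := fun _ => B)
    (Metric.closedBall_mem_nhds x one_pos)
    (Eventually.of_forall fun y => (hFx y).aestronglyMeasurable)
    ((hFx x).intervalIntegrable _ _)
    (hF'.comp (by fun_prop : Continuous fun s => (x, s))).aestronglyMeasurable
    (Eventually.of_forall fun s hs y hy => hB (y, s) ⟨hy, uIoc_subset_uIcc hs⟩)
    intervalIntegrable_const (Eventually.of_forall fun s _ y _ => hd y s)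

end Transport

namespace CutData

variable (S : CutData)

/-- Integration of `c` along the trajectory of `v` ending at `(t, x)`. -/
noncomputable def growth (v : ℝ → ℝ × ℝ → ℝ) (t : ℝ) (x : ℝ × ℝ) : ℝ :=
  ∫ s in (0 : ℝ)..S.clamp t, S.c (S.path v s (S.clamp t) x)

/-- The transported density. -/
noncomputable def rho (v : ℝ → ℝ × ℝ → ℝ) (t : ℝ) (x : ℝ × ℝ) : ℝ :=
  S.r₀ (S.path v 0 (S.clamp t) x)

/-- The solution of the linear transport problem with the velocity generated by `v`. -/
noncomputable def step (v : ℝ → ℝ × ℝ → ℝ) (t : ℝ) (x : ℝ × ℝ) : ℝ :=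
  S.w₀ (S.path v 0 (S.clamp t) x) + S.rho v t x * S.growth v t x

variable {v : ℝ → ℝ × ℝ → ℝ}

theorem continuous_path_comp (hv : Cont v) {X : Type*} [TopologicalSpace X] {a b : X → ℝ}
    {c : X → ℝ × ℝ} (ha : Continuous a) (hb : Continuous b) (hc : Continuous c) :
    Continuous fun p => S.path v (a p) (b p) (c p) :=
  (S.continuous_path hv).comp (ha.prodMk (hb.prodMk hc))

theorem continuous_back (hv : Cont v) :
    Continuous fun p : ℝ × ℝ × ℝ => S.path v 0 (S.clamp p.1) p.2 :=
  S.continuous_path_comp hv continuous_const (S.continuous_clamp.comp continuous_fst)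
    continuous_snd

theorem continuous_growth (hv : Cont v) : Cont (S.growth v) := by
  refine intervalIntegral.continuous_parametric_intervalIntegral_of_continuous
    (f := fun (p : ℝ × ℝ × ℝ) s => S.c (S.path v s (S.clamp p.1) p.2)) ?_
    (S.continuous_clamp.comp continuous_fst)
  exact S.c_smooth.continuous.comp (S.continuous_path_comp hv continuous_snd
    (S.continuous_clamp.comp (by fun_prop)) (by fun_prop))

theorem continuous_rho (hv : Cont v) : Cont (S.rho v) :=
  S.r₀_smooth.continuous.comp (S.continuous_back hv)

theorem continuous_step (hv : Cont v) : Cont (S.step v) :=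
  Continuous.add (S.w₀_smooth.continuous.comp (S.continuous_back hv))
    (Continuous.mul (S.continuous_rho hv) (S.continuous_growth hv))

theorem abs_growth_le {B : ℝ} (hB : ∀ x, |S.c x| ≤ B) (v : ℝ → ℝ × ℝ → ℝ) (t : ℝ) (x : ℝ × ℝ) :
    |S.growth v t x| ≤ B * S.T := by
  have hB0 := (abs_nonneg _).trans (hB 0)
  refine (intervalIntegral.norm_integral_le_of_norm_le_const
    (f := fun s => S.c (S.path v s (S.clamp t) x)) (fun _ _ => hB _)).trans ?_
  have := S.clamp_mem t
  rw [sub_zero, abs_of_nonneg this.1]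
  exact mul_le_mul_of_nonneg_left this.2 hB0

theorem abs_step_le {A B C : ℝ} (hA : ∀ x, |S.w₀ x| ≤ A) (hB : ∀ x, |S.r₀ x| ≤ B)
    (hC : ∀ x, |S.c x| ≤ C) (v : ℝ → ℝ × ℝ → ℝ) (t : ℝ) (x : ℝ × ℝ) :
    |S.step v t x| ≤ A + B * (C * S.T) := by
  have hB0 := (abs_nonneg _).trans (hB 0)
  refine (abs_add_le _ _).trans (add_le_add (hA _) ?_)
  rw [abs_mul]
  exact mul_le_mul (hB _) (S.abs_growth_le hC v t x) (abs_nonneg _) hB0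

theorem exists_step_bound : ∃ M : ℝ, ∀ v t x, |S.step v t x| ≤ M := by
  obtain ⟨A, hA⟩ := S.w₀_smooth.continuous.bounded_above_of_compact_support S.w₀_supp
  obtain ⟨B, hB⟩ := S.r₀_smooth.continuous.bounded_above_of_compact_support S.r₀_supp
  obtain ⟨C, hC⟩ := S.c_smooth.continuous.bounded_above_of_compact_support S.c_supp
  exact ⟨_, S.abs_step_le hA hB hC⟩

/-- The data and `c` are C¹ with compact support, hence Lipschitz and bounded, so `step` depends on
`v` through the paths in a Lipschitz way and inherits their factor 1 / l. -/
theorem exists_step_sub_le : ∃ B : ℝ, 0 ≤ B ∧ ∀ v v' : ℝ → ℝ × ℝ → ℝ, Cont v → Cont v' →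
    ∀ (l A t : ℝ), 0 < l → 0 ≤ A → t ∈ Icc 0 S.T →
    (∀ r ∈ Icc 0 t, ∀ y ∈ quadrant, |v r y - v' r y| ≤ A * Real.exp (l * r)) →
    ∀ x, |S.step v t x - S.step v' t x| ≤ A * B / l * Real.exp (l * t) := by
  obtain ⟨B, hB0, hB⟩ := S.exists_path_sub_le
  obtain ⟨Lw, hLw⟩ := S.w₀_smooth.lipschitzWith_of_hasCompactSupport S.w₀_supp one_ne_zero
  obtain ⟨Lr, hLr⟩ := S.r₀_smooth.lipschitzWith_of_hasCompactSupport S.r₀_supp one_ne_zero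
  obtain ⟨Lc, hLc⟩ := S.c_smooth.lipschitzWith_of_hasCompactSupport S.c_supp one_ne_zero
  obtain ⟨Br, hBr⟩ := S.r₀_smooth.continuous.bounded_above_of_compact_support S.r₀_supp
  obtain ⟨Bc, hBc⟩ := S.c_smooth.continuous.bounded_above_of_compact_support S.c_supp
  have hBr0 := (norm_nonneg _).trans (hBr 0)
  have hBc0 := (norm_nonneg _).trans (hBc 0)
  have hT := S.T_nonneg
  refine ⟨B * (Lw + Lr * (Bc * S.T) + Br * (Lc * S.T)), by positivity,
    fun v v' hv hv' l A t hl hA ht h x => ?_⟩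
  have hct := S.clamp_of_mem ht
  set δ : ℝ := A * B / l * Real.exp (l * t) with hδ
  have hδ0 : 0 ≤ δ := by positivity
  have hp : ∀ s ∈ Icc 0 t, ‖S.path v s t x - S.path v' s t x‖ ≤ δ :=
    fun s hs => hB v v' hv hv' l A t hl hA ht h s hs x
  have lip : ∀ {L : NNReal} {f : ℝ × ℝ → ℝ}, LipschitzWith L f → ∀ s ∈ Icc 0 t,
      |f (S.path v s t x) - f (S.path v' s t x)| ≤ L * δ := fun {L f} hf s hs =>
    (hf.norm_sub_le _ _).trans (mul_le_mul_of_nonneg_left (hp s hs) L.2)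
  have h0 : (0 : ℝ) ∈ Icc 0 t := ⟨le_rfl, ht.1⟩
  have hg : |S.growth v t x - S.growth v' t x| ≤ Lc * δ * S.T := by
    have hcp : ∀ {v : ℝ → ℝ × ℝ → ℝ}, Cont v → Continuous fun s => S.c (S.path v s t x) :=
      fun hv => S.c_smooth.continuous.comp
        (S.continuous_path_comp hv continuous_id continuous_const continuous_const)
    rw [growth, growth, hct, ← intervalIntegral.integral_sub ((hcp hv).intervalIntegrable _ _)
      ((hcp hv').intervalIntegrable _ _)]
    refine (intervalIntegral.norm_integral_le_of_norm_le_const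
      (f := fun s => S.c (S.path v s t x) - S.c (S.path v' s t x)) (C := Lc * δ)
      (fun s hs => ?_)).trans ?_
    · rw [uIoc_of_le ht.1] at hs
      exact lip hLc s ⟨hs.1.le, hs.2⟩
    · rw [sub_zero, abs_of_nonneg ht.1]
      exact mul_le_mul_of_nonneg_left ht.2 (by positivity)
  have e : S.step v t x - S.step v' t x =
      (S.w₀ (S.path v 0 t x) - S.w₀ (S.path v' 0 t x)) +
      ((S.r₀ (S.path v 0 t x) - S.r₀ (S.path v' 0 t x)) * S.growth v t x +
        S.r₀ (S.path v' 0 t x) * (S.growth v t x - S.growth v' t x)) := by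
    simp only [step, rho, hct]; ring
  rw [e]
  calc _ ≤ Lw * δ + (Lr * δ * (Bc * S.T) + Br * (Lc * δ * S.T)) := by
        refine (abs_add_le _ _).trans (add_le_add (lip hLw 0 h0) ?_)
        refine (abs_add_le _ _).trans (add_le_add ?_ ?_)
        · rw [abs_mul]
          exact mul_le_mul (lip hLr 0 h0) (S.abs_growth_le hBc v t x) (abs_nonneg _)
            (by positivity)
        · rw [abs_mul]
          exact mul_le_mul (hBr _) hg (abs_nonneg _) hBr0
    _ = _ := by rw [hδ]; ring

/-- The map is a contraction for w = exp(-l t) v with time clamped to [0, T]. `step` is bounded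
independently of `v`, so it acts on bounded continuous functions. -/
theorem exists_fixedPoint : ∃ v : ℝ → ℝ × ℝ → ℝ, Cont v ∧ ∀ t x, v t x = S.step v t x := by
  obtain ⟨B, hB0, hB⟩ := S.exists_step_sub_le
  obtain ⟨M, hM⟩ := S.exists_step_bound
  set l : ℝ := 2 * B + 1 with hl
  have hl0 : 0 < l := by positivity
  have hec : Continuous fun p : ℝ × ℝ × ℝ => Real.exp (l * S.clamp p.1) :=
    Real.continuous_exp.comp (continuous_const.mul (S.continuous_clamp.comp continuous_fst))
  have hec' : Continuous fun p : ℝ × ℝ × ℝ => Real.exp (-(l * S.clamp p.1)) :=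
    Real.continuous_exp.comp (continuous_const.mul (S.continuous_clamp.comp continuous_fst)).neg
  let V : BoundedContinuousFunction (ℝ × ℝ × ℝ) ℝ → ℝ → ℝ × ℝ → ℝ := fun w t x =>
    Real.exp (l * S.clamp t) * w (t, x)
  have hV : ∀ w, Cont (V w) := fun w => hec.mul w.continuous
  have hstep : ∀ w, Continuous fun p : ℝ × ℝ × ℝ =>
      Real.exp (-(l * S.clamp p.1)) * S.step (V w) p.1 p.2 :=
    fun w => hec'.mul (S.continuous_step (hV w))
  let Φ : BoundedContinuousFunction (ℝ × ℝ × ℝ) ℝ → BoundedContinuousFunction (ℝ × ℝ × ℝ) ℝ :=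
    fun w => BoundedContinuousFunction.ofNormedAddCommGroup _ (hstep w) M (fun p => by
      rw [norm_mul, Real.norm_eq_abs, Real.abs_exp]
      have h1 : Real.exp (-(l * S.clamp p.1)) ≤ 1 :=
        Real.exp_le_one_iff.2 (neg_nonpos.2 (mul_nonneg hl0.le (S.clamp_mem p.1).1))
      calc _ ≤ 1 * ‖S.step (V w) p.1 p.2‖ := by gcongr
        _ ≤ M := by rw [one_mul]; exact hM _ _ _)
  have hclamp : ∀ t, S.clamp (S.clamp t) = S.clamp t := fun t => S.clamp_of_mem (S.clamp_mem t)
  have hΦ : ContractingWith (1 / 2) Φ := by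
    refine ⟨by norm_num, LipschitzWith.of_dist_le_mul fun w w' => ?_⟩
    rw [BoundedContinuousFunction.dist_le (by positivity)]
    rintro ⟨t, x⟩
    have h1 := hB (V w) (V w') (hV w) (hV w') l (dist w w') (S.clamp t) hl0 dist_nonneg
      (S.clamp_mem t) (fun r hr y _ => by
        have hr' : S.clamp r = r := S.clamp_of_mem ⟨hr.1, hr.2.trans (S.clamp_mem t).2⟩
        simp only [V, hr', ← mul_sub, abs_mul, Real.abs_exp]
        rw [mul_comm]
        exact mul_le_mul_of_nonneg_right (w.dist_coe_le_dist (r, y)) (Real.exp_pos _).le) x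
    have h2 : ∀ w : BoundedContinuousFunction (ℝ × ℝ × ℝ) ℝ,
        S.step (V w) (S.clamp t) x = S.step (V w) t x := fun w => by
      simp only [step, rho, growth, hclamp]
    rw [h2, h2] at h1
    change |Real.exp (-(l * S.clamp t)) * S.step (V w) t x -
      Real.exp (-(l * S.clamp t)) * S.step (V w') t x| ≤ _
    rw [← mul_sub, abs_mul, Real.abs_exp, Real.exp_neg, inv_mul_le_iff₀ (Real.exp_pos _)]
    refine h1.trans ?_
    have h3 : B / l ≤ 1 / 2 := by rw [div_le_iff₀ hl0]; linarith
    calc dist w w' * B / l * Real.exp (l * S.clamp t)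
        = (B / l) * (dist w w' * Real.exp (l * S.clamp t)) := by ring
      _ ≤ (1 / 2) * (dist w w' * Real.exp (l * S.clamp t)) := by gcongr
      _ = _ := by push_cast; ring
  let w := ContractingWith.fixedPoint Φ hΦ
  have hw : Φ w = w := hΦ.fixedPoint_isFixedPt
  refine ⟨V w, hV w, fun t x => ?_⟩
  have : w (t, x) = Real.exp (-(l * S.clamp t)) * S.step (V w) t x := by
    conv_lhs => rw [← hw]
    rfl
  simp only [V]
  rw [this, ← mul_assoc, ← Real.exp_add]; simp [V]

/-- Two fixed points up to time `τ` on the quadrant agree there. -/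
theorem fixedPoint_unique {v' : ℝ → ℝ × ℝ → ℝ} (hv : Cont v) (hv' : Cont v') {τ : ℝ}
    (hτ : τ ∈ Icc 0 S.T) (h : ∀ t ∈ Icc 0 τ, ∀ x ∈ quadrant, v t x = S.step v t x)
    (h' : ∀ t ∈ Icc 0 τ, ∀ x ∈ quadrant, v' t x = S.step v' t x) :
    ∀ t ∈ Icc 0 τ, ∀ x ∈ quadrant, v t x = v' t x := by
  obtain ⟨B, hB0, hB⟩ := S.exists_step_sub_le
  obtain ⟨M, hM⟩ := S.exists_step_bound
  have hM0 : 0 ≤ M := (abs_nonneg _).trans (hM v 0 0)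
  set l : ℝ := 2 * B + 1 with hl
  have hl0 : 0 < l := by positivity
  have hind : ∀ n : ℕ, ∀ t ∈ Icc 0 τ, ∀ x ∈ quadrant,
      |v t x - v' t x| ≤ (2 * M) * (1 / 2) ^ n * Real.exp (l * t) := by
    intro n
    induction n with
    | zero =>
      intro t ht x hx
      rw [h t ht x hx, h' t ht x hx, pow_zero, mul_one]
      have h1 : 1 ≤ Real.exp (l * t) := Real.one_le_exp (mul_nonneg hl0.le ht.1)
      calc _ ≤ |S.step v t x| + |S.step v' t x| := abs_sub _ _
        _ ≤ 2 * M := by linarith [hM v t x, hM v' t x]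
        _ ≤ _ := le_mul_of_one_le_right (by positivity) h1
    | succ n ih =>
      intro t ht x hx
      rw [h t ht x hx, h' t ht x hx]
      refine (hB v v' hv hv' l _ t hl0 (by positivity) ⟨ht.1, ht.2.trans hτ.2⟩
        (fun r hr y hy => ih r ⟨hr.1, hr.2.trans ht.2⟩ y hy) x).trans ?_
      have h3 : B / l ≤ 1 / 2 := by rw [div_le_iff₀ hl0]; linarith
      calc _ = (B / l) * (2 * M * (1 / 2) ^ n * Real.exp (l * t)) := by ring
        _ ≤ (1 / 2) * (2 * M * (1 / 2) ^ n * Real.exp (l * t)) := by gcongr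
        _ = _ := by ring
  intro t ht x hx
  have hlim : Tendsto (fun n : ℕ => (2 * M) * (1 / 2 : ℝ) ^ n * Real.exp (l * t)) atTop (𝓝 0) := by
    have := ((tendsto_pow_atTop_nhds_zero_of_lt_one (r := (1 / 2 : ℝ)) (by norm_num)
      (by norm_num)).const_mul (2 * M)).mul_const (Real.exp (l * t))
    simpa using this
  have := ge_of_tendsto' hlim fun n => hind n t ht x hx
  exact sub_eq_zero.1 (abs_nonpos_iff.1 this)

/-- The spatial derivative of the flow. -/
noncomputable def pathDeriv (v : ℝ → ℝ × ℝ → ℝ) (s t : ℝ) (x : ℝ × ℝ) : ℝ × ℝ →L[ℝ] ℝ × ℝ :=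
  flowSlope (S.field v) (S.field' v) s t x x

theorem continuous_pathDeriv_comp (hv : Cont v) {X : Type*} [TopologicalSpace X] {a b : X → ℝ}
    {c : X → ℝ × ℝ} (ha : Continuous a) (hb : Continuous b) (hc : Continuous c) :
    Continuous fun p => S.pathDeriv v (a p) (b p) (c p) :=
  Continuous.comp (g := fun q : ℝ × ℝ × (ℝ × ℝ) × (ℝ × ℝ) =>
      flowSlope (S.field v) (S.field' v) q.1 q.2.1 q.2.2.1 q.2.2.2)
    (f := fun p => (a p, b p, c p, c p))
    (S.smoothField hv).continuous_flowSlope (ha.prodMk (hb.prodMk (hc.prodMk hc)))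

theorem hasFDerivAt_path (hv : Cont v) (s t : ℝ) (x : ℝ × ℝ) :
    HasFDerivAt (S.path v s t) (S.pathDeriv v s t x) x :=
  (S.smoothField hv).hasFDerivAt_flow s t x

/-- The spatial derivative of `rho`. -/
noncomputable def rhoDeriv (v : ℝ → ℝ × ℝ → ℝ) (t : ℝ) (x : ℝ × ℝ) : ℝ × ℝ →L[ℝ] ℝ :=
  (fderiv ℝ S.r₀ (S.path v 0 (S.clamp t) x)).comp (S.pathDeriv v 0 (S.clamp t) x)

/-- The spatial derivative of `growth`. -/
noncomputable def growthDeriv (v : ℝ → ℝ × ℝ → ℝ) (t : ℝ) (x : ℝ × ℝ) : ℝ × ℝ →L[ℝ] ℝ :=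
  ∫ s in (0 : ℝ)..S.clamp t,
    (fderiv ℝ S.c (S.path v s (S.clamp t) x)).comp (S.pathDeriv v s (S.clamp t) x)

/-- The spatial derivative of `step`. -/
noncomputable def stepDeriv (v : ℝ → ℝ × ℝ → ℝ) (t : ℝ) (x : ℝ × ℝ) : ℝ × ℝ →L[ℝ] ℝ :=
  (fderiv ℝ S.w₀ (S.path v 0 (S.clamp t) x)).comp (S.pathDeriv v 0 (S.clamp t) x) +
    (S.rho v t x • S.growthDeriv v t x + S.growth v t x • S.rhoDeriv v t x)

theorem continuous_fderiv_comp_path {f : ℝ × ℝ → ℝ} (hf : ContDiff ℝ 1 f) (hv : Cont v)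
    {X : Type*} [TopologicalSpace X] {a b : X → ℝ} {c : X → ℝ × ℝ} (ha : Continuous a)
    (hb : Continuous b) (hc : Continuous c) :
    Continuous fun p => (fderiv ℝ f (S.path v (a p) (b p) (c p))).comp
      (S.pathDeriv v (a p) (b p) (c p)) :=
  ((hf.continuous_fderiv one_ne_zero).comp (S.continuous_path_comp hv ha hb hc)).clm_comp
    (S.continuous_pathDeriv_comp hv ha hb hc)

theorem hasFDerivAt_comp_path {f : ℝ × ℝ → ℝ} (hf : ContDiff ℝ 1 f) (hv : Cont v) (s t : ℝ)
    (x : ℝ × ℝ) : HasFDerivAt (fun x => f (S.path v s t x))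
      ((fderiv ℝ f (S.path v s t x)).comp (S.pathDeriv v s t x)) x :=
  ((hf.differentiable one_ne_zero _).hasFDerivAt).comp x (S.hasFDerivAt_path hv s t x)

theorem continuous_rhoDeriv (hv : Cont v) :
    Continuous fun p : ℝ × ℝ × ℝ => S.rhoDeriv v p.1 p.2 :=
  S.continuous_fderiv_comp_path S.r₀_smooth hv continuous_const
    (S.continuous_clamp.comp continuous_fst) continuous_snd

theorem hasFDerivAt_rho (hv : Cont v) (t : ℝ) (x : ℝ × ℝ) :
    HasFDerivAt (S.rho v t) (S.rhoDeriv v t x) x :=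
  S.hasFDerivAt_comp_path S.r₀_smooth hv 0 _ x

theorem continuous_stepDeriv (hv : Cont v) :
    Continuous fun p : ℝ × ℝ × ℝ => S.stepDeriv v p.1 p.2 := by
  have hg : Continuous fun p : ℝ × ℝ × ℝ => S.growthDeriv v p.1 p.2 := by
    refine intervalIntegral.continuous_parametric_intervalIntegral_of_continuous
      (f := fun (p : ℝ × ℝ × ℝ) s => (fderiv ℝ S.c (S.path v s (S.clamp p.1) p.2)).comp
        (S.pathDeriv v s (S.clamp p.1) p.2)) ?_ (S.continuous_clamp.comp continuous_fst)
    exact S.continuous_fderiv_comp_path S.c_smooth hv continuous_snd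
      (S.continuous_clamp.comp (by fun_prop)) (by fun_prop)
  exact (S.continuous_fderiv_comp_path S.w₀_smooth hv continuous_const
    (S.continuous_clamp.comp continuous_fst) continuous_snd).add
    ((Continuous.smul (S.continuous_rho hv) hg).add
      (Continuous.smul (S.continuous_growth hv) (S.continuous_rhoDeriv hv)))

theorem hasFDerivAt_step (hv : Cont v) (t : ℝ) (x : ℝ × ℝ) :
    HasFDerivAt (S.step v t) (S.stepDeriv v t x) x := by
  have hg : HasFDerivAt (S.growth v t) (S.growthDeriv v t x) x :=
    hasFDerivAt_intervalIntegral_of_continuous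
    (F := fun x s => S.c (S.path v s (S.clamp t) x))
    (F' := fun x s => (fderiv ℝ S.c (S.path v s (S.clamp t) x)).comp
      (S.pathDeriv v s (S.clamp t) x))
    (S.c_smooth.continuous.comp
      (S.continuous_path_comp hv continuous_snd continuous_const continuous_fst))
    (S.continuous_fderiv_comp_path S.c_smooth hv continuous_snd continuous_const continuous_fst)
    (fun x s => S.hasFDerivAt_comp_path S.c_smooth hv s _ x) _ _ x
  exact (S.hasFDerivAt_comp_path S.w₀_smooth hv 0 _ x).add ((S.hasFDerivAt_rho hv t x).mul hg)

theorem path_path (hv : Cont v) (s r t : ℝ) (x : ℝ × ℝ) :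
    S.path v s r (S.path v r t x) = S.path v s t x :=
  (S.smoothField hv).lipField.flow_flow s r t x

theorem path_self (hv : Cont v) (t : ℝ) (x : ℝ × ℝ) : S.path v t t x = x :=
  (S.smoothField hv).lipField.flow_self t x

theorem hasDerivAt_path (hv : Cont v) (s t : ℝ) (x : ℝ × ℝ) :
    HasDerivAt (fun s => S.path v s t x) (S.field v s (S.path v s t x)) s :=
  (S.smoothField hv).lipField.hasDerivAt_flow s t x

theorem rho_path (hv : Cont v) {s : ℝ} (hs : s ∈ Icc 0 S.T) (t : ℝ) (x : ℝ × ℝ) :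
    S.rho v s (S.path v s t x) = S.r₀ (S.path v 0 t x) := by
  rw [rho, S.clamp_of_mem hs, S.path_path hv]

theorem step_path (hv : Cont v) {s : ℝ} (hs : s ∈ Icc 0 S.T) (t : ℝ) (x : ℝ × ℝ) :
    S.step v s (S.path v s t x) = S.w₀ (S.path v 0 t x) +
      S.r₀ (S.path v 0 t x) * ∫ r in (0 : ℝ)..s, S.c (S.path v r t x) := by
  simp only [step, S.rho_path hv hs, growth, S.clamp_of_mem hs, S.path_path hv]

theorem hasDerivWithinAt_step_path (hv : Cont v) {s : ℝ} (hs : s ∈ Icc 0 S.T) (t : ℝ)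
    (x : ℝ × ℝ) : HasDerivWithinAt (fun s => S.step v s (S.path v s t x))
      (S.r₀ (S.path v 0 t x) * S.c (S.path v s t x)) (Icc 0 S.T) s := by
  have hc : Continuous fun r => S.c (S.path v r t x) := S.c_smooth.continuous.comp
    (S.continuous_path_comp hv continuous_id continuous_const continuous_const)
  have h1 : HasDerivAt (fun s => S.w₀ (S.path v 0 t x) +
      S.r₀ (S.path v 0 t x) * ∫ r in (0 : ℝ)..s, S.c (S.path v r t x))
      (S.r₀ (S.path v 0 t x) * S.c (S.path v s t x)) s :=
    ((intervalIntegral.integral_hasDerivAt_right (hc.intervalIntegrable _ _)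
      (hc.stronglyMeasurableAtFilter _ _) hc.continuousAt).const_mul _).const_add _
  exact h1.hasDerivWithinAt.congr (fun r hr => S.step_path hv hr t x) (S.step_path hv hs t x)

/-- Passage from the Lagrangian to the Eulerian form. The difference between following the path and
staying at x contributes the spatial derivative in the direction of the velocity, to be subtracted.
-/
theorem hasDerivWithinAt_of_path (hv : Cont v) {u : ℝ → ℝ × ℝ → ℝ}
    {u' : ℝ → ℝ × ℝ → ℝ × ℝ →L[ℝ] ℝ} (hu : ∀ t x, HasFDerivAt (u t) (u' t x) x)
    (hu' : Continuous fun p : ℝ × ℝ × ℝ => u' p.1 p.2) {t : ℝ} (ht : t ∈ Icc 0 S.T) {x : ℝ × ℝ}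
    {d : ℝ} (h : HasDerivWithinAt (fun s => u s (S.path v s t x)) d (Icc 0 S.T) t) :
    HasDerivWithinAt (fun s => u s x) (d - u' t x (S.field v t x)) (Icc 0 S.T) t := by
  have h1 := hasDerivWithinAt_along_sub (A := univ) convex_univ (v := u) (G := u')
    (S.hasDerivAt_path hv t t x).hasDerivWithinAt (fun _ _ => mem_univ _) ht
    (fun s _ y _ => (hu s y).hasFDerivWithinAt) (by
      rw [nhdsWithin_univ]
      have h2 := hu'.tendsto (t, S.path v t t x)
      rw [nhds_prod_eq] at h2
      exact h2.mono_left (Filter.prod_mono nhdsWithin_le_nhds le_rfl))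
  simp only [S.path_self hv] at h1
  have h2 := h.sub h1
  refine h2.congr_of_mem (fun s _ => ?_) ht
  simp

theorem hasDerivWithinAt_step (hv : Cont v) {t : ℝ} (ht : t ∈ Icc 0 S.T) (x : ℝ × ℝ) :
    HasDerivWithinAt (fun s => S.step v s x)
      (S.rho v t x * S.c x - S.stepDeriv v t x (S.field v t x)) (Icc 0 S.T) t := by
  refine S.hasDerivWithinAt_of_path hv (S.hasFDerivAt_step hv) (S.continuous_stepDeriv hv) ht ?_
  have := S.hasDerivWithinAt_step_path hv ht t x
  rw [S.path_self hv] at this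
  rwa [rho, S.clamp_of_mem ht]

theorem hasDerivWithinAt_rho (hv : Cont v) {t : ℝ} (ht : t ∈ Icc 0 S.T) (x : ℝ × ℝ) :
    HasDerivWithinAt (fun s => S.rho v s x)
      (-S.rhoDeriv v t x (S.field v t x)) (Icc 0 S.T) t := by
  rw [← zero_sub]
  refine S.hasDerivWithinAt_of_path hv (S.hasFDerivAt_rho hv) (S.continuous_rhoDeriv hv) ht ?_
  exact (hasDerivWithinAt_const t (Icc 0 S.T) (S.r₀ (S.path v 0 t x))).congr
    (fun r hr => S.rho_path hv hr t x) (S.rho_path hv ht t x)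

end CutData

end BoussinesqModel

namespace BoussinesqModel

/-! ### Cutting off the coefficients of the original system. -/

section Cutoff

/-- The kernel `y₁ y₂ / |y|⁴`. -/
noncomputable def kernel (y : ℝ × ℝ) : ℝ := y.1 * y.2 / (y.1 ^ 2 + y.2 ^ 2) ^ 2

/-- A smooth cutoff function supported in the open right half plane. -/
structure Cutoff (η : ℝ × ℝ → ℝ) : Prop where
  smooth : ContDiff ℝ 1 η
  supp : HasCompactSupport η
  pos : tsupport η ⊆ {x | 0 < x.1}
  nonneg : ∀ x, 0 ≤ η x

theorem exists_cutoff {a R : ℝ} (ha : 0 < a) (haR : a < R) :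
    ∃ η, Cutoff η ∧ ∀ x : ℝ × ℝ, a ≤ x.1 → x.1 ≤ R → |x.2| ≤ R → η x = 1 := by
  let f : ContDiffBump ((a + R) / 2) := ⟨(R - a) / 2, (R - a) / 2 + a / 2, by linarith, by linarith⟩
  let g : ContDiffBump (0 : ℝ) := ⟨R, R + 1, by linarith, by linarith⟩
  have hsub : tsupport (fun x : ℝ × ℝ => f x.1 * g x.2) ⊆
      Metric.closedBall ((a + R) / 2) ((R - a) / 2 + a / 2) ×ˢ Metric.closedBall 0 (R + 1) := by
    refine closure_minimal (fun x hx => ?_)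
      (Metric.isClosed_closedBall.prod Metric.isClosed_closedBall)
    have h := mul_ne_zero_iff.1 (Function.mem_support.1 hx)
    have h1 : x.1 ∈ Function.support f := h.1
    have h2 : x.2 ∈ Function.support g := h.2
    rw [ContDiffBump.support_eq] at h1 h2
    exact ⟨Metric.ball_subset_closedBall h1, Metric.ball_subset_closedBall h2⟩
  refine ⟨fun x => f x.1 * g x.2, ⟨?_, ?_, ?_, fun x => mul_nonneg f.nonneg g.nonneg⟩, ?_⟩
  · exact (f.contDiff.comp contDiff_fst).mul (g.contDiff.comp contDiff_snd)
  · exact ((isCompact_closedBall _ _).prod (isCompact_closedBall _ _)).of_isClosed_subset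
      (isClosed_tsupport _) hsub
  · intro x hx
    have h := (hsub hx).1
    rw [Metric.mem_closedBall, Real.dist_eq] at h
    have := (abs_le.1 h).1
    simp only [mem_ofPred_eq]
    linarith
  · intro x h1 h2 h3
    have e1 : f x.1 = 1 := f.one_of_mem_closedBall (by
      rw [Metric.mem_closedBall, Real.dist_eq, abs_le]
      constructor <;> simp only [f] <;> linarith)
    have e2 : g x.2 = 1 := g.one_of_mem_closedBall (by
      rw [Metric.mem_closedBall, Real.dist_eq, sub_zero]; exact h3)
    simp only [e1, e2, mul_one]

variable {η : ℝ × ℝ → ℝ}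

theorem Cutoff.eventually_zero (hη : Cutoff η) {x : ℝ × ℝ} (hx : ¬ 0 < x.1) : η =ᶠ[𝓝 x] 0 :=
  notMem_tsupport_iff_eventuallyEq.1 fun h => hx (hη.pos h)

theorem Cutoff.continuous_mul (hη : Cutoff η) {f : ℝ × ℝ → ℝ}
    (hf : ∀ x : ℝ × ℝ, 0 < x.1 → ContinuousAt f x) : Continuous fun x => η x * f x := by
  rw [continuous_iff_continuousAt]
  intro x
  by_cases hx : 0 < x.1
  · exact hη.smooth.continuous.continuousAt.mul (hf x hx)
  · refine (continuousAt_const (y := (0 : ℝ))).congr ?_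
    filter_upwards [hη.eventually_zero hx] with y hy
    simp [hy]

theorem Cutoff.contDiff_mul (hη : Cutoff η) {f : ℝ × ℝ → ℝ}
    (hf : ∀ x : ℝ × ℝ, 0 < x.1 → ContDiffAt ℝ 1 f x) : ContDiff ℝ 1 fun x => η x * f x := by
  rw [contDiff_iff_contDiffAt]
  intro x
  by_cases hx : 0 < x.1
  · exact hη.smooth.contDiffAt.mul (hf x hx)
  · refine (contDiffAt_const (c := (0 : ℝ))).congr_of_eventuallyEq ?_
    filter_upwards [hη.eventually_zero hx] with y hy
    simp [hy]

theorem Cutoff.eq_zero (hη : Cutoff η) {x : ℝ × ℝ} (hx : ¬ 0 < x.1) : η x = 0 :=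
  image_eq_zero_of_notMem_tsupport fun h => hx (hη.pos h)

/-- A compactly supported `C¹` function on the plane supported in the right half plane. -/
structure Datum (g : ℝ × ℝ → ℝ) : Prop where
  smooth : ContDiff ℝ 1 g
  supp : HasCompactSupport g
  pos : tsupport g ⊆ {x | 0 < x.1}

/-- The cut-off Cauchy problem defined by the cutoff function `η`. -/
noncomputable def cutData {α : ℝ} (hα : 0 < α) (hη : Cutoff η) {w₀ r₀ : ℝ × ℝ → ℝ}
    (hw : Datum w₀) (hr : Datum r₀) {T N : ℝ} (hT : 0 ≤ T) (hN : 0 ≤ N) : CutData where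
  α := α
  α_pos := hα
  -- Replacing y₂ by its positive part leaves the kernel unchanged on the quadrant, makes it vanish
  -- for y₂ < 0, and keeps it continuous for y₁ > 0.
  k y := η y * kernel (y.1, max y.2 0)
  k_cont := hη.continuous_mul fun x hx => by
    have : (x.1 ^ 2 + (max x.2 0) ^ 2) ^ 2 ≠ 0 := by positivity
    exact ContinuousAt.div (by fun_prop) (by fun_prop) this
  k_supp := hη.supp.mul_right
  k_zero y hy := by
    by_cases h1 : 0 < y.1
    · have h2 : ¬ 0 ≤ y.2 := fun h2 => hy ⟨h1.le, h2⟩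
      simp [kernel, max_eq_right (not_le.1 h2).le]
    · simp [hη.eq_zero h1]
  m x := η x • (-x.1, x.2)
  m_smooth := hη.smooth.smul (contDiff_fst.neg.prodMk contDiff_snd)
  m_supp := hη.supp.smul_right
  c x := η x * x.1⁻¹
  c_smooth := hη.contDiff_mul fun x hx => contDiffAt_fst.inv hx.ne'
  c_supp := hη.supp.mul_right
  w₀ := w₀
  w₀_smooth := hw.smooth
  w₀_supp := hw.supp
  r₀ := r₀
  r₀_smooth := hr.smooth
  r₀_supp := hr.supp
  T := T
  T_nonneg := hT
  N := N
  N_nonneg := hN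

/-- A cut-off Cauchy problem together with a solution for which the truncation is inactive. -/
structure CutSol (α : ℝ) (η w₀ r₀ : ℝ × ℝ → ℝ) (T : ℝ) where
  S : CutData
  cutoff : Cutoff η
  datum_w : Datum w₀
  datum_r : Datum r₀
  α_eq : S.α = α
  k_eq : S.k = fun y => η y * kernel (y.1, max y.2 0)
  m_eq : S.m = fun x => η x • (-x.1, x.2)
  c_eq : S.c = fun x => η x * x.1⁻¹
  w₀_eq : S.w₀ = w₀
  r₀_eq : S.r₀ = r₀
  T_eq : S.T = T
  v : ℝ → ℝ × ℝ → ℝ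
  cont : CutData.Cont v
  fix : ∀ t x, v t x = S.step v t x
  bound : ∀ t x, |v t x| ≤ S.N

/-- The bound for `step` involves the data, `c` and the final time, but not the truncation level.
Taking that bound as the level makes the truncation inactive, so cut-off solutions exist on any time
interval. -/
theorem exists_cutSol {α : ℝ} (hα : 0 < α) (hη : Cutoff η) {w₀ r₀ : ℝ × ℝ → ℝ}
    (hw : Datum w₀) (hr : Datum r₀) {T : ℝ} (hT : 0 ≤ T) (N : ℝ) :
    ∃ P : CutSol α η w₀ r₀ T, N ≤ P.S.N := by
  obtain ⟨A, hA⟩ := hw.smooth.continuous.bounded_above_of_compact_support hw.supp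
  obtain ⟨B, hB⟩ := hr.smooth.continuous.bounded_above_of_compact_support hr.supp
  let S₀ := cutData hα hη hw hr hT le_rfl
  obtain ⟨C, hC⟩ := S₀.c_smooth.continuous.bounded_above_of_compact_support S₀.c_supp
  have hN : 0 ≤ max N (A + B * (C * T)) := by
    refine le_max_of_le_right ?_
    have h1 := (norm_nonneg _).trans (hA 0)
    have h2 := (norm_nonneg _).trans (hB 0)
    have h3 := (norm_nonneg _).trans (hC 0)
    positivity
  let S := cutData hα hη hw hr hT hN
  obtain ⟨v, hv, hfix⟩ := S.exists_fixedPoint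
  refine ⟨⟨S, hη, hw, hr, rfl, rfl, rfl, rfl, rfl, rfl, rfl, v, hv, hfix, fun t x => ?_⟩,
    le_max_left _ _⟩
  rw [hfix]
  exact (S.abs_step_le hA hB hC v t x).trans (le_max_right _ _)

end Cutoff

/-- Explicit solution of a scalar linear homogeneous equation. -/
theorem eq_mul_exp_integral {y a : ℝ → ℝ} (ha : Continuous a)
    (hy : ∀ s, HasDerivAt y (a s * y s) s) (s t : ℝ) :
    y s = y t * Real.exp (∫ r in t..s, a r) := by
  have hE : ∀ s, HasDerivAt (fun s => ∫ r in t..s, a r) (a s) s := fun s =>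
    intervalIntegral.integral_hasDerivAt_right (ha.intervalIntegrable _ _)
      (ha.stronglyMeasurableAtFilter _ _) ha.continuousAt
  have hd : ∀ s, HasDerivAt (fun s => y s * Real.exp (-∫ r in t..s, a r)) 0 s := by
    intro s
    have := (hy s).mul ((hE s).neg.exp)
    refine this.congr_deriv ?_
    ring
  have hc := is_const_of_deriv_eq_zero (fun s => (hd s).differentiableAt)
    (fun s => (hd s).deriv) s t
  simp only [intervalIntegral.integral_same, neg_zero, Real.exp_zero, mul_one] at hc
  rw [← hc, mul_assoc, ← Real.exp_add]; simp

namespace CutSol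

variable {α : ℝ} {η w₀ r₀ : ℝ × ℝ → ℝ} {T : ℝ} (P : CutSol α η w₀ r₀ T)

/-- The exponential rate of the motion along the trajectory through `(t, x)`, for an arbitrary
vorticity `u`. -/
noncomputable def rate (u : ℝ → ℝ × ℝ → ℝ) (t : ℝ) (x : ℝ × ℝ) (s : ℝ) : ℝ :=
  P.S.q u s (P.S.path u s t x) * η (P.S.path u s t x)

variable {u : ℝ → ℝ × ℝ → ℝ}

theorem continuous_rate (hu : CutData.Cont u) (t : ℝ) (x : ℝ × ℝ) :
    Continuous (P.rate u t x) := by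
  have hp : Continuous fun s => P.S.path u s t x :=
    P.S.continuous_path_comp hu continuous_id continuous_const continuous_const
  exact (Continuous.comp (g := fun p : ℝ × ℝ × ℝ => P.S.q u p.1 p.2) (P.S.continuous_q hu)
    (continuous_id.prodMk hp)).mul (P.cutoff.smooth.continuous.comp hp)

theorem field_eq (u : ℝ → ℝ × ℝ → ℝ) (t : ℝ) (x : ℝ × ℝ) :
    P.S.field u t x = (-(P.S.q u t x * η x) * x.1, (P.S.q u t x * η x) * x.2) := by
  simp only [CutData.field, P.m_eq, Prod.smul_mk, smul_eq_mul, Prod.mk.injEq]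
  constructor <;> ring

theorem hasDerivAt_path_fst (hu : CutData.Cont u) (s t : ℝ) (x : ℝ × ℝ) :
    HasDerivAt (fun s => (P.S.path u s t x).1) (-P.rate u t x s * (P.S.path u s t x).1) s := by
  have := (P.S.hasDerivAt_path hu s t x).fst
  rwa [P.field_eq] at this

theorem hasDerivAt_path_snd (hu : CutData.Cont u) (s t : ℝ) (x : ℝ × ℝ) :
    HasDerivAt (fun s => (P.S.path u s t x).2) (P.rate u t x s * (P.S.path u s t x).2) s := by
  have := (P.S.hasDerivAt_path hu s t x).snd
  rwa [P.field_eq] at this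

/-- Each coordinate solves a scalar linear equation, so it is its initial value times a positive
exponential. This preserves the quadrant and the half plane x₁ > 0. -/
theorem path_fst (hu : CutData.Cont u) (s t : ℝ) (x : ℝ × ℝ) :
    (P.S.path u s t x).1 = x.1 * Real.exp (∫ r in t..s, -P.rate u t x r) := by
  have := eq_mul_exp_integral (P.continuous_rate hu t x).neg
    (fun s => P.hasDerivAt_path_fst hu s t x) s t
  rwa [P.S.path_self hu] at this

theorem path_snd (hu : CutData.Cont u) (s t : ℝ) (x : ℝ × ℝ) :
    (P.S.path u s t x).2 = x.2 * Real.exp (∫ r in t..s, P.rate u t x r) := by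
  have := eq_mul_exp_integral (P.continuous_rate hu t x)
    (fun s => P.hasDerivAt_path_snd hu s t x) s t
  rwa [P.S.path_self hu] at this

theorem path_fst_pos (hu : CutData.Cont u) (s t : ℝ) {x : ℝ × ℝ} (hx : 0 < x.1) :
    0 < (P.S.path u s t x).1 := by
  rw [P.path_fst hu]; positivity

theorem path_mem_quadrant (hu : CutData.Cont u) (s t : ℝ) {x : ℝ × ℝ} (hx : x ∈ quadrant) :
    P.S.path u s t x ∈ quadrant := by
  refine ⟨?_, ?_⟩
  · rw [P.path_fst hu]; exact mul_nonneg hx.1 (Real.exp_pos _).le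
  · rw [P.path_snd hu]; exact mul_nonneg hx.2 (Real.exp_pos _).le

end CutSol

end BoussinesqModel

/-! ### From cut-off solutions to solutions of the original system. -/

namespace BoussinesqModel

theorem quadrant_eq_prod : quadrant = Ici (0 : ℝ) ×ˢ Ici (0 : ℝ) := rfl

theorem isClosed_quadrant : IsClosed quadrant := isClosed_Ici.prod isClosed_Ici

theorem measurableSet_quadrant : MeasurableSet quadrant := isClosed_quadrant.measurableSet

theorem convex_quadrant : Convex ℝ quadrant := (convex_Ici 0).prod (convex_Ici 0)

theorem uniqueDiffOn_quadrant : UniqueDiffOn ℝ quadrant :=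
  (uniqueDiffOn_Ici 0).prod (uniqueDiffOn_Ici 0)

theorem mem_quadrant_of_sub_mem_sector {α : ℝ} {x y : ℝ × ℝ} (hx : x ∈ quadrant)
    (hy : y - x ∈ sector α) : y ∈ quadrant := by
  obtain ⟨h1, h2, -⟩ := hy
  rw [Prod.fst_sub] at h1
  rw [Prod.snd_sub] at h2
  exact ⟨by linarith [hx.1], by linarith [hx.2]⟩

theorem Q_eq_sectorIntegral (α : ℝ) (f : ℝ × ℝ → ℝ) (x : ℝ × ℝ) :
    Q α f x = sectorIntegral α (fun y => kernel y * f y) x := rfl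

theorem Q_congr {α : ℝ} {f g : ℝ × ℝ → ℝ} (h : EqOn f g quadrant) {x : ℝ × ℝ}
    (hx : x ∈ quadrant) : Q α f x = Q α g x := by
  refine setIntegral_congr_fun (measurableSet_translate_sector α x) fun y hy => ?_
  simp only [h (mem_quadrant_of_sub_mem_sector hx hy)]

theorem velocity_congr {α : ℝ} {f g : ℝ × ℝ → ℝ} (h : EqOn f g quadrant) {x : ℝ × ℝ}
    (hx : x ∈ quadrant) : velocity α f x = velocity α g x := by
  simp only [velocity, Q_congr h hx]

theorem kernel_nonneg {y : ℝ × ℝ} (hy : y ∈ quadrant) : 0 ≤ kernel y :=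
  div_nonneg (mul_nonneg hy.1 hy.2) (by positivity)

/-- Joint continuity gives uniform convergence on a compact set, and outside a common support
nothing is left to check. This supplies both continuity clauses of `ContinuousInX`. -/
theorem tendstoUniformlyOn_of_compact {E G : Type*} [TopologicalSpace E] [NormedAddCommGroup G]
    {F : ℝ → E → G} (hF : Continuous fun p : ℝ × E => F p.1 p.2) {K A : Set E} (hK : IsCompact K)
    {I : Set ℝ} (h0 : ∀ s ∈ I, ∀ y ∈ A, y ∉ K → F s y = 0) {t : ℝ} (ht : t ∈ I) :
    TendstoUniformlyOn F (F t) (𝓝[I] t) A := by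
  rw [Metric.tendstoUniformlyOn_iff]
  intro ε hε
  have h1 : ∀ᶠ s in 𝓝 t, ∀ y ∈ K, dist (F t y) (F s y) < ε := by
    refine hK.eventually_forall_of_forall_eventually fun y _ => ?_
    have hc : Continuous fun p : ℝ × E => dist (F t p.2) (F p.1 p.2) :=
      (hF.comp (by fun_prop : Continuous fun p : ℝ × E => (t, p.2))).dist hF
    exact (hc.tendsto (t, y)).eventually_lt_const (by simpa using hε)
  filter_upwards [mem_nhdsWithin_of_mem_nhds h1, self_mem_nhdsWithin] with s hs hsI y hy
  by_cases hyK : y ∈ K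
  · exact hs y hyK
  · rw [h0 s hsI y hy hyK, h0 t ht y hy hyK, dist_self]; exact hε

theorem MemX.exists_datum {f : ℝ × ℝ → ℝ} (hf : MemX f) : ∃ g, Datum g ∧ EqOn f g quadrant := by
  obtain ⟨g, h1, h2, h3, h4⟩ := hf
  exact ⟨g, ⟨h1, h2, h3⟩, h4⟩

theorem fderivWithin_quadrant_eq_zero {f : ℝ × ℝ → ℝ} {x : ℝ × ℝ} (hx : x ∈ quadrant)
    {U : Set (ℝ × ℝ)} (hU : U ∈ 𝓝[quadrant] x) (h : ∀ y ∈ U, y ∈ quadrant → f y = 0) :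
    fderivWithin ℝ f quadrant x = 0 := by
  have h1 : f =ᶠ[𝓝[quadrant] x] fun _ => (0 : ℝ) := by
    filter_upwards [hU, self_mem_nhdsWithin] with y hy hyq using h y hy hyq
  rw [h1.fderivWithin_eq (h1.eq_of_nhdsWithin hx)]
  simp

namespace CutSol

variable {α : ℝ} {η w₀ r₀ : ℝ × ℝ → ℝ} {T : ℝ} (P : CutSol α η w₀ r₀ T)

/-- The density transported by the solution. -/
noncomputable def ρ (t : ℝ) (x : ℝ × ℝ) : ℝ := P.S.rho P.v t x

theorem v_eq_step : P.v = P.S.step P.v := by funext t x; exact P.fix t x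

theorem c_nonneg {x : ℝ × ℝ} (hx : x ∈ quadrant) : 0 ≤ P.S.c x := by
  rw [P.c_eq]; exact mul_nonneg (P.cutoff.nonneg x) (inv_nonneg.2 hx.1)

theorem growth_nonneg {u : ℝ → ℝ × ℝ → ℝ} (hu : CutData.Cont u) (t : ℝ) {x : ℝ × ℝ}
    (hx : x ∈ quadrant) : 0 ≤ P.S.growth u t x :=
  intervalIntegral.integral_nonneg (P.S.clamp_mem t).1 fun _ _ =>
    P.c_nonneg (P.path_mem_quadrant hu _ _ hx)

theorem q_eq_Q {u : ℝ → ℝ × ℝ → ℝ} {t : ℝ} (ht : t ∈ Icc 0 T)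
    (hN : ∀ y ∈ quadrant, |u t y| ≤ P.S.N) (hη : ∀ y ∈ quadrant, u t y ≠ 0 → η y = 1)
    {x : ℝ × ℝ} (hx : x ∈ quadrant) : P.S.q u t x = Q α (u t) x := by
  rw [CutData.q, Q_eq_sectorIntegral, sectorIntegral, sectorIntegral, P.α_eq]
  refine setIntegral_congr_fun (measurableSet_translate_sector α x) fun y hy => ?_
  have hyq := mem_quadrant_of_sub_mem_sector hx hy
  rw [← P.T_eq] at ht
  simp only [CutData.density, P.k_eq, P.S.clamp_of_mem ht, max_eq_left hyq.2,
    clip_of_abs_le (hN y hyq)]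
  by_cases h0 : u t y = 0
  · simp [h0]
  · rw [hη y hyq h0, one_mul]

theorem ρ_nonneg (hr : ∀ x ∈ quadrant, 0 ≤ r₀ x) (t : ℝ) {x : ℝ × ℝ}
    (hx : x ∈ quadrant) : 0 ≤ P.ρ t x := by
  rw [ρ, CutData.rho, P.r₀_eq]
  exact hr _ (P.path_mem_quadrant P.cont _ _ hx)

theorem v_nonneg (hw : ∀ x ∈ quadrant, 0 ≤ w₀ x) (hr : ∀ x ∈ quadrant, 0 ≤ r₀ x) (t : ℝ)
    {x : ℝ × ℝ} (hx : x ∈ quadrant) : 0 ≤ P.v t x := by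
  rw [P.fix, CutData.step, P.w₀_eq]
  exact add_nonneg (hw _ (P.path_mem_quadrant P.cont _ _ hx))
    (mul_nonneg (P.ρ_nonneg hr t hx) (P.growth_nonneg P.cont t hx))

theorem q_nonneg (hw : ∀ x ∈ quadrant, 0 ≤ w₀ x) (hr : ∀ x ∈ quadrant, 0 ≤ r₀ x) (t : ℝ)
    (x : ℝ × ℝ) : 0 ≤ P.S.q P.v t x := by
  refine integral_nonneg fun y => ?_
  by_cases hy : y ∈ quadrant
  · simp only [Pi.zero_apply, CutData.density, P.k_eq, max_eq_left hy.2]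
    refine mul_nonneg (mul_nonneg (P.cutoff.nonneg y) (kernel_nonneg hy)) ?_
    rw [clip_of_abs_le (P.bound _ _)]
    exact P.v_nonneg hw hr _ hy
  · simp [CutData.density, P.S.k_zero y hy]

theorem hasFDerivAt_v (t : ℝ) (x : ℝ × ℝ) : HasFDerivAt (P.v t) (P.S.stepDeriv P.v t x) x := by
  have h := P.S.hasFDerivAt_step P.cont t x
  rwa [← P.v_eq_step] at h

theorem hasFDerivAt_ρ (t : ℝ) (x : ℝ × ℝ) : HasFDerivAt (P.ρ t) (P.S.rhoDeriv P.v t x) x :=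
  P.S.hasFDerivAt_rho P.cont t x

/-- The support lies in the image of the initial supports under the flow. That image is compact and
stays in x₁ > 0. -/
theorem datum_of_transport {f : ℝ × ℝ → ℝ} {f' : ℝ × ℝ → ℝ × ℝ →L[ℝ] ℝ}
    (hf : ∀ x, HasFDerivAt f (f' x) x) (hf' : Continuous f') (t : ℝ)
    (h0 : ∀ x, w₀ (P.S.path P.v 0 t x) = 0 → r₀ (P.S.path P.v 0 t x) = 0 → f x = 0) :
    Datum f := by
  have hK : IsCompact (P.S.path P.v t 0 '' (tsupport w₀ ∪ tsupport r₀)) :=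
    (P.datum_w.supp.isCompact.union P.datum_r.supp.isCompact).image
      (P.S.continuous_path_comp P.cont continuous_const continuous_const continuous_id)
  have hsub : tsupport f ⊆ P.S.path P.v t 0 '' (tsupport w₀ ∪ tsupport r₀) := by
    refine closure_minimal (fun x hx => ?_) hK.isClosed
    refine ⟨P.S.path P.v 0 t x, ?_, by rw [P.S.path_path P.cont, P.S.path_self P.cont]⟩
    by_contra hcon
    rw [mem_union, not_or] at hcon
    exact hx (h0 x (image_eq_zero_of_notMem_tsupport hcon.1)
      (image_eq_zero_of_notMem_tsupport hcon.2))
  refine ⟨?_, hK.of_isClosed_subset (isClosed_tsupport _) hsub, fun x hx => ?_⟩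
  · rw [contDiff_one_iff_fderiv]
    refine ⟨fun x => (hf x).differentiableAt, ?_⟩
    have : fderiv ℝ f = f' := funext fun x => (hf x).fderiv
    rwa [this]
  · obtain ⟨y, hy, rfl⟩ := hsub hx
    refine P.path_fst_pos P.cont t 0 ?_
    rcases hy with hy | hy
    · exact P.datum_w.pos hy
    · exact P.datum_r.pos hy

theorem datum_v {t : ℝ} (ht : t ∈ Icc 0 T) : Datum (P.v t) := by
  refine P.datum_of_transport (P.hasFDerivAt_v t)
    ((P.S.continuous_stepDeriv P.cont).comp (by fun_prop : Continuous fun x => (t, x))) t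
    fun x h1 h2 => ?_
  rw [← P.T_eq] at ht
  rw [P.fix, CutData.step, CutData.rho, P.S.clamp_of_mem ht, P.w₀_eq, P.r₀_eq, h1, h2]
  simp

theorem datum_ρ {t : ℝ} (ht : t ∈ Icc 0 T) : Datum (P.ρ t) := by
  refine P.datum_of_transport (P.hasFDerivAt_ρ t)
    ((P.S.continuous_rhoDeriv P.cont).comp (by fun_prop : Continuous fun x => (t, x))) t
    fun x h1 h2 => ?_
  rw [← P.T_eq] at ht
  rw [ρ, CutData.rho, P.S.clamp_of_mem ht, P.r₀_eq, h2]

theorem continuousInX {f : ℝ → ℝ × ℝ → ℝ} {f' : ℝ → ℝ × ℝ → ℝ × ℝ →L[ℝ] ℝ} {τ : ℝ}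
    (hη : Cutoff η)
    (hc : CutData.Cont f) (hc' : Continuous fun p : ℝ × ℝ × ℝ => f' p.1 p.2)
    (hf : ∀ t x, HasFDerivAt (f t) (f' t x) x) (hd : ∀ t ∈ Ico 0 τ, Datum (f t))
    (h0 : ∀ t ∈ Ico 0 τ, ∀ x ∈ quadrant, f t x ≠ 0 → η x = 1) : ContinuousInX τ f := by
  have hfd : ∀ t, EqOn (fderivWithin ℝ (f t) quadrant) (f' t) quadrant := fun t x hx =>
    (hf t x).hasFDerivWithinAt.fderivWithin (uniqueDiffOn_quadrant x hx)
  have hz : ∀ t ∈ Ico 0 τ, ∀ x ∈ quadrant, x ∉ tsupport η → f t x = 0 := by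
    intro t ht x hx hxη
    by_contra hne
    have := h0 t ht x hx hne
    rw [image_eq_zero_of_notMem_tsupport hxη] at this
    exact zero_ne_one this
  refine ⟨fun t ht => ⟨f t, (hd t ht).smooth, (hd t ht).supp, (hd t ht).pos, fun _ _ => rfl⟩,
    fun t ht => tendstoUniformlyOn_of_compact hc hη.supp.isCompact hz ht, fun t ht => ?_,
    fun T' hT' => ⟨tsupport η, hη.supp.isCompact, hη.pos, fun t ht x hx hxη =>
      hz t ⟨ht.1, ht.2.trans_lt hT'.2⟩ x hx hxη⟩⟩
  have hz' : ∀ t ∈ Ico 0 τ, ∀ x ∈ quadrant, x ∉ tsupport η → f' t x = 0 := by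
    intro t ht x hx hxη
    rw [← hfd t hx]
    exact fderivWithin_quadrant_eq_zero hx
      (mem_nhdsWithin_of_mem_nhds ((isClosed_tsupport η).isOpen_compl.mem_nhds hxη))
      fun y hy hyq => hz t ht y hyq hy
  exact ((tendstoUniformlyOn_of_compact hc' hη.supp.isCompact hz' ht).congr_right
    (hfd t).symm).congr (Eventually.of_forall fun s => (hfd s).symm)

/-- As long as the cutoff is inactive on the supports, the solution of the cut-off problem solves
the original one. -/
theorem isSolution {ω₀ ρ₀ : ℝ × ℝ → ℝ} (hω : EqOn ω₀ w₀ quadrant) (hρ : EqOn ρ₀ r₀ quadrant)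
    {τ : ℝ} (hτ : τ ≤ T)
    (hlive : ∀ t ∈ Ico 0 τ, ∀ x ∈ quadrant, P.v t x ≠ 0 ∨ P.ρ t x ≠ 0 → η x = 1) :
    IsSolution α ω₀ ρ₀ τ P.v P.ρ := by
  have hIcc : ∀ t ∈ Ico 0 τ, t ∈ Icc 0 T := fun t ht => ⟨ht.1, ht.2.le.trans hτ⟩
  have hIccS : ∀ t ∈ Ico 0 τ, t ∈ Icc 0 P.S.T := fun t ht => by rw [P.T_eq]; exact hIcc t ht
  have hnhds : ∀ t ∈ Ico 0 τ, Icc 0 P.S.T ∈ 𝓝[Ici 0] t := fun t ht => by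
    rw [P.T_eq, ← Ici_inter_Iic]
    exact inter_mem_nhdsWithin _ (Iic_mem_nhds (ht.2.trans_le hτ))
  have hclamp0 : P.S.clamp 0 = 0 := P.S.clamp_of_mem ⟨le_rfl, P.S.T_nonneg⟩
  have hfw : ∀ t, ∀ x ∈ quadrant, fderivWithin ℝ (P.v t) quadrant x = P.S.stepDeriv P.v t x :=
    fun t x hx => (P.hasFDerivAt_v t x).hasFDerivWithinAt.fderivWithin (uniqueDiffOn_quadrant x hx)
  have hfr : ∀ t, ∀ x ∈ quadrant, fderivWithin ℝ (P.ρ t) quadrant x = P.S.rhoDeriv P.v t x :=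
    fun t x hx => (P.hasFDerivAt_ρ t x).hasFDerivWithinAt.fderivWithin (uniqueDiffOn_quadrant x hx)
  have hvel : ∀ t ∈ Ico 0 τ, ∀ x ∈ quadrant, η x = 1 →
      velocity α (P.v t) x = P.S.field P.v t x := by
    intro t ht x hx hηx
    rw [P.field_eq, hηx, P.q_eq_Q (hIcc t ht) (fun y _ => P.bound t y)
      (fun y hy h => hlive t ht y hy (Or.inl h)) hx, velocity, mul_one, Prod.mk.injEq]
    exact ⟨by ring, by ring⟩
  have hopen : ∀ x, η x ≠ 1 → {y | η y ≠ 1} ∈ 𝓝[quadrant] x := fun x hx =>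
    mem_nhdsWithin_of_mem_nhds
      ((isOpen_ne_fun P.cutoff.smooth.continuous continuous_const).mem_nhds hx)
  have hzv : ∀ t ∈ Ico 0 τ, ∀ x ∈ quadrant, η x ≠ 1 →
      fderivWithin ℝ (P.v t) quadrant x = 0 := fun t ht x hx hηx =>
    fderivWithin_quadrant_eq_zero hx (hopen x hηx) fun y hy hyq => by
      by_contra hne
      exact hy (hlive t ht y hyq (Or.inl hne))
  have hzr : ∀ t ∈ Ico 0 τ, ∀ x ∈ quadrant, η x ≠ 1 →
      fderivWithin ℝ (P.ρ t) quadrant x = 0 := fun t ht x hx hηx =>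
    fderivWithin_quadrant_eq_zero hx (hopen x hηx) fun y hy hyq => by
      by_contra hne
      exact hy (hlive t ht y hyq (Or.inr hne))
  refine ⟨continuousInX P.cutoff P.cont (P.S.continuous_stepDeriv P.cont) P.hasFDerivAt_v
    (fun t ht => P.datum_v (hIcc t ht)) (fun t ht x hx h => hlive t ht x hx (Or.inl h)),
    continuousInX P.cutoff (P.S.continuous_rho P.cont) (P.S.continuous_rhoDeriv P.cont)
    P.hasFDerivAt_ρ
    (fun t ht => P.datum_ρ (hIcc t ht)) (fun t ht x hx h => hlive t ht x hx (Or.inr h)),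
    fun x hx => ?_, fun x hx => ?_, fun t ht x hx => ?_, fun t ht x hx => ?_⟩
  · rw [P.fix, CutData.step, CutData.growth, hclamp0, P.S.path_self P.cont, P.w₀_eq, hω hx]
    simp
  · rw [ρ, CutData.rho, hclamp0, P.S.path_self P.cont, P.r₀_eq, hρ hx]
  · have h := (P.S.hasDerivWithinAt_step P.cont (hIccS t ht) x).mono_of_mem_nhdsWithin
      (hnhds t ht)
    have e : (fun s => P.S.step P.v s x) = fun s => P.v s x := funext fun s => (P.fix s x).symm
    rw [e] at h
    refine HasDerivWithinAt.congr_deriv h (Eq.symm ?_)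
    -- Where η ≠ 1 the solution vanishes on a neighbourhood in the quadrant, so all its derivatives
    -- drop out and the discrepancy between the two velocities is invisible. The same dichotomy
    -- handles the density.
    by_cases hηx : η x = 1
    · rw [hvel t ht x hx hηx, hfw t x hx, P.c_eq]
      simp only [hηx, one_mul, div_eq_mul_inv, ρ]
    · have h1 : P.ρ t x = 0 := by
        by_contra hne
        exact hηx (hlive t ht x hx (Or.inr hne))
      rw [hzv t ht x hx hηx, ← hfw t x hx, hzv t ht x hx hηx, h1]
      rw [ρ] at h1
      simp [h1]
  · have h := (P.S.hasDerivWithinAt_rho P.cont (hIccS t ht) x).mono_of_mem_nhdsWithin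
      (hnhds t ht)
    refine HasDerivWithinAt.congr_deriv h (Eq.symm ?_)
    by_cases hηx : η x = 1
    · rw [hvel t ht x hx hηx, hfr t x hx]
    · rw [hzr t ht x hx hηx, ← hfr t x hx, hzr t ht x hx hηx]
      simp

end CutSol

end BoussinesqModel

/-! ### From solutions of the original system to cut-off solutions. -/

namespace BoussinesqModel

theorem tendsto_of_tendstoUniformlyOn {E G : Type*} [TopologicalSpace E] [NormedAddCommGroup G]
    {F : ℝ → E → G} {l : Filter ℝ} {A : Set E} {t : ℝ} {x : E}
    (hF : TendstoUniformlyOn F (F t) l A) (hc : ContinuousWithinAt (F t) A x) :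
    Tendsto (fun p : ℝ × E => F p.1 p.2) (l ×ˢ 𝓝[A] x) (𝓝 (F t x)) := by
  rw [Metric.tendsto_nhds]
  intro ε hε
  have h1 := Metric.tendstoUniformlyOn_iff.1 hF (ε / 2) (half_pos hε)
  have h2 : ∀ᶠ y in 𝓝[A] x, y ∈ A ∧ dist (F t y) (F t x) < ε / 2 :=
    eventually_mem_nhdsWithin.and (Metric.tendsto_nhds.1 hc (ε / 2) (half_pos hε))
  filter_upwards [h1.prod_mk h2] with p hp
  obtain ⟨h3, h4, h5⟩ := hp
  calc dist (F p.1 p.2) (F t x) ≤ dist (F p.1 p.2) (F t p.2) + dist (F t p.2) (F t x) :=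
        dist_triangle _ _ _
    _ < ε := by have := h3 p.2 h4; rw [dist_comm] at this; linarith

theorem MemX.continuousOn {f : ℝ × ℝ → ℝ} (hf : MemX f) : ContinuousOn f quadrant := by
  obtain ⟨g, hg, h⟩ := hf.exists_datum
  exact hg.smooth.continuous.continuousOn.congr h

theorem MemX.hasFDerivWithinAt {f : ℝ × ℝ → ℝ} (hf : MemX f) {x : ℝ × ℝ} (hx : x ∈ quadrant) :
    HasFDerivWithinAt f (fderivWithin ℝ f quadrant x) quadrant x := by
  obtain ⟨g, hg, h⟩ := hf.exists_datum
  have : DifferentiableWithinAt ℝ f quadrant x :=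
    ((hg.smooth.differentiable one_ne_zero x).differentiableWithinAt).congr h (h hx)
  exact this.hasFDerivWithinAt

theorem MemX.continuousOn_fderivWithin {f : ℝ × ℝ → ℝ} (hf : MemX f) :
    ContinuousOn (fderivWithin ℝ f quadrant) quadrant := by
  obtain ⟨g, hg, h⟩ := hf.exists_datum
  refine (hg.smooth.continuous_fderiv one_ne_zero).continuousOn.congr fun x hx => ?_
  rw [fderivWithin_congr h (h hx)]
  exact (hg.smooth.differentiable one_ne_zero x).fderivWithin (uniqueDiffOn_quadrant x hx)

theorem ContinuousInX.continuousOn {f : ℝ → ℝ × ℝ → ℝ} {T : ℝ} (hf : ContinuousInX T f) :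
    ContinuousOn (fun p : ℝ × ℝ × ℝ => f p.1 p.2) (Ico 0 T ×ˢ quadrant) := by
  rintro ⟨t, x⟩ ⟨ht, hx⟩
  rw [ContinuousWithinAt, nhdsWithin_prod_eq]
  exact tendsto_of_tendstoUniformlyOn (hf.tendsto t ht) ((hf.mem t ht).continuousOn x hx)

theorem ContinuousInX.hasDerivWithinAt_along {f : ℝ → ℝ × ℝ → ℝ} {T : ℝ} (hf : ContinuousInX T f)
    {τ t : ℝ} (hτ : τ < T) (ht : t ∈ Icc 0 τ) {X : ℝ → ℝ × ℝ} {U : ℝ × ℝ}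
    (hX : HasDerivWithinAt X U (Icc 0 τ) t) (hXq : ∀ s ∈ Icc 0 τ, X s ∈ quadrant) {d : ℝ}
    (hd : HasDerivWithinAt (fun s => f s (X t)) d (Ici 0) t) :
    HasDerivWithinAt (fun s => f s (X s)) (d + fderivWithin ℝ (f t) quadrant (X t) U)
      (Icc 0 τ) t := by
  have hsub : Icc 0 τ ⊆ Ico 0 T := fun s hs => ⟨hs.1, hs.2.trans_lt hτ⟩
  have h1 := hasDerivWithinAt_along_sub convex_quadrant (v := f)
    (G := fun s => fderivWithin ℝ (f s) quadrant) hX hXq ht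
    (fun s hs y hy => (hf.mem s (hsub hs)).hasFDerivWithinAt hy)
    ((tendsto_of_tendstoUniformlyOn (hf.tendsto_fderiv t (hsub ht))
      ((hf.mem t (hsub ht)).continuousOn_fderivWithin _ (hXq t ht))).mono_left
      (Filter.prod_mono (nhdsWithin_mono t hsub) le_rfl))
  have h2 := (hd.mono Icc_subset_Ici_self).add h1
  refine h2.congr_of_mem (fun s _ => ?_) ht
  simp

theorem const_of_hasDerivWithinAt_zero {g : ℝ → ℝ} {τ : ℝ}
    (hg : ∀ s ∈ Icc 0 τ, HasDerivWithinAt g 0 (Icc 0 τ) s) {s : ℝ} (hs : s ∈ Icc 0 τ) :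
    g s = g 0 :=
  constant_of_has_deriv_right_zero (fun s hs => (hg s hs).continuousWithinAt)
    (fun s hs => (hg s ⟨hs.1, hs.2.le⟩).mono_of_mem_nhdsWithin (Icc_mem_nhdsGE_of_mem hs)) s hs

namespace CutSol

variable {α : ℝ} {η w₀ r₀ : ℝ × ℝ → ℝ} {T : ℝ} (P : CutSol α η w₀ r₀ T)

/-- Every solution for which the cutoff and the truncation are inactive coincides with the
solution of the cut-off problem. -/
theorem eq_of_isSolution {ω₀ ρ₀ : ℝ × ℝ → ℝ} (hω : EqOn ω₀ w₀ quadrant)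
    (hρ : EqOn ρ₀ r₀ quadrant) {T' : ℝ} {ω ρ : ℝ → ℝ × ℝ → ℝ}
    (sol : IsSolution α ω₀ ρ₀ T' ω ρ) {τ : ℝ} (hτ : τ ∈ Ico 0 T') (hτT : τ ≤ T)
    (hN : ∀ t ∈ Icc 0 τ, ∀ x ∈ quadrant, |ω t x| ≤ P.S.N)
    (hlive : ∀ t ∈ Icc 0 τ, ∀ x ∈ quadrant, ω t x ≠ 0 ∨ ρ t x ≠ 0 → η x = 1) :
    ∀ t ∈ Icc 0 τ, ∀ x ∈ quadrant, ω t x = P.v t x ∧ ρ t x = P.ρ t x := by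
  have hsub : Icc 0 τ ⊆ Ico 0 T' := fun s hs => ⟨hs.1, hs.2.trans_lt hτ.2⟩
  have hIcc : ∀ t ∈ Icc 0 τ, t ∈ Icc 0 T := fun t ht => ⟨ht.1, ht.2.trans hτT⟩
  have hIccS : ∀ t ∈ Icc 0 τ, t ∈ Icc 0 P.S.T := fun t ht => by rw [P.T_eq]; exact hIcc t ht
  -- A continuous extension of the solution to all times and the whole plane, as required of
  -- vorticities in the cut-off problem, obtained by projecting time to [0, τ] and space to the
  -- quadrant.
  let u : ℝ → ℝ × ℝ → ℝ := fun t x => ω (max 0 (min t τ)) (max x.1 0, max x.2 0)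
  have hu : CutData.Cont u := by
    refine (sol.continuous_ω.continuousOn).comp_continuous
      (f := fun p : ℝ × ℝ × ℝ => (max 0 (min p.1 τ), (max p.2.1 0, max p.2.2 0)))
      (by fun_prop) fun p => ⟨hsub ⟨le_max_left _ _, max_le hτ.1 (min_le_right _ _)⟩,
        le_max_right _ _, le_max_right _ _⟩
  have huω : ∀ t ∈ Icc 0 τ, ∀ x ∈ quadrant, u t x = ω t x := by
    intro t ht x hx
    simp only [u]
    rw [min_eq_left ht.2, max_eq_right ht.1, max_eq_left hx.1, max_eq_left hx.2]
  have hq : ∀ t ∈ Icc 0 τ, ∀ x ∈ quadrant, P.S.q u t x = Q α (ω t) x := by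
    intro t ht x hx
    rw [P.q_eq_Q (hIcc t ht) (fun y hy => by rw [huω t ht y hy]; exact hN t ht y hy)
      (fun y hy h => hlive t ht y hy (Or.inl (by rwa [huω t ht y hy] at h))) hx]
    exact Q_congr (fun y hy => huω t ht y hy) hx
  have hopen : ∀ x, η x ≠ 1 → {y | η y ≠ 1} ∈ 𝓝[quadrant] x := fun x hx =>
    mem_nhdsWithin_of_mem_nhds
      ((isOpen_ne_fun P.cutoff.smooth.continuous continuous_const).mem_nhds hx)
  -- the directional derivatives along the cut-off and the original velocity agree
  have hdir : ∀ t ∈ Icc 0 τ, ∀ x ∈ quadrant, ∀ f : ℝ × ℝ → ℝ,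
      (∀ y ∈ quadrant, f y ≠ 0 → η y = 1) →
      fderivWithin ℝ f quadrant x (P.S.field u t x) =
        fderivWithin ℝ f quadrant x (velocity α (ω t) x) := by
    intro t ht x hx f hf
    by_cases hηx : η x = 1
    · congr 1
      rw [P.field_eq, hηx, hq t ht x hx, velocity, mul_one, Prod.mk.injEq]
      exact ⟨by ring, by ring⟩
    · rw [fderivWithin_quadrant_eq_zero hx (hopen x hηx) fun y hy hyq => by
        by_contra hne
        exact hy (hf y hyq hne)]
      simp
  -- Integrating the equations along the cut-off paths of `u` shows that the given solution
  -- satisfies the representation formula, so it is a fixed point up to time τ and uniqueness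
  -- applies.
  have hrep : ∀ t ∈ Icc 0 τ, ∀ x ∈ quadrant, ω t x = P.S.step u t x ∧ ρ t x = P.S.rho u t x := by
    intro t ht x hx
    set X : ℝ → ℝ × ℝ := fun s => P.S.path u s t x with hXdef
    have hXq : ∀ s, X s ∈ quadrant := fun s => P.path_mem_quadrant hu s t hx
    have hXd : ∀ s, HasDerivAt X (P.S.field u s (X s)) s := fun s => P.S.hasDerivAt_path hu s t x
    have hXt : X t = x := P.S.path_self hu t x
    have h0 : (0 : ℝ) ∈ Icc 0 τ := ⟨le_rfl, hτ.1⟩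
    have hρd : ∀ s ∈ Icc 0 τ, HasDerivWithinAt (fun s => ρ s (X s)) 0 (Icc 0 τ) s := by
      intro s hs
      have h1 := sol.continuous_ρ.hasDerivWithinAt_along hτ.2 hs (hXd s).hasDerivWithinAt
        (fun r _ => hXq r) (sol.eq_ρ s (hsub hs) (X s) (hXq s))
      rwa [hdir s hs (X s) (hXq s) _ (fun y hy h => hlive s hs y hy (Or.inr h)),
        neg_add_cancel] at h1
    have hρc : ∀ s ∈ Icc 0 τ, ρ s (X s) = r₀ (X 0) := fun s hs => by
      rw [const_of_hasDerivWithinAt_zero hρd hs, sol.initial_ρ (hXq 0), hρ (hXq 0)]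
    have hc : Continuous fun r => P.S.c (X r) := P.S.c_smooth.continuous.comp
      (P.S.continuous_path_comp hu continuous_id continuous_const continuous_const)
    have hωd : ∀ s ∈ Icc 0 τ, HasDerivWithinAt
        (fun s => ω s (X s) - r₀ (X 0) * ∫ r in (0 : ℝ)..s, P.S.c (X r)) 0 (Icc 0 τ) s := by
      intro s hs
      have h1 := sol.continuous_ω.hasDerivWithinAt_along hτ.2 hs (hXd s).hasDerivWithinAt
        (fun r _ => hXq r) (sol.eq_ω s (hsub hs) (X s) (hXq s))
      rw [hdir s hs (X s) (hXq s) _ (fun y hy h => hlive s hs y hy (Or.inl h)),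
        sub_add_cancel] at h1
      have h2 : HasDerivAt (fun s => r₀ (X 0) * ∫ r in (0 : ℝ)..s, P.S.c (X r))
          (r₀ (X 0) * P.S.c (X s)) s :=
        (intervalIntegral.integral_hasDerivAt_right (hc.intervalIntegrable _ _)
          (hc.stronglyMeasurableAtFilter _ _) hc.continuousAt).const_mul _
      refine HasDerivWithinAt.congr_deriv (h1.sub h2.hasDerivWithinAt) ?_
      rw [← hρc s hs, P.c_eq, sub_eq_zero]
      by_cases hηx : η (X s) = 1
      · simp only [hηx, one_mul, div_eq_mul_inv]
      · have : ρ s (X s) = 0 := by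
          by_contra hne
          exact hηx (hlive s hs _ (hXq s) (Or.inr hne))
        simp [this]
    have hωt := const_of_hasDerivWithinAt_zero hωd ht
    have hρt := hρc t ht
    rw [hXt] at hωt hρt
    simp only [intervalIntegral.integral_same, mul_zero, sub_zero] at hωt
    rw [sol.initial_ω (hXq 0), hω (hXq 0), sub_eq_iff_eq_add] at hωt
    simp only [CutData.step, CutData.rho, CutData.growth, P.S.clamp_of_mem (hIccS t ht), P.w₀_eq,
      P.r₀_eq]
    exact ⟨hωt, hρt⟩
  have hvu : ∀ t ∈ Icc 0 τ, ∀ x ∈ quadrant, P.v t x = u t x :=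
    P.S.fixedPoint_unique P.cont hu (hIccS τ ⟨hτ.1, le_rfl⟩) (fun t _ x _ => P.fix t x)
      (fun t ht x hx => by rw [huω t ht x hx]; exact (hrep t ht x hx).1)
  obtain ⟨B, -, hB⟩ := P.S.exists_path_sub_le
  intro t ht x hx
  refine ⟨by rw [hvu t ht x hx, huω t ht x hx], ?_⟩
  -- Equal vorticities generate equal paths, by the path estimate with A = 0; hence the densities
  -- agree too.
  have hpath := hB u P.v hu P.cont 1 0 t one_pos le_rfl (hIccS t ht)
    (fun r hr y hy => by rw [hvu r ⟨hr.1, hr.2.trans ht.2⟩ y hy]; simp) 0 ⟨le_rfl, ht.1⟩ x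
  simp only [zero_mul, zero_div] at hpath
  have := sub_eq_zero.1 (norm_le_zero_iff.1 hpath)
  rw [(hrep t ht x hx).2, CutSol.ρ, CutData.rho, CutData.rho, P.S.clamp_of_mem (hIccS t ht), this]

end CutSol

end BoussinesqModel

/-! ### Supports, trajectories and monotonicity for solutions. -/

namespace BoussinesqModel

theorem exists_box {K : Set (ℝ × ℝ)} (hK : IsCompact K) (hpos : K ⊆ {x | 0 < x.1}) :
    ∃ a R : ℝ, 0 < a ∧ a < R ∧ ∀ x ∈ K, a ≤ x.1 ∧ x.1 ≤ R ∧ |x.2| ≤ R := by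
  rcases K.eq_empty_or_nonempty with rfl | hne
  · exact ⟨1, 2, one_pos, one_lt_two, fun x hx => hx.elim⟩
  · obtain ⟨z, hz, hmin⟩ := hK.exists_isMinOn hne continuous_fst.continuousOn
    obtain ⟨R, hR⟩ := hK.isBounded.subset_closedBall (0 : ℝ × ℝ)
    refine ⟨z.1, max R z.1 + 1, hpos hz, by linarith [le_max_right R z.1], fun x hx => ?_⟩
    have h1 : ‖x‖ ≤ R := mem_closedBall_zero_iff.1 (hR hx)
    have h2 := (le_abs_self x.1).trans (norm_fst_le x)
    have h3 : |x.2| ≤ ‖x‖ := norm_snd_le x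
    have h4 := le_max_left R z.1
    exact ⟨hmin hx, by linarith, by linarith⟩

variable {α : ℝ} {ω₀ ρ₀ : ℝ × ℝ → ℝ} {T : ℝ} {ω ρ : ℝ → ℝ × ℝ → ℝ}

/-- On compact time intervals the solution is supported in a box and bounded. -/
theorem IsSolution.exists_box (sol : IsSolution α ω₀ ρ₀ T ω ρ) {τ : ℝ} (hτ : τ ∈ Ico 0 T) :
    ∃ a R M : ℝ, 0 < a ∧ a < R ∧ ∀ t ∈ Icc 0 τ, ∀ x ∈ quadrant,
      |ω t x| ≤ M ∧ (ω t x ≠ 0 ∨ ρ t x ≠ 0 → a ≤ x.1 ∧ x.1 ≤ R ∧ |x.2| ≤ R) := by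
  obtain ⟨K₁, hK₁, hp₁, h₁⟩ := sol.continuous_ω.supp τ hτ
  obtain ⟨K₂, hK₂, hp₂, h₂⟩ := sol.continuous_ρ.supp τ hτ
  obtain ⟨a, R, ha, haR, hbox⟩ := BoussinesqModel.exists_box (hK₁.union hK₂) (union_subset hp₁ hp₂)
  have hsub : Icc 0 τ ⊆ Ico 0 T := fun s hs => ⟨hs.1, hs.2.trans_lt hτ.2⟩
  obtain ⟨M, hM⟩ := (isCompact_Icc.prod (hK₁.inter_right isClosed_quadrant) :
    IsCompact (Icc 0 τ ×ˢ (K₁ ∩ quadrant))).exists_bound_of_continuousOn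
    (sol.continuous_ω.continuousOn.mono (prod_mono hsub inter_subset_right))
  refine ⟨a, R, max M 0, ha, haR, fun t ht x hx => ⟨?_, fun h => hbox x ?_⟩⟩
  · by_cases hxK : x ∈ K₁
    · exact (hM (t, x) ⟨ht, hxK, hx⟩).trans (le_max_left _ _)
    · rw [h₁ t ht x hx hxK, abs_zero]; exact le_max_right _ _
  · rcases h with h | h
    · exact Or.inl (by by_contra hn; exact h (h₁ t ht x hx hn))
    · exact Or.inr (by by_contra hn; exact h (h₂ t ht x hx hn))

/-- On compact time intervals a solution is a solution of a cut-off problem, whose cutoff function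
may be taken equal to one on a given box. -/
theorem IsSolution.exists_cutSol (hα : 0 < α) {w₀ r₀ : ℝ × ℝ → ℝ} (hw : Datum w₀) (hr : Datum r₀)
    (hω : EqOn ω₀ w₀ quadrant) (hρ : EqOn ρ₀ r₀ quadrant) (sol : IsSolution α ω₀ ρ₀ T ω ρ)
    {τ a R M : ℝ} (hτ : τ ∈ Ico 0 T) (ha : 0 < a) (haR : a < R)
    (hbox : ∀ t ∈ Icc 0 τ, ∀ x ∈ quadrant,
      |ω t x| ≤ M ∧ (ω t x ≠ 0 ∨ ρ t x ≠ 0 → a ≤ x.1 ∧ x.1 ≤ R ∧ |x.2| ≤ R)) :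
    ∃ (η : ℝ × ℝ → ℝ) (P : CutSol α η w₀ r₀ τ),
      (∀ x : ℝ × ℝ, a ≤ x.1 → x.1 ≤ R → |x.2| ≤ R → η x = 1) ∧
      ∀ t ∈ Icc 0 τ, ∀ x ∈ quadrant, ω t x = P.v t x ∧ ρ t x = P.ρ t x := by
  obtain ⟨η, hη, h1⟩ := exists_cutoff ha haR
  obtain ⟨P, hP⟩ := BoussinesqModel.exists_cutSol hα hη hw hr hτ.1 M
  refine ⟨η, P, h1, P.eq_of_isSolution hω hρ sol hτ le_rfl
    (fun t ht x hx => (hbox t ht x hx).1.trans hP) fun t ht x hx h => ?_⟩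
  obtain ⟨h2, h3, h4⟩ := (hbox t ht x hx).2 h
  exact h1 x h2 h3 h4

/-- The trajectory of the flow of `ω` reaching `x` at time `t`, together with the evolution of
the solution along it. -/
structure IsTrajectory (α : ℝ) (ω₀ ρ₀ : ℝ × ℝ → ℝ) (ω ρ : ℝ → ℝ × ℝ → ℝ) (t : ℝ)
    (X : ℝ → ℝ × ℝ) : Prop where
  mem : ∀ s ∈ Icc 0 t, X s ∈ quadrant
  pos : ∀ s ∈ Icc 0 t, 0 < (X s).1
  deriv_fst : ∀ s ∈ Icc 0 t,
    HasDerivWithinAt (fun s => (X s).1) (-(Q α (ω s) (X s)) * (X s).1) (Icc 0 t) s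
  deriv_snd : ∀ s ∈ Icc 0 t,
    HasDerivWithinAt (fun s => (X s).2) (Q α (ω s) (X s) * (X s).2) (Icc 0 t) s
  deriv_ω : ∀ s ∈ Icc 0 t,
    HasDerivWithinAt (fun s => ω s (X s)) (ρ₀ (X 0) * ((X s).1)⁻¹) (Icc 0 t) s
  ρ_eq : ∀ s ∈ Icc 0 t, ρ s (X s) = ρ₀ (X 0)
  initial : ω 0 (X 0) = ω₀ (X 0)
  anti_fst : AntitoneOn (fun s => (X s).1) (Icc 0 t)
  mono_snd : MonotoneOn (fun s => (X s).2) (Icc 0 t)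

/-- Paths of a cut-off problem are used. They are true trajectories only where η = 1, so the box is
enlarged to contain the endpoint x, and the backward path must be shown not to leave it. -/
theorem IsSolution.exists_trajectory (hα : 0 < α) (hω₀ : MemX ω₀) (hρ₀ : MemX ρ₀)
    (hωn : ∀ x ∈ quadrant, 0 ≤ ω₀ x) (hρn : ∀ x ∈ quadrant, 0 ≤ ρ₀ x)
    (sol : IsSolution α ω₀ ρ₀ T ω ρ) {t : ℝ} (ht : t ∈ Ico 0 T) {x : ℝ × ℝ} (hx : x ∈ quadrant)
    (hx0 : 0 < x.1) : ∃ X, X t = x ∧ IsTrajectory α ω₀ ρ₀ ω ρ t X := by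
  obtain ⟨w₀, hw, hω⟩ := hω₀.exists_datum
  obtain ⟨r₀, hr, hρ⟩ := hρ₀.exists_datum
  have hwn : ∀ x ∈ quadrant, 0 ≤ w₀ x := fun x hx => by rw [← hω hx]; exact hωn x hx
  have hrn : ∀ x ∈ quadrant, 0 ≤ r₀ x := fun x hx => by rw [← hρ hx]; exact hρn x hx
  obtain ⟨a, R, M, ha, haR, hbox⟩ := sol.exists_box ht
  set R' : ℝ := max R (max x.1 x.2) with hR'
  have hRR' : R ≤ R' := le_max_left _ _
  have hxR' : x.1 ≤ R' := (le_max_left _ _).trans (le_max_right _ _)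
  have hx2R' : x.2 ≤ R' := (le_max_right _ _).trans (le_max_right _ _)
  obtain ⟨η, P, hη, hP⟩ := sol.exists_cutSol hα hw hr hω hρ ht (a := min a x.1) (R := R') (M := M)
    (lt_min ha hx0) ((min_le_left _ _).trans_lt (haR.trans_le hRR'))
    (fun t ht x hx => ⟨(hbox t ht x hx).1, fun h => by
      obtain ⟨h1, h2, h3⟩ := (hbox t ht x hx).2 h
      exact ⟨(min_le_left _ _).trans h1, h2.trans hRR', h3.trans hRR'⟩⟩)
  set X : ℝ → ℝ × ℝ := fun s => P.S.path P.v s t x with hX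
  have hXt : X t = x := P.S.path_self P.cont t x
  have hXq : ∀ s, X s ∈ quadrant := fun s => P.path_mem_quadrant P.cont s t hx
  have hXp : ∀ s, 0 < (X s).1 := fun s => P.path_fst_pos P.cont s t hx0
  have hrate : ∀ s, 0 ≤ P.rate P.v t x s := fun s =>
    mul_nonneg (P.q_nonneg hwn hrn _ _) (P.cutoff.nonneg _)
  have hd1 : ∀ s, HasDerivAt (fun s => (X s).1) (-P.rate P.v t x s * (X s).1) s := fun s =>
    P.hasDerivAt_path_fst P.cont s t x
  have hd2 : ∀ s, HasDerivAt (fun s => (X s).2) (P.rate P.v t x s * (X s).2) s := fun s =>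
    P.hasDerivAt_path_snd P.cont s t x
  have hanti : Antitone fun s => (X s).1 := by
    refine antitone_of_deriv_nonpos (fun s => (hd1 s).differentiableAt) fun s => ?_
    rw [(hd1 s).deriv]
    nlinarith [mul_nonneg (hrate s) (hXp s).le]
  have hmono : Monotone fun s => (X s).2 := by
    refine monotone_of_deriv_nonneg (fun s => (hd2 s).differentiableAt) fun s => ?_
    rw [(hd2 s).deriv]
    exact mul_nonneg (hrate s) (hXq s).2
  -- No vorticity lies to the right of `R'`, and the sector at a point contains only points to its
  -- right. So the rate is zero there and the first coordinate is stationary; a path ending at x₁ ≤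
  -- R' cannot have been beyond R' earlier.
  have hup : ∀ s ∈ Icc 0 t, (X s).1 ≤ R' := by
    intro s₀ hs₀
    by_contra hlt
    push Not at hlt
    obtain ⟨m, hm1, hm2⟩ := exists_between hlt
    have hc1 : ContinuousOn (fun s => (X s).1) (Icc s₀ t) := fun s _ =>
      (hd1 s).continuousAt.continuousWithinAt
    obtain ⟨s₁, hs₁, hs₁m⟩ := intermediate_value_Icc' hs₀.2 hc1
      (show m ∈ Icc (X t).1 (X s₀).1 from ⟨by rw [hXt]; exact hxR'.trans hm1.le, hm2.le⟩)
    have hz : ∀ s ∈ Icc s₀ s₁, P.rate P.v t x s = 0 := by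
      intro s hs
      have hsI : s ∈ Icc 0 t := ⟨hs₀.1.trans hs.1, hs.2.trans hs₁.2⟩
      have h1 : m ≤ (X s).1 := by rw [← hs₁m]; exact hanti hs.2
      have h2 : P.S.q P.v s (X s) = 0 := by
        refine setIntegral_eq_zero_of_forall_eq_zero fun y hy => ?_
        have hyq := mem_quadrant_of_sub_mem_sector (hXq s) hy
        have hy1 : (X s).1 ≤ y.1 := by have := hy.1; rw [Prod.fst_sub] at this; linarith
        have hclamp : P.S.clamp s = s := P.S.clamp_of_mem (by rw [P.T_eq]; exact hsI)
        have hv : P.v s y = 0 := by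
          rw [← (hP s hsI y hyq).1]
          by_contra hne
          have := ((hbox s hsI y hyq).2 (Or.inl hne)).2.1
          linarith
        simp [CutData.density, hclamp, hv, clip_of_abs_le, P.S.N_nonneg]
      rw [CutSol.rate]
      change P.S.q P.v s (X s) * _ = 0
      rw [h2, zero_mul]
    have hconst := constant_of_has_deriv_right_zero (f := fun s => (X s).1) (a := s₀) (b := s₁)
      (fun s _ => (hd1 s).continuousAt.continuousWithinAt)
      (fun s hs => by
        have h3 := (hd1 s).hasDerivWithinAt (s := Ici s)
        rwa [hz s ⟨hs.1, hs.2.le⟩, neg_zero, zero_mul] at h3) s₁ ⟨hs₁.1, le_rfl⟩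
    have hconst' : (X s₁).1 = (X s₀).1 := hconst
    have : (X s₁).1 = m := hs₁m
    linarith
  have hη1 : ∀ s ∈ Icc 0 t, η (X s) = 1 := by
    intro s hs
    refine hη _ ((min_le_right _ _).trans ?_) (hup s hs) ?_
    · have := hanti hs.2; simp only [hXt] at this; exact this
    · rw [abs_of_nonneg (hXq s).2]
      have := hmono hs.2; simp only [hXt] at this; exact this.trans hx2R'
  have hrQ : ∀ s ∈ Icc 0 t, P.rate P.v t x s = Q α (ω s) (X s) := by
    intro s hs
    have h1 : P.S.q P.v s (X s) = Q α (P.v s) (X s) :=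
      P.q_eq_Q hs (fun y _ => P.bound s y) (fun y hy h => by
        rw [← (hP s hs y hy).1] at h
        obtain ⟨h1, h2, h3⟩ := (hbox s hs y hy).2 (Or.inl h)
        exact hη y ((min_le_left _ _).trans h1) (h2.trans hRR') (h3.trans hRR')) (hXq s)
    have h2 : P.rate P.v t x s = P.S.q P.v s (X s) * η (X s) := rfl
    rw [h2, h1, hη1 s hs, mul_one]
    exact Q_congr (fun y hy => ((hP s hs y hy).1).symm) (hXq s)
  have h0t : (0 : ℝ) ∈ Icc 0 t := ⟨le_rfl, ht.1⟩
  refine ⟨X, hXt, fun s _ => hXq s, fun s _ => hXp s, fun s hs => ?_, fun s hs => ?_,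
    fun s hs => ?_, fun s hs => ?_, sol.initial_ω (hXq 0), hanti.antitoneOn _, hmono.monotoneOn _⟩
  · rw [← hrQ s hs]; exact (hd1 s).hasDerivWithinAt
  · rw [← hrQ s hs]; exact (hd2 s).hasDerivWithinAt
  · have h1 := P.S.hasDerivWithinAt_step_path P.cont (by rw [P.T_eq]; exact hs) t x
    rw [P.T_eq, P.r₀_eq, P.c_eq, ← P.v_eq_step] at h1
    have e : r₀ (X 0) * (η (X s) * ((X s).1)⁻¹) = ρ₀ (X 0) * ((X s).1)⁻¹ := by
      rw [hη1 s hs, one_mul, hρ (hXq 0)]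
    exact (HasDerivWithinAt.congr_deriv h1 e).congr_of_mem
      (fun r hr => (hP r hr (X r) (hXq r)).1) hs
  · rw [(hP s hs _ (hXq s)).2, hρ (hXq 0)]
    exact (P.S.rho_path P.cont (by rw [P.T_eq]; exact hs) t x).trans (by rw [P.r₀_eq])

theorem IsSolution.ω_nonneg (hα : 0 < α) (hω₀ : MemX ω₀) (hρ₀ : MemX ρ₀)
    (hωn : ∀ x ∈ quadrant, 0 ≤ ω₀ x) (hρn : ∀ x ∈ quadrant, 0 ≤ ρ₀ x)
    (sol : IsSolution α ω₀ ρ₀ T ω ρ) {t : ℝ} (ht : t ∈ Ico 0 T) {x : ℝ × ℝ} (hx : x ∈ quadrant) :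
    0 ≤ ω t x := by
  obtain ⟨w₀, hw, hω⟩ := hω₀.exists_datum
  obtain ⟨r₀, hr, hρ⟩ := hρ₀.exists_datum
  obtain ⟨a, R, M, ha, haR, hbox⟩ := sol.exists_box ht
  obtain ⟨η, P, -, hP⟩ := sol.exists_cutSol hα hw hr hω hρ ht ha haR hbox
  rw [(hP t ⟨ht.1, le_rfl⟩ x hx).1]
  exact P.v_nonneg (fun x hx => by rw [← hω hx]; exact hωn x hx)
    (fun x hx => by rw [← hρ hx]; exact hρn x hx) t hx

/-- The supremum of the vorticity does not decrease in time. -/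
theorem IsSolution.exists_le_later (hα : 0 < α) (hω₀ : MemX ω₀) (hρ₀ : MemX ρ₀)
    (hρn : ∀ x ∈ quadrant, 0 ≤ ρ₀ x)
    (sol : IsSolution α ω₀ ρ₀ T ω ρ) {s t : ℝ} (hs : 0 ≤ s) (hst : s ≤ t) (ht : t < T)
    {x : ℝ × ℝ} (hx : x ∈ quadrant) : ∃ y ∈ quadrant, ω s x ≤ ω t y := by
  obtain ⟨w₀, hw, hω⟩ := hω₀.exists_datum
  obtain ⟨r₀, hr, hρ⟩ := hρ₀.exists_datum
  have htI : t ∈ Ico 0 T := ⟨hs.trans hst, ht⟩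
  obtain ⟨a, R, M, ha, haR, hbox⟩ := sol.exists_box htI
  obtain ⟨η, P, -, hP⟩ := sol.exists_cutSol hα hw hr hω hρ htI ha haR hbox
  have hq := fun r => P.path_mem_quadrant P.cont r s hx
  refine ⟨P.S.path P.v t s x, hq t, ?_⟩
  rw [(hP s ⟨hs, hst⟩ x hx).1, (hP t ⟨htI.1, le_rfl⟩ _ (hq t)).1]
  have hsS : s ∈ Icc 0 P.S.T := by rw [P.T_eq]; exact ⟨hs, hst⟩
  have htS : t ∈ Icc 0 P.S.T := by rw [P.T_eq]; exact ⟨htI.1, le_rfl⟩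
  have h1 := P.S.step_path P.cont hsS s x
  have h2 := P.S.step_path P.cont htS s x
  rw [P.S.path_self P.cont] at h1
  rw [P.fix, P.fix, h1, h2, P.r₀_eq]
  have hc : Continuous fun r => P.S.c (P.S.path P.v r s x) := P.S.c_smooth.continuous.comp
    (P.S.continuous_path_comp P.cont continuous_id continuous_const continuous_const)
  have hr0 : 0 ≤ r₀ (P.S.path P.v 0 s x) := by rw [← hρ (hq 0)]; exact hρn _ (hq 0)
  have hadd := intervalIntegral.integral_add_adjacent_intervals (hc.intervalIntegrable 0 s)
    (hc.intervalIntegrable (μ := volume) s t)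
  have hnn : 0 ≤ ∫ r in s..t, P.S.c (P.S.path P.v r s x) :=
    intervalIntegral.integral_nonneg hst fun r _ => P.c_nonneg (hq r)
  have := mul_nonneg hr0 hnn
  rw [← hadd]
  linarith

end BoussinesqModel

/-! ### Uniqueness and short-time existence. -/

namespace BoussinesqModel

section Uniqueness

variable {α : ℝ} {ω₀ ρ₀ : ℝ × ℝ → ℝ}

/-- Solutions are determined by the initial data. -/
theorem IsSolution.eqOn (hα : 0 < α) (hω₀ : MemX ω₀) (hρ₀ : MemX ρ₀)
    {T₁ T₂ : ℝ} {ω₁ ρ₁ ω₂ ρ₂ : ℝ → ℝ × ℝ → ℝ} (sol₁ : IsSolution α ω₀ ρ₀ T₁ ω₁ ρ₁)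
    (sol₂ : IsSolution α ω₀ ρ₀ T₂ ω₂ ρ₂) {t : ℝ} (h₁ : t ∈ Ico 0 T₁) (h₂ : t < T₂) :
    EqOn (ω₁ t) (ω₂ t) quadrant ∧ EqOn (ρ₁ t) (ρ₂ t) quadrant := by
  obtain ⟨w₀, hw, hω⟩ := hω₀.exists_datum
  obtain ⟨r₀, hr, hρ⟩ := hρ₀.exists_datum
  have h₂' : t ∈ Ico 0 T₂ := ⟨h₁.1, h₂⟩
  obtain ⟨a₁, R₁, M₁, ha₁, haR₁, hb₁⟩ := sol₁.exists_box h₁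
  obtain ⟨a₂, R₂, M₂, ha₂, haR₂, hb₂⟩ := sol₂.exists_box h₂'
  obtain ⟨η, hη, h1⟩ := exists_cutoff (a := min a₁ a₂) (R := max R₁ R₂) (lt_min ha₁ ha₂)
    ((min_le_left _ _).trans_lt (haR₁.trans_le (le_max_left _ _)))
  obtain ⟨P, hP⟩ := BoussinesqModel.exists_cutSol hα hη hw hr h₁.1 (max M₁ M₂)
  have e₁ := P.eq_of_isSolution hω hρ sol₁ h₁ le_rfl
    (fun s hs x hx => (hb₁ s hs x hx).1.trans ((le_max_left _ _).trans hP))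
    fun s hs x hx h => by
      obtain ⟨i, j, k⟩ := (hb₁ s hs x hx).2 h
      exact h1 x ((min_le_left _ _).trans i) (j.trans (le_max_left _ _))
        (k.trans (le_max_left _ _))
  have e₂ := P.eq_of_isSolution hω hρ sol₂ h₂' le_rfl
    (fun s hs x hx => (hb₂ s hs x hx).1.trans ((le_max_right _ _).trans hP))
    fun s hs x hx h => by
      obtain ⟨i, j, k⟩ := (hb₂ s hs x hx).2 h
      exact h1 x ((min_le_right _ _).trans i) (j.trans (le_max_right _ _))
        (k.trans (le_max_right _ _))
  have ht : t ∈ Icc 0 t := ⟨h₁.1, le_rfl⟩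
  exact ⟨fun x hx => (e₁ t ht x hx).1.trans (e₂ t ht x hx).1.symm,
    fun x hx => (e₁ t ht x hx).2.trans (e₂ t ht x hx).2.symm⟩

end Uniqueness

namespace CutSol

variable {α : ℝ} {η w₀ r₀ : ℝ × ℝ → ℝ} {T : ℝ} (P : CutSol α η w₀ r₀ T)

/-- The particles carrying vorticity or density. -/
def labels (w₀ r₀ : ℝ × ℝ → ℝ) : Set (ℝ × ℝ) := {x | x ∈ quadrant ∧ (w₀ x ≠ 0 ∨ r₀ x ≠ 0)}

theorem path_mem_labels {t : ℝ} (ht : t ∈ Icc 0 T) {y : ℝ × ℝ} (hy : y ∈ quadrant)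
    (h : P.v t y ≠ 0 ∨ P.ρ t y ≠ 0) : P.S.path P.v 0 t y ∈ labels w₀ r₀ := by
  refine ⟨P.path_mem_quadrant P.cont _ _ hy, ?_⟩
  rw [← P.T_eq] at ht
  have e : P.ρ t y = r₀ (P.S.path P.v 0 t y) := by
    rw [ρ, CutData.rho, P.S.clamp_of_mem ht, P.r₀_eq]
  by_contra hn
  push Not at hn
  rw [e, hn.2] at h
  refine h.elim (fun h => h ?_) fun h => h rfl
  rw [P.fix, CutData.step, P.w₀_eq, P.S.clamp_of_mem ht, hn.1]
  have : P.S.rho P.v t y = 0 := e.trans hn.2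
  rw [this, zero_mul, add_zero]

theorem ne_zero_of_labels {t : ℝ} (ht : t ∈ Icc 0 T)
    {x : ℝ × ℝ} (hx : x ∈ labels w₀ r₀) :
    P.v t (P.S.path P.v t 0 x) ≠ 0 ∨ P.ρ t (P.S.path P.v t 0 x) ≠ 0 := by
  have ht' := ht
  rw [← P.T_eq] at ht'
  have e := P.S.rho_path P.cont ht' 0 x
  rw [P.S.path_self P.cont, P.r₀_eq] at e
  by_cases h : r₀ x = 0
  · refine Or.inl ?_
    have h1 := P.S.step_path P.cont ht' 0 x
    rw [P.S.path_self P.cont, P.r₀_eq, P.w₀_eq, h, zero_mul, add_zero] at h1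
    rw [P.fix, h1]
    exact hx.2.resolve_right (not_not.2 h)
  · exact Or.inr (by rw [ρ, e]; exact h)

/-- The solution of the cut-off problem solves the original problem a little longer than the
particles are known to remain where the cutoff is inactive. -/
theorem exists_isSolution_of_path_mem {ω₀ ρ₀ : ℝ × ℝ → ℝ} (hω : EqOn ω₀ w₀ quadrant)
    (hρ : EqOn ρ₀ r₀ quadrant) {τ : ℝ} (hτT : τ < T) {U : Set (ℝ × ℝ)}
    (hU : IsOpen U) (hηU : ∀ x ∈ U, η x = 1)
    (hpath : ∀ t ∈ Icc 0 τ, ∀ x ∈ closure (labels w₀ r₀), P.S.path P.v t 0 x ∈ U) :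
    ∃ τ' > τ, IsSolution α ω₀ ρ₀ τ' P.v P.ρ := by
  have hK : IsCompact (closure (labels w₀ r₀)) := by
    refine (P.datum_w.supp.isCompact.union P.datum_r.supp.isCompact).of_isClosed_subset
      isClosed_closure (closure_minimal ?_ ((isClosed_tsupport _).union (isClosed_tsupport _)))
    rintro x ⟨-, h | h⟩
    · exact Or.inl (subset_tsupport _ h)
    · exact Or.inr (subset_tsupport _ h)
  have hlive : ∀ t ∈ Icc 0 T, (∀ x ∈ closure (labels w₀ r₀), P.S.path P.v t 0 x ∈ U) →
      ∀ y ∈ quadrant, P.v t y ≠ 0 ∨ P.ρ t y ≠ 0 → η y = 1 := by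
    intro t ht h y hy hne
    have := h _ (subset_closure (P.path_mem_labels ht hy hne))
    rw [P.S.path_path P.cont, P.S.path_self P.cont] at this
    exact hηU y this
  by_cases hτ0 : τ < 0
  · exact ⟨0, hτ0, P.isSolution hω hρ (by have := P.S.T_nonneg; rwa [P.T_eq] at this)
      fun t ht => (lt_irrefl _ (ht.1.trans_lt ht.2)).elim⟩
  have hc : Continuous fun p : ℝ × ℝ × ℝ => P.S.path P.v p.1 0 p.2 :=
    P.S.continuous_path_comp P.cont continuous_fst continuous_const continuous_snd
  -- The closed set of labels is compact and `U` is open, so the particles remain in `U` for a short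
  -- time after τ.
  have hev : ∀ᶠ t in 𝓝 τ, ∀ x ∈ closure (labels w₀ r₀), P.S.path P.v t 0 x ∈ U :=
    hK.eventually_forall_of_forall_eventually fun x hx =>
      (hc.tendsto (τ, x)).eventually (hU.mem_nhds (hpath τ ⟨not_lt.1 hτ0, le_rfl⟩ x hx))
  obtain ⟨ε, hε, hball⟩ := Metric.eventually_nhds_iff.1 hev
  refine ⟨min T (τ + ε), lt_min hτT (by linarith), P.isSolution hω hρ (min_le_left _ _)
    fun t ht => hlive t ⟨ht.1, (ht.2.trans_le (min_le_left _ _)).le⟩ ?_⟩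
  by_cases htτ : t ≤ τ
  · exact hpath t ⟨ht.1, htτ⟩
  · refine hball ?_
    have := ht.2.trans_le (min_le_right _ _)
    rw [Real.dist_eq, abs_lt]
    constructor <;> linarith

end CutSol

theorem isOpen_box (a R : ℝ) : IsOpen {x : ℝ × ℝ | a < x.1 ∧ x.1 < R ∧ |x.2| < R} :=
  (isOpen_lt continuous_const continuous_fst).inter
    ((isOpen_lt continuous_fst continuous_const).inter
      (isOpen_lt continuous_snd.abs continuous_const))

section Local

variable {α : ℝ} {ω₀ ρ₀ : ℝ × ℝ → ℝ}

/-- At time 0 the particles sit inside an open box on which the cutoff equals one. Taking τ = 0 in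
the previous continuation result gives a positive time of existence. -/
theorem exists_isSolution (hα : 0 < α) (hω₀ : MemX ω₀) (hρ₀ : MemX ρ₀) :
    ∃ T > 0, ∃ ω ρ, IsSolution α ω₀ ρ₀ T ω ρ := by
  obtain ⟨w₀, hw, hω⟩ := hω₀.exists_datum
  obtain ⟨r₀, hr, hρ⟩ := hρ₀.exists_datum
  obtain ⟨a, R, ha, haR, hbox⟩ := BoussinesqModel.exists_box
    (hw.supp.isCompact.union hr.supp.isCompact) (union_subset hw.pos hr.pos)
  obtain ⟨η, hη, h1⟩ := exists_cutoff (a := a / 2) (R := R + 1) (by linarith) (by linarith)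
  obtain ⟨P, -⟩ := exists_cutSol hα hη hw hr zero_le_one 0
  obtain ⟨τ, hτ, h⟩ := P.exists_isSolution_of_path_mem hω hρ zero_lt_one
    (isOpen_box (a / 2) (R + 1))
    (fun x hx => h1 x hx.1.le hx.2.1.le hx.2.2.le) (by
      intro t ht x hx
      obtain rfl : t = 0 := le_antisymm ht.2 ht.1
      rw [P.S.path_self P.cont]
      have hx' : x ∈ tsupport w₀ ∪ tsupport r₀ := by
        refine closure_minimal ?_ ((isClosed_tsupport _).union (isClosed_tsupport _)) hx
        rintro x ⟨-, h | h⟩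
        · exact Or.inl (subset_tsupport _ h)
        · exact Or.inr (subset_tsupport _ h)
      obtain ⟨h2, h3, h4⟩ := hbox x hx'
      exact ⟨by linarith, by linarith, by linarith⟩)
  exact ⟨τ, hτ, _, _, h⟩

end Local

/-! ### Upper bounds for the kernel and for Q. -/

section Kernel

/-- In s the kernel has the primitive -(y/2) / (y² + s²), whose total variation over s ≥ 0 is 1 /
(2y). After this integration Q behaves like a one-dimensional integral against ds / (2s). -/
theorem integral_kernel_le {y a b : ℝ} (hy : 0 < y) (hab : a ≤ b) :
    ∫ s in Icc a b, kernel (y, s) ≤ 1 / (2 * y) := by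
  have hpos : ∀ s : ℝ, 0 < y ^ 2 + s ^ 2 := fun s => by positivity
  have hd : ∀ s ∈ uIcc a b,
      HasDerivAt (fun s => -(y / 2) * (y ^ 2 + s ^ 2)⁻¹) (kernel (y, s)) s := by
    intro s _
    have h1 : HasDerivAt (fun s : ℝ => y ^ 2 + s ^ 2) (2 * s) s := by
      simpa using (hasDerivAt_pow 2 s).const_add (y ^ 2)
    refine ((h1.inv (hpos s).ne').const_mul (-(y / 2))).congr_deriv ?_
    simp only [kernel]
    field_simp
  have hc : Continuous fun s => kernel (y, s) := by
    simp only [kernel]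
    exact Continuous.div (by fun_prop) (by fun_prop) fun s => pow_ne_zero 2 (hpos s).ne'
  rw [integral_Icc_eq_integral_Ioc, ← intervalIntegral.integral_of_le hab,
    intervalIntegral.integral_eq_sub_of_hasDerivAt hd (hc.intervalIntegrable _ _)]
  have h2 : (y ^ 2 + a ^ 2)⁻¹ ≤ (y ^ 2)⁻¹ :=
    inv_anti₀ (by positivity) (by nlinarith [sq_nonneg a])
  have h3 : 0 < (y ^ 2 + b ^ 2)⁻¹ := inv_pos.2 (hpos b)
  have h4 : y / 2 * (y ^ 2)⁻¹ = 1 / (2 * y) := by field_simp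
  nlinarith [mul_le_mul_of_nonneg_left h2 (by positivity : 0 ≤ y / 2),
    mul_pos (by positivity : 0 < y / 2) h3]

theorem continuousOn_kernel : ContinuousOn kernel {y : ℝ × ℝ | 0 < y.1} := by
  intro y hy
  have hy' : 0 < y.1 := hy
  have : (y.1 ^ 2 + y.2 ^ 2) ^ 2 ≠ 0 := by positivity
  have h : ContinuousAt (fun y : ℝ × ℝ => y.1 * y.2 / (y.1 ^ 2 + y.2 ^ 2) ^ 2) y :=
    ContinuousAt.div (by fun_prop) (by fun_prop) this
  exact h.continuousWithinAt

theorem isCompact_sector_inter (α R : ℝ) (x : ℝ × ℝ) :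
    IsCompact ({y : ℝ × ℝ | y - x ∈ sector α} ∩ {y | y.1 ≤ R}) := by
  refine (isCompact_Icc.prod isCompact_Icc :
    IsCompact (Icc x.1 R ×ˢ Icc x.2 (x.2 + |α| * |R - x.1|))).of_isClosed_subset
    ((isClosed_translate_sector α x).inter (isClosed_le continuous_fst continuous_const)) ?_
  rintro y ⟨⟨h1, h2, h3⟩, h4⟩
  simp only [Prod.fst_sub, Prod.snd_sub, mem_ofPred_eq] at h1 h2 h3 h4
  refine ⟨⟨by linarith, h4⟩, by linarith, ?_⟩
  have h5 : α * (y.1 - x.1) ≤ |α| * |R - x.1| := by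
    refine mul_le_mul (le_abs_self α) ?_ h1 (abs_nonneg α)
    exact le_trans (by linarith) (le_abs_self _)
  linarith

/-- Integrability of the integrand defining `Q`. -/
theorem integrableOn_kernel_mul {α R : ℝ} {f : ℝ × ℝ → ℝ} (hf : ContinuousOn f quadrant)
    (hR : ∀ y ∈ quadrant, R < y.1 → f y = 0) {x : ℝ × ℝ} (hx : x ∈ quadrant) (hx1 : 0 < x.1) :
    IntegrableOn (fun y => kernel y * f y) {y : ℝ × ℝ | y - x ∈ sector α} := by
  have hsub : {y : ℝ × ℝ | y - x ∈ sector α} ∩ {y | y.1 ≤ R} ⊆ {y : ℝ × ℝ | 0 < y.1} := by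
    rintro y ⟨⟨h1, -⟩, -⟩
    simp only [Prod.fst_sub, mem_ofPred_eq] at h1 ⊢
    linarith
  have h1 : IntegrableOn (fun y => kernel y * f y)
      ({y : ℝ × ℝ | y - x ∈ sector α} ∩ {y | y.1 ≤ R}) :=
    ContinuousOn.integrableOn_compact (isCompact_sector_inter α R x)
      ((continuousOn_kernel.mono hsub).mul
        (hf.mono fun y hy => mem_quadrant_of_sub_mem_sector hx hy.1))
  refine h1.of_forall_sdiff_eq_zero (measurableSet_translate_sector α x) fun y hy => ?_
  have h2 : R < y.1 := not_le.1 fun h => hy.2 ⟨hy.1, h⟩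
  rw [hR y (mem_quadrant_of_sub_mem_sector hx hy.1) h2, mul_zero]

/-- Upper bound for `Q` in terms of a majorant depending on the first variable. -/
theorem Q_le_integral {α R : ℝ} (hα : 0 ≤ α) {f : ℝ × ℝ → ℝ} {h : ℝ → ℝ} {x : ℝ × ℝ}
    (hx : x ∈ quadrant) (hx1 : 0 < x.1) (hxR : x.1 ≤ R) (hh : ContinuousOn h (Icc x.1 R))
    (hh0 : ∀ s ∈ Icc x.1 R, 0 ≤ h s)
    (hf0 : ∀ y ∈ quadrant, 0 ≤ f y)
    (hfh : ∀ y : ℝ × ℝ, y - x ∈ sector α → y.1 ≤ R → f y ≤ h y.1)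
    (hR : ∀ y ∈ quadrant, R < y.1 → f y = 0) :
    Q α f x ≤ ∫ s in Icc x.1 R, h s / (2 * s) := by
  set B := x.2 + α * (R - x.1) with hB
  have hBx : x.2 ≤ B := by rw [hB]; nlinarith
  set S : Set (ℝ × ℝ) := Icc x.1 R ×ˢ Icc x.2 B with hS
  have hSm : MeasurableSet S := measurableSet_Icc.prod measurableSet_Icc
  have hSpos : S ⊆ {y : ℝ × ℝ | 0 < y.1} := fun y hy => hx1.trans_le hy.1.1
  have hSq : S ⊆ quadrant := fun y hy => ⟨(hSpos hy).le, hx.2.trans hy.2.1⟩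
  have hint : IntegrableOn (fun y : ℝ × ℝ => kernel y * h y.1) S :=
    ContinuousOn.integrableOn_compact (isCompact_Icc.prod isCompact_Icc)
      ((continuousOn_kernel.mono hSpos).mul (hh.comp continuousOn_fst fun y hy => hy.1))
  have h1 : Q α f x ≤ ∫ y in S, kernel y * h y.1 := by
    change ∫ y in {y : ℝ × ℝ | y - x ∈ sector α}, kernel y * f y ≤ _
    rw [← integral_indicator (measurableSet_translate_sector α x), ← integral_indicator hSm]
    refine integral_mono_of_nonneg
      (Eventually.of_forall fun y => indicator_nonneg (fun y hy => ?_) y)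
      ((integrable_indicator_iff hSm).2 hint) (Eventually.of_forall fun y => ?_)
    · have hyq := mem_quadrant_of_sub_mem_sector hx hy
      exact mul_nonneg (kernel_nonneg hyq) (hf0 y hyq)
    · have hnn : 0 ≤ S.indicator (fun y => kernel y * h y.1) y :=
        indicator_nonneg (fun y hy => mul_nonneg (kernel_nonneg (hSq hy)) (hh0 _ hy.1)) y
      by_cases hy : y ∈ {y : ℝ × ℝ | y - x ∈ sector α}
      · have hyq := mem_quadrant_of_sub_mem_sector hx hy
        rw [indicator_of_mem hy]
        by_cases hyR : y.1 ≤ R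
        · have hyS : y ∈ S := by
            obtain ⟨h1, h2, h3⟩ := hy
            simp only [Prod.fst_sub, Prod.snd_sub] at h1 h2 h3
            refine ⟨⟨by linarith, hyR⟩, by linarith, ?_⟩
            rw [hB]
            nlinarith
          rw [indicator_of_mem hyS]
          exact mul_le_mul_of_nonneg_left (hfh y hy hyR) (kernel_nonneg hyq)
        · rw [hR y hyq (not_le.1 hyR), mul_zero]
          exact hnn
      · rw [indicator_of_notMem hy]
        exact hnn
  refine h1.trans ?_
  rw [hS, Measure.volume_eq_prod, setIntegral_prod _ (by rw [← Measure.volume_eq_prod]; exact hint)]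
  have hint2 : IntegrableOn (fun s => h s / (2 * s)) (Icc x.1 R) := by
    refine ContinuousOn.integrableOn_compact isCompact_Icc (hh.div (by fun_prop) fun s hs => ?_)
    have := hx1.trans_le hs.1
    positivity
  have hint1 := (show Integrable (fun y : ℝ × ℝ => kernel y * h y.1)
      ((volume.restrict (Icc x.1 R)).prod (volume.restrict (Icc x.2 B))) by
    rw [Measure.prod_restrict, ← Measure.volume_eq_prod]; exact hint).integral_prod_left
  refine setIntegral_mono_on hint1 hint2 measurableSet_Icc fun s hs => ?_
  have hs0 := hx1.trans_le hs.1
  simp only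
  rw [integral_mul_const]
  calc _ ≤ 1 / (2 * s) * h s := mul_le_mul_of_nonneg_right (integral_kernel_le hs0 hBx) (hh0 s hs)
    _ = _ := by ring

end Kernel

end BoussinesqModel

/-! ### Identities along trajectories. -/

namespace BoussinesqModel

theorem le_of_hasDerivAt_nonneg {f f' : ℝ → ℝ} {a b : ℝ} (hab : a ≤ b)
    (hc : ContinuousOn f (Icc a b)) (hd : ∀ s ∈ Ioo a b, HasDerivAt f (f' s) s)
    (h0 : ∀ s ∈ Ioo a b, 0 ≤ f' s) : f a ≤ f b := by
  refine monotoneOn_of_deriv_nonneg (convex_Icc a b) hc (fun s hs => ?_) (fun s hs => ?_)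
    ⟨le_rfl, hab⟩ ⟨hab, le_rfl⟩ hab <;> rw [interior_Icc] at hs
  · exact (hd s hs).differentiableAt.differentiableWithinAt
  · rw [(hd s hs).deriv]; exact h0 s hs

section Trajectory

variable {α : ℝ} {ω₀ ρ₀ : ℝ × ℝ → ℝ} {ω ρ : ℝ → ℝ × ℝ → ℝ} {t : ℝ} {X : ℝ → ℝ × ℝ}

namespace IsTrajectory

theorem continuousOn_fst (h : IsTrajectory α ω₀ ρ₀ ω ρ t X) :
    ContinuousOn (fun s => (X s).1) (Icc 0 t) := fun s hs => (h.deriv_fst s hs).continuousWithinAt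

theorem continuousOn_snd (h : IsTrajectory α ω₀ ρ₀ ω ρ t X) :
    ContinuousOn (fun s => (X s).2) (Icc 0 t) := fun s hs => (h.deriv_snd s hs).continuousWithinAt

theorem continuousOn_ω (h : IsTrajectory α ω₀ ρ₀ ω ρ t X) :
    ContinuousOn (fun s => ω s (X s)) (Icc 0 t) := fun s hs => (h.deriv_ω s hs).continuousWithinAt

theorem hasDerivAt_fst (h : IsTrajectory α ω₀ ρ₀ ω ρ t X) {s : ℝ} (hs : s ∈ Ioo 0 t) :
    HasDerivAt (fun s => (X s).1) (-(Q α (ω s) (X s)) * (X s).1) s :=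
  (h.deriv_fst s (Ioo_subset_Icc_self hs)).hasDerivAt (Icc_mem_nhds hs.1 hs.2)

theorem hasDerivAt_ω (h : IsTrajectory α ω₀ ρ₀ ω ρ t X) {s : ℝ} (hs : s ∈ Ioo 0 t) :
    HasDerivAt (fun s => ω s (X s)) (ρ₀ (X 0) * ((X s).1)⁻¹) s :=
  (h.deriv_ω s (Ioo_subset_Icc_self hs)).hasDerivAt (Icc_mem_nhds hs.1 hs.2)

/-- The product of the coordinates is conserved. -/
theorem fst_mul_snd (h : IsTrajectory α ω₀ ρ₀ ω ρ t X) {s : ℝ} (hs : s ∈ Icc 0 t) :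
    (X s).1 * (X s).2 = (X 0).1 * (X 0).2 :=
  const_of_hasDerivWithinAt_zero (g := fun s => (X s).1 * (X s).2) (fun r hr =>
    ((h.deriv_fst r hr).mul (h.deriv_snd r hr)).congr_deriv (by ring)) hs

theorem label_ne_zero (h : IsTrajectory α ω₀ ρ₀ ω ρ t X) (ht : 0 ≤ t)
    (hne : ω t (X t) ≠ 0 ∨ ρ t (X t) ≠ 0) : ω₀ (X 0) ≠ 0 ∨ ρ₀ (X 0) ≠ 0 := by
  have htt : t ∈ Icc 0 t := ⟨ht, le_rfl⟩
  by_contra hn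
  push Not at hn
  rw [h.ρ_eq t htt, hn.2] at hne
  refine hne.elim (fun hω => hω ?_) fun h => h rfl
  have := const_of_hasDerivWithinAt_zero (g := fun s => ω s (X s)) (fun r hr => by
    have := h.deriv_ω r hr
    rwa [hn.2, zero_mul] at this) htt
  rw [this, h.initial, hn.1]

end IsTrajectory

end Trajectory

/-! ### Bounded solutions extend. -/

section Continuation

variable {α : ℝ} {ω₀ ρ₀ : ℝ × ℝ → ℝ} {T : ℝ} {ω ρ : ℝ → ℝ × ℝ → ℝ}

theorem IsSolution.exists_label (hα : 0 < α) (hω₀ : MemX ω₀) (hρ₀ : MemX ρ₀)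
    (hωn : ∀ x ∈ quadrant, 0 ≤ ω₀ x) (hρn : ∀ x ∈ quadrant, 0 ≤ ρ₀ x)
    (sol : IsSolution α ω₀ ρ₀ T ω ρ) {t : ℝ} (ht : t ∈ Ico 0 T) {x : ℝ × ℝ} (hx : x ∈ quadrant)
    (hne : ω t x ≠ 0 ∨ ρ t x ≠ 0) :
    ∃ X, X t = x ∧ IsTrajectory α ω₀ ρ₀ ω ρ t X ∧ (ω₀ (X 0) ≠ 0 ∨ ρ₀ (X 0) ≠ 0) := by
  obtain ⟨a, R, M, ha, -, hbox⟩ := sol.exists_box ht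
  have hx0 : 0 < x.1 := ha.trans_le ((hbox t ⟨ht.1, le_rfl⟩ x hx).2 hne).1
  obtain ⟨X, rfl, hX⟩ := sol.exists_trajectory hα hω₀ hρ₀ hωn hρn ht hx hx0
  exact ⟨X, rfl, hX, hX.label_ne_zero ht.1 hne⟩

/-- The vorticity vanishes to the right of the initial supports. -/
theorem IsSolution.ω_eq_zero (hα : 0 < α) (hω₀ : MemX ω₀) (hρ₀ : MemX ρ₀)
    (hωn : ∀ x ∈ quadrant, 0 ≤ ω₀ x) (hρn : ∀ x ∈ quadrant, 0 ≤ ρ₀ x)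
    (sol : IsSolution α ω₀ ρ₀ T ω ρ) {R : ℝ}
    (hR : ∀ x ∈ quadrant, ω₀ x ≠ 0 ∨ ρ₀ x ≠ 0 → x.1 ≤ R)
    {t : ℝ} (ht : t ∈ Ico 0 T) {x : ℝ × ℝ} (hx : x ∈ quadrant) (hxR : R < x.1) : ω t x = 0 := by
  by_contra hne
  obtain ⟨X, rfl, hX, hl⟩ := sol.exists_label hα hω₀ hρ₀ hωn hρn ht hx (Or.inl hne)
  have h0 : (0 : ℝ) ∈ Icc 0 t := ⟨le_rfl, ht.1⟩
  have h1 := hR _ (hX.mem 0 h0) hl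
  have h2 : (X t).1 ≤ (X 0).1 := hX.anti_fst h0 ⟨ht.1, le_rfl⟩ ht.1
  linarith

/-- Bounded solutions have supports in a fixed box. -/
theorem IsSolution.exists_uniform_box (hα : 0 < α) (hω₀ : MemX ω₀) (hρ₀ : MemX ρ₀)
    (hωn : ∀ x ∈ quadrant, 0 ≤ ω₀ x) (hρn : ∀ x ∈ quadrant, 0 ≤ ρ₀ x)
    (sol : IsSolution α ω₀ ρ₀ T ω ρ) (hT : 0 < T) {C : ℝ}
    (hC : ∀ t ∈ Ico 0 T, ∀ x ∈ quadrant, |ω t x| ≤ C) :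
    ∃ a R : ℝ, 0 < a ∧ a < R ∧ ∀ t ∈ Ico 0 T, ∀ x ∈ quadrant, ω t x ≠ 0 ∨ ρ t x ≠ 0 →
      a ≤ x.1 ∧ x.1 ≤ R ∧ |x.2| ≤ R := by
  have h0T : (0 : ℝ) ∈ Ico 0 T := ⟨le_rfl, hT⟩
  have hC0 : 0 ≤ C := (abs_nonneg _).trans (hC 0 h0T 0 ⟨le_rfl, le_rfl⟩)
  obtain ⟨a, R, M, ha, haR, hbox⟩ := sol.exists_box h0T
  have hbox0 : ∀ x ∈ quadrant, ω₀ x ≠ 0 ∨ ρ₀ x ≠ 0 → a ≤ x.1 ∧ x.1 ≤ R ∧ |x.2| ≤ R := by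
    intro x hx h
    rw [← sol.initial_ω hx, ← sol.initial_ρ hx] at h
    exact (hbox 0 ⟨le_rfl, le_rfl⟩ x hx).2 h
  have hR0 : 0 < R := ha.trans haR
  set Λ := Real.log R - Real.log a with hΛ
  have hΛ0 : 0 ≤ Λ := sub_nonneg.2 (Real.log_le_log ha haR.le)
  -- With L = log(R / x₁), boundedness of ω by C gives L' = Q ≤ (C/2) L along paths. So L grows at
  -- most exponentially from its initial value, which is at most Λ; `ε` is the resulting lower bound
  -- for x₁.
  set ε := R * Real.exp (-(Λ * Real.exp (C / 2 * T))) with hε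
  have hε0 : 0 < ε := by positivity
  have hεR : ε ≤ R := by
    have : Real.exp (-(Λ * Real.exp (C / 2 * T))) ≤ 1 := Real.exp_le_one_iff.2 (by
      rw [neg_nonpos]; positivity)
    rw [hε]; nlinarith
  have hq : 0 ≤ R * R / ε := by positivity
  refine ⟨ε, R + R * R / ε + 1, hε0, by linarith, fun t ht x hx hne => ?_⟩
  obtain ⟨X, rfl, hX, hl⟩ := sol.exists_label hα hω₀ hρ₀ hωn hρn ht hx hne
  have h0 : (0 : ℝ) ∈ Icc 0 t := ⟨le_rfl, ht.1⟩
  have htt : t ∈ Icc 0 t := ⟨ht.1, le_rfl⟩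
  obtain ⟨l1, l2, l3⟩ := hbox0 _ (hX.mem 0 h0) hl
  have hXR : ∀ s ∈ Icc 0 t, (X s).1 ≤ R := fun s hs =>
    (show (X s).1 ≤ (X 0).1 from hX.anti_fst h0 hs hs.1).trans l2
  have hQ : ∀ s ∈ Icc 0 t, Q α (ω s) (X s) ≤ C / 2 * (Real.log R - Real.log (X s).1) := by
    intro s hs
    have hsT : s ∈ Ico 0 T := ⟨hs.1, hs.2.trans_lt ht.2⟩
    have hp := hX.pos s hs
    refine (Q_le_integral (h := fun _ => C) hα.le (hX.mem s hs) hp (hXR s hs) continuousOn_const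
      (fun _ _ => hC0) (fun y hy => sol.ω_nonneg hα hω₀ hρ₀ hωn hρn hsT hy)
      (fun y hy _ => (le_abs_self _).trans
        (hC s hsT y (mem_quadrant_of_sub_mem_sector (hX.mem s hs) hy)))
      (fun y hy hyR => sol.ω_eq_zero hα hω₀ hρ₀ hωn hρn
        (fun x hx h => (hbox0 x hx h).2.1) hsT hy hyR)).trans (le_of_eq ?_)
    rw [integral_Icc_eq_integral_Ioc, ← intervalIntegral.integral_of_le (hXR s hs)]
    have e : (fun r : ℝ => C / (2 * r)) = fun r => C / 2 * r⁻¹ := by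
      funext r; rw [mul_comm 2 r, ← div_div, div_right_comm, div_eq_mul_inv]
    rw [e, intervalIntegral.integral_const_mul, integral_inv_of_pos hp hR0,
      Real.log_div hR0.ne' hp.ne']
  have hlog : Real.log R - Real.log (X t).1 ≤ Λ * Real.exp (C / 2 * t) := by
    have hm := le_of_hasDerivAt_nonneg
      (f := fun s => (Real.log (X s).1 - Real.log R) * Real.exp (-(C / 2 * s)))
      (f' := fun s => (C / 2 * (Real.log R - Real.log (X s).1) - Q α (ω s) (X s)) *
        Real.exp (-(C / 2 * s))) ht.1
      (((hX.continuousOn_fst.log fun s hs => (hX.pos s hs).ne').sub continuousOn_const).mul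
        (by fun_prop)) (fun s hs => ?_) fun s hs => ?_
    · simp only [mul_zero, neg_zero, Real.exp_zero, mul_one] at hm
      have h1 : Real.log a ≤ Real.log (X 0).1 := Real.log_le_log ha l1
      have h2 : -Λ ≤ (Real.log (X t).1 - Real.log R) * Real.exp (-(C / 2 * t)) := by linarith
      have h3 := mul_le_mul_of_nonneg_right h2 (Real.exp_pos (C / 2 * t)).le
      rw [mul_assoc, ← Real.exp_add, neg_add_cancel, Real.exp_zero] at h3
      linarith
    · have hp := hX.pos s (Ioo_subset_Icc_self hs)
      have h1 := ((hX.hasDerivAt_fst hs).log hp.ne').sub_const (Real.log R)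
      have h2 : HasDerivAt (fun s : ℝ => Real.exp (-(C / 2 * s)))
          (Real.exp (-(C / 2 * s)) * -(C / 2 * 1)) s :=
        (((hasDerivAt_id s).const_mul (C / 2)).neg).exp
      refine (h1.mul h2).congr_deriv ?_
      field_simp
      ring
    · exact mul_nonneg (sub_nonneg.2 (hQ s (Ioo_subset_Icc_self hs))) (Real.exp_pos _).le
  have hXt := hX.pos t htt
  have hlow : ε ≤ (X t).1 := by
    have h1 : Λ * Real.exp (C / 2 * t) ≤ Λ * Real.exp (C / 2 * T) :=
      mul_le_mul_of_nonneg_left (Real.exp_le_exp.2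
        (mul_le_mul_of_nonneg_left ht.2.le (by linarith))) hΛ0
    have h2 : Real.log ε ≤ Real.log (X t).1 := by
      rw [hε, Real.log_mul hR0.ne' (Real.exp_pos _).ne', Real.log_exp]
      linarith
    exact (Real.log_le_log_iff hε0 hXt).1 h2
  refine ⟨hlow, by linarith [hXR t htt], ?_⟩
  have hsnd := (hX.mem t htt).2
  rw [abs_of_nonneg hsnd]
  -- Conservation of x₁x₂ converts the lower bound on x₁ into an upper bound on x₂.
  have hprod := hX.fst_mul_snd htt
  have h1 : (X 0).1 * (X 0).2 ≤ R * R :=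
    mul_le_mul l2 ((le_abs_self _).trans l3) (hX.mem 0 h0).2 hR0.le
  have h2 : ε * (X t).2 ≤ R * R := by
    calc _ ≤ (X t).1 * (X t).2 := mul_le_mul_of_nonneg_right hlow hsnd
      _ ≤ _ := by rw [hprod]; exact h1
  have h3 : (X t).2 ≤ R * R / ε := by rw [le_div_iff₀ hε0]; linarith
  linarith

/-- Bounded solutions can be continued. -/
theorem IsSolution.exists_extension (hα : 0 < α) (hω₀ : MemX ω₀) (hρ₀ : MemX ρ₀)
    (hωn : ∀ x ∈ quadrant, 0 ≤ ω₀ x) (hρn : ∀ x ∈ quadrant, 0 ≤ ρ₀ x)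
    (sol : IsSolution α ω₀ ρ₀ T ω ρ) (hT : 0 < T) {C : ℝ}
    (hC : ∀ t ∈ Ico 0 T, ∀ x ∈ quadrant, |ω t x| ≤ C) :
    ∃ T' > T, ∃ ω' ρ', IsSolution α ω₀ ρ₀ T' ω' ρ' := by
  obtain ⟨a, R, ha, haR, hbox⟩ := sol.exists_uniform_box hα hω₀ hρ₀ hωn hρn hT hC
  obtain ⟨w₀, hw, hω⟩ := hω₀.exists_datum
  obtain ⟨r₀, hr, hρ⟩ := hρ₀.exists_datum
  obtain ⟨η, hη, h1⟩ := exists_cutoff (a := a / 2) (R := R + 1) (by linarith) (by linarith)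
  obtain ⟨P, hP⟩ := BoussinesqModel.exists_cutSol hα hη hw hr (by linarith : 0 ≤ T + 1) C
  have heq : ∀ t ∈ Ico 0 T, ∀ x ∈ quadrant, ω t x = P.v t x ∧ ρ t x = P.ρ t x := by
    intro t ht x hx
    have hsub : ∀ s ∈ Icc 0 t, s ∈ Ico 0 T := fun s hs => ⟨hs.1, hs.2.trans_lt ht.2⟩
    refine P.eq_of_isSolution hω hρ sol ht (by linarith [ht.2])
      (fun s hs x hx => (hC s (hsub s hs) x hx).trans hP) (fun s hs x hx h => ?_) t
      ⟨ht.1, le_rfl⟩ x hx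
    obtain ⟨h2, h3, h4⟩ := hbox s (hsub s hs) x hx h
    exact h1 x (by linarith) (by linarith) (by linarith)
  obtain ⟨τ, hτ, h⟩ := P.exists_isSolution_of_path_mem (τ := T) hω hρ (by linarith)
    (isOpen_box (a / 2) (R + 1)) (fun x hx => h1 x hx.1.le hx.2.1.le hx.2.2.le) (by
      intro t ht x hx
      have hcl : IsClosed {p : ℝ × ℝ × ℝ | a ≤ (P.S.path P.v p.1 0 p.2).1 ∧
          (P.S.path P.v p.1 0 p.2).1 ≤ R ∧ |(P.S.path P.v p.1 0 p.2).2| ≤ R} := by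
        have hc : Continuous fun p : ℝ × ℝ × ℝ => P.S.path P.v p.1 0 p.2 :=
          P.S.continuous_path_comp P.cont continuous_fst continuous_const continuous_snd
        exact (isClosed_le continuous_const hc.fst).inter
          ((isClosed_le hc.fst continuous_const).inter (isClosed_le hc.snd.abs continuous_const))
      -- The cut-off problem lives until T + 1, so its paths are defined at time T. The closed box
      -- condition, known for times before T and actual labels, passes to the closure and thus to t
      -- = T.
      have hsub : closure (Ico 0 T ×ˢ CutSol.labels w₀ r₀) ⊆ _ :=
        closure_minimal (fun p hp => ?_) hcl
      · rw [closure_prod_eq, closure_Ico hT.ne] at hsub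
        obtain ⟨h2, h3, h4⟩ := hsub (show (t, x) ∈ _ from ⟨ht, hx⟩)
        exact ⟨by simp only at h2; linarith, by simp only at h3; linarith,
          by simp only at h4; linarith⟩
      · have hq := P.path_mem_quadrant P.cont p.1 0 hp.2.1
        have hne := P.ne_zero_of_labels (t := p.1) ⟨hp.1.1, by linarith [hp.1.2]⟩ hp.2
        rw [← (heq p.1 hp.1 _ hq).1, ← (heq p.1 hp.1 _ hq).2] at hne
        exact hbox p.1 hp.1 _ hq hne)
  exact ⟨τ, hτ, _, _, h⟩

end Continuation

/-! ### The maximal solution and blow-up of its supremum. -/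

section Maximal

variable {α : ℝ} {ω₀ ρ₀ : ℝ × ℝ → ℝ} {T : ℝ} {ω ρ : ℝ → ℝ × ℝ → ℝ}

/-- Each clause at a time t concerns only times near t, or an interval [0, T₁] covered by a single
piece, so it is inherited from a solution living slightly longer. -/
theorem ContinuousInX.glue {f : ℝ → ℝ × ℝ → ℝ}
    (h : ∀ t ∈ Ico 0 T, ∃ T' > t, T' ≤ T ∧ ∃ f', ContinuousInX T' f' ∧
      ∀ s ∈ Ico 0 T', EqOn (f s) (f' s) quadrant) : ContinuousInX T f := by
  have hcongr : ∀ {f f' : ℝ × ℝ → ℝ}, EqOn f f' quadrant → MemX f' → MemX f := by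
    rintro f f' h ⟨g, h1, h2, h3, h4⟩
    exact ⟨g, h1, h2, h3, h.trans h4⟩
  have hfd : ∀ {f f' : ℝ × ℝ → ℝ}, EqOn f f' quadrant →
      EqOn (fderivWithin ℝ f quadrant) (fderivWithin ℝ f' quadrant) quadrant := fun h x hx =>
    fderivWithin_congr h (h hx)
  have hnhds : ∀ {t T' : ℝ}, 0 ≤ t → t < T' → T' ≤ T → 𝓝[Ico 0 T] t = 𝓝[Ico 0 T'] t := by
    intro t T' h0 h1 h2
    refine le_antisymm ?_ (nhdsWithin_mono _ (Ico_subset_Ico_right h2))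
    refine nhdsWithin_le_iff.2 ?_
    filter_upwards [self_mem_nhdsWithin, mem_nhdsWithin_of_mem_nhds (Iio_mem_nhds h1)] with s hs hs'
    exact ⟨hs.1, hs'⟩
  refine ⟨fun t ht => ?_, fun t ht => ?_, fun t ht => ?_, fun T₁ hT₁ => ?_⟩
  · obtain ⟨T', h1, h2, f', hf', he⟩ := h t ht
    exact hcongr (he t ⟨ht.1, h1⟩) (hf'.mem t ⟨ht.1, h1⟩)
  · obtain ⟨T', h1, h2, f', hf', he⟩ := h t ht
    rw [hnhds ht.1 h1 h2]
    refine ((hf'.tendsto t ⟨ht.1, h1⟩).congr_right (he t ⟨ht.1, h1⟩).symm).congr ?_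
    filter_upwards [self_mem_nhdsWithin] with s hs using (he s hs).symm
  · obtain ⟨T', h1, h2, f', hf', he⟩ := h t ht
    rw [hnhds ht.1 h1 h2]
    refine ((hf'.tendsto_fderiv t ⟨ht.1, h1⟩).congr_right (hfd (he t ⟨ht.1, h1⟩)).symm).congr ?_
    filter_upwards [self_mem_nhdsWithin] with s hs using hfd (he s hs).symm
  · obtain ⟨T', h1, h2, f', hf', he⟩ := h T₁ hT₁
    obtain ⟨K, hK, hp, hz⟩ := hf'.supp T₁ ⟨hT₁.1, h1⟩
    exact ⟨K, hK, hp, fun t ht x hx hxK => by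
      rw [he t ⟨ht.1, ht.2.trans_lt h1⟩ hx]; exact hz t ht x hx hxK⟩

theorem IsSolution.glue (hT : 0 < T)
    (h : ∀ t ∈ Ico 0 T, ∃ T' > t, T' ≤ T ∧ ∃ ω' ρ', IsSolution α ω₀ ρ₀ T' ω' ρ' ∧
      ∀ s ∈ Ico 0 T', EqOn (ω s) (ω' s) quadrant ∧ EqOn (ρ s) (ρ' s) quadrant) :
    IsSolution α ω₀ ρ₀ T ω ρ := by
  have hfd : ∀ {f f' : ℝ × ℝ → ℝ}, EqOn f f' quadrant → ∀ x ∈ quadrant,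
      fderivWithin ℝ f quadrant x = fderivWithin ℝ f' quadrant x := fun h x hx =>
    fderivWithin_congr h (h hx)
  have hnear : ∀ {t T' : ℝ}, 0 ≤ t → t < T' → Ico 0 T' ∈ 𝓝[Ici 0] t := by
    intro t T' h0 h1
    filter_upwards [self_mem_nhdsWithin, mem_nhdsWithin_of_mem_nhds (Iio_mem_nhds h1)] with s hs hs'
    exact ⟨hs, hs'⟩
  have h0 : (0 : ℝ) ∈ Ico 0 T := ⟨le_rfl, hT⟩
  refine ⟨ContinuousInX.glue fun t ht => ?_, ContinuousInX.glue fun t ht => ?_, ?_, ?_,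
    fun t ht x hx => ?_, fun t ht x hx => ?_⟩
  · obtain ⟨T', h1, h2, ω', ρ', hs, he⟩ := h t ht
    exact ⟨T', h1, h2, ω', hs.continuous_ω, fun s hs => (he s hs).1⟩
  · obtain ⟨T', h1, h2, ω', ρ', hs, he⟩ := h t ht
    exact ⟨T', h1, h2, ρ', hs.continuous_ρ, fun s hs => (he s hs).2⟩
  · obtain ⟨T', h1, h2, ω', ρ', hs, he⟩ := h 0 h0
    exact (he 0 ⟨le_rfl, h1⟩).1.trans hs.initial_ω
  · obtain ⟨T', h1, h2, ω', ρ', hs, he⟩ := h 0 h0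
    exact (he 0 ⟨le_rfl, h1⟩).2.trans hs.initial_ρ
  · obtain ⟨T', h1, h2, ω', ρ', hs, he⟩ := h t ht
    have ht' : t ∈ Ico 0 T' := ⟨ht.1, h1⟩
    have hev : (fun s => ω s x) =ᶠ[𝓝[Ici 0] t] fun s => ω' s x := by
      filter_upwards [hnear ht.1 h1] with s hs using (he s hs).1 hx
    have h3 := (hs.eq_ω t ht' x hx).congr_of_eventuallyEq hev ((he t ht').1 hx)
    rwa [← (he t ht').2 hx, ← hfd (he t ht').1 x hx, ← velocity_congr (he t ht').1 hx] at h3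
  · obtain ⟨T', h1, h2, ω', ρ', hs, he⟩ := h t ht
    have ht' : t ∈ Ico 0 T' := ⟨ht.1, h1⟩
    have hev : (fun s => ρ s x) =ᶠ[𝓝[Ici 0] t] fun s => ρ' s x := by
      filter_upwards [hnear ht.1 h1] with s hs using (he s hs).2 hx
    have h3 := (hs.eq_ρ t ht' x hx).congr_of_eventuallyEq hev ((he t ht').2 hx)
    rwa [← hfd (he t ht').2 x hx, ← velocity_congr (he t ht').1 hx] at h3

/-- If the lifespans of all solutions are bounded, then there is a maximal one. -/
theorem exists_isMaximalSolution (hα : 0 < α) (hω₀ : MemX ω₀) (hρ₀ : MemX ρ₀) {B : ℝ}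
    (hB : ∀ T ω ρ, IsSolution α ω₀ ρ₀ T ω ρ → T ≤ B) :
    ∃ T ω ρ, 0 < T ∧ IsMaximalSolution α ω₀ ρ₀ T ω ρ := by
  set A : Set ℝ := {T | ∃ ω ρ, IsSolution α ω₀ ρ₀ T ω ρ} with hA
  have hbdd : BddAbove A := ⟨B, fun T ⟨ω, ρ, h⟩ => hB T ω ρ h⟩
  obtain ⟨T₀, hT₀, ω', ρ', h₀⟩ := exists_isSolution hα hω₀ hρ₀
  have hmem : T₀ ∈ A := ⟨ω', ρ', h₀⟩
  have hpos : 0 < sSup A := hT₀.trans_le (le_csSup hbdd hmem)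
  have hex : ∀ t, t < sSup A → ∃ T' ω' ρ', t < T' ∧ IsSolution α ω₀ ρ₀ T' ω' ρ' := fun t ht => by
    obtain ⟨T', ⟨ω', ρ', h⟩, hlt⟩ := exists_lt_of_lt_csSup ⟨T₀, hmem⟩ ht
    exact ⟨T', ω', ρ', hlt, h⟩
  -- For every t a solution living beyond t is fixed. By uniqueness the diagonal t ↦ W t t coincides
  -- with each of them on its lifespan.
  choose! L W D hL hW using hex
  have huniq : ∀ {T' ω' ρ'}, IsSolution α ω₀ ρ₀ T' ω' ρ' → ∀ t ∈ Ico 0 T',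
      EqOn (ω' t) (W t t) quadrant ∧ EqOn (ρ' t) (D t t) quadrant := by
    intro T' ω' ρ' h t ht
    have hlt : t < sSup A := ht.2.trans_le (le_csSup hbdd ⟨ω', ρ', h⟩)
    exact h.eqOn hα hω₀ hρ₀ (hW t hlt) ht (hL t hlt)
  refine ⟨sSup A, fun t => W t t, fun t => D t t, hpos, IsSolution.glue hpos fun t ht => ?_,
    fun T' ω' ρ' h => ⟨le_csSup hbdd ⟨ω', ρ', h⟩, huniq h⟩⟩
  refine ⟨L t, hL t ht.2, le_csSup hbdd ⟨_, _, hW t ht.2⟩, W t, D t, hW t ht.2, fun s hs => ?_⟩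
  exact ⟨(huniq (hW t ht.2) s hs).1.symm, (huniq (hW t ht.2) s hs).2.symm⟩

/-- By continuity the strict inequality persists on a relative neighbourhood. The quadrant is the
closure of its interior, so even at boundary points that neighbourhood has positive measure. -/
theorem le_eLpNorm_top_of_lt {f : ℝ × ℝ → ℝ} (hf : ContinuousOn f quadrant) {y : ℝ × ℝ}
    (hy : y ∈ quadrant) {C : ℝ} (hC : C < f y) :
    ENNReal.ofReal C ≤ eLpNorm f ⊤ (volume.restrict quadrant) := by
  rw [eLpNorm_exponent_top]
  by_contra hlt
  push Not at hlt
  have hae := ae_lt_of_essSup_lt hlt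
  rw [ae_restrict_iff' measurableSet_quadrant] at hae
  have hopen : {x | C < f x} ∈ 𝓝[quadrant] y := (hf y hy).eventually (lt_mem_nhds hC)
  obtain ⟨U, hU, hyU, hsub⟩ := mem_nhdsWithin.1 hopen
  have hcl : y ∈ closure (interior quadrant) := by
    rw [quadrant_eq_prod, interior_prod_eq, interior_Ici, closure_prod_eq, closure_Ioi]
    exact hy
  obtain ⟨z, hzU, hz⟩ := mem_closure_iff.1 hcl U hU hyU
  have hV : IsOpen (U ∩ interior quadrant) := hU.inter isOpen_interior
  have hpos := hV.measure_pos volume ⟨z, hzU, hz⟩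
  refine hpos.ne' (measure_mono_null ?_ hae)
  rintro w ⟨hwU, hwi⟩ hw
  have hwq := interior_subset hwi
  have h1 := hw hwq
  have h2 : C < f w := hsub ⟨hwU, hwq⟩
  have h3 : ENNReal.ofReal C ≤ ‖f w‖ₑ := by
    rw [Real.enorm_eq_ofReal_abs]
    exact ENNReal.ofReal_le_ofReal (h2.le.trans (le_abs_self _))
  exact not_lt.2 h3 h1

/-- The vorticity of a maximal solution of finite lifespan blows up. -/
theorem IsMaximalSolution.tendsto_eLpNorm (hα : 0 < α) (hω₀ : MemX ω₀) (hρ₀ : MemX ρ₀)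
    (hωn : ∀ x ∈ quadrant, 0 ≤ ω₀ x) (hρn : ∀ x ∈ quadrant, 0 ≤ ρ₀ x) (hT : 0 < T)
    (sol : IsMaximalSolution α ω₀ ρ₀ T ω ρ) :
    Tendsto (fun t => eLpNorm (ω t) ⊤ (volume.restrict quadrant)) (𝓝[<] T) (𝓝 ⊤) := by
  have hs := sol.isSolution
  rw [ENNReal.tendsto_nhds_top_iff_nnreal]
  intro C
  -- Otherwise the solution would be bounded and could be continued. One large value is enough,
  -- because it is carried to all later times along the path. The margin 2 absorbs the strict
  -- inequalities.
  have hex : ∃ s ∈ Ico 0 T, ∃ x ∈ quadrant, (C : ℝ) + 2 < ω s x := by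
    by_contra hn
    push Not at hn
    obtain ⟨T', hT', ω', ρ', h'⟩ := hs.exists_extension hα hω₀ hρ₀ hωn hρn hT (C := C + 2)
      fun t ht x hx => by
        rw [abs_of_nonneg (hs.ω_nonneg hα hω₀ hρ₀ hωn hρn ht hx)]; exact hn t ht x hx
    exact absurd (sol.maximal T' ω' ρ' h').1 (not_le.2 hT')
  obtain ⟨s, hsT, x, hx, hlt⟩ := hex
  filter_upwards [Ioo_mem_nhdsLT hsT.2] with t ht
  obtain ⟨y, hy, hle⟩ := hs.exists_le_later hα hω₀ hρ₀ hρn hsT.1 ht.1.le ht.2 hx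
  refine lt_of_lt_of_le ?_ (le_eLpNorm_top_of_lt
    (hs.continuous_ω.mem t ⟨hsT.1.trans ht.1.le, ht.2⟩).continuousOn hy (C := C + 1) (by linarith))
  rw [← ENNReal.ofReal_coe_nnreal]
  exact (ENNReal.ofReal_lt_ofReal_iff (by positivity)).2 (by linarith)

end Maximal

end BoussinesqModel

/-! ### Bounds for Q behind the front, and the barrier region. -/

namespace BoussinesqModel

/-- The constant in the lower bound of `Q`. -/
noncomputable def rateConst (α : ℝ) : ℝ := α ^ 2 / (20 * (25 / 4 + 9 * α ^ 2) ^ 2)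

theorem rateConst_pos {α : ℝ} (hα : 0 < α) : 0 < rateConst α := by
  unfold rateConst; positivity

/-- Only a rectangle inside the sector is kept. Its area is α x₁² / 4, and on it the kernel is at
least α / (D² x₁²), because x₂ ≤ 2α x₁ keeps y₂ ≤ 3α x₁. The powers of x₁ cancel, leaving a constant
times `m`. -/
theorem mul_le_Q {α R m : ℝ} (hα : 0 < α) {f : ℝ × ℝ → ℝ} (hf : ContinuousOn f quadrant)
    (hf0 : ∀ y ∈ quadrant, 0 ≤ f y) (hR : ∀ y ∈ quadrant, R < y.1 → f y = 0) (hm : 0 ≤ m)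
    {x : ℝ × ℝ} (hx : x ∈ quadrant) (hx1 : 0 < x.1) (hx2 : x.2 ≤ 2 * α * x.1)
    (hfm : ∀ y : ℝ × ℝ, y - x ∈ sector α → y.1 ≤ 5 / 2 * x.1 → m ≤ f y) :
    5 * rateConst α * m ≤ Q α f x := by
  set S : Set (ℝ × ℝ) :=
    Icc (2 * x.1) (5 / 2 * x.1) ×ˢ Icc (x.2 + α * x.1 / 2) (x.2 + α * x.1) with hS
  have hax : 0 < α * x.1 := mul_pos hα hx1
  have hSm : MeasurableSet S := measurableSet_Icc.prod measurableSet_Icc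
  have hsub : S ⊆ {y : ℝ × ℝ | y - x ∈ sector α} := by
    rintro y ⟨⟨h1, h2⟩, h3, h4⟩
    refine ⟨?_, ?_, ?_⟩ <;> simp only [Prod.fst_sub, Prod.snd_sub] <;> nlinarith
  have hint := integrableOn_kernel_mul (α := α) hf hR hx hx1
  set D := 25 / 4 + 9 * α ^ 2 with hD
  have hD0 : 0 < D := by positivity
  have hk : ∀ y ∈ S, α / (D ^ 2 * x.1 ^ 2) ≤ kernel y := by
    rintro y ⟨⟨h1, h2⟩, h3, h4⟩
    have hx2' := hx.2
    have hy1 : 0 < y.1 := by linarith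
    have hy2 : α * x.1 / 2 ≤ y.2 := by linarith
    have hy20 : 0 ≤ y.2 := by linarith
    have hy2' : y.2 ≤ 3 * (α * x.1) := by linarith
    have hn : y.1 ^ 2 + y.2 ^ 2 ≤ D * x.1 ^ 2 := by
      have a1 : y.1 ^ 2 ≤ (5 / 2 * x.1) ^ 2 := pow_le_pow_left₀ hy1.le h2 2
      have a2 : y.2 ^ 2 ≤ (3 * (α * x.1)) ^ 2 := pow_le_pow_left₀ (by linarith) hy2' 2
      rw [hD]; nlinarith
    have hp : α * x.1 ^ 2 ≤ y.1 * y.2 := by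
      have := mul_le_mul h1 hy2 (by linarith) hy1.le
      nlinarith
    have hn0 : 0 < y.1 ^ 2 + y.2 ^ 2 := by positivity
    calc α / (D ^ 2 * x.1 ^ 2) = α * x.1 ^ 2 / (D * x.1 ^ 2) ^ 2 := by
          field_simp
      _ ≤ y.1 * y.2 / (y.1 ^ 2 + y.2 ^ 2) ^ 2 := by gcongr
  have hvol : (volume : Measure (ℝ × ℝ)).real S = α * x.1 ^ 2 / 4 := by
    rw [hS, Measure.volume_eq_prod, measureReal_prod_prod, Real.volume_real_Icc_of_le (by linarith),
      Real.volume_real_Icc_of_le (by linarith)]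
    ring
  have hfin : volume S ≠ ⊤ := (isCompact_Icc.prod isCompact_Icc).measure_lt_top.ne
  calc 5 * rateConst α * m = ∫ _ in S, α / (D ^ 2 * x.1 ^ 2) * m := by
        rw [setIntegral_const, hvol, rateConst, ← hD, smul_eq_mul]
        field_simp
        ring
    _ ≤ ∫ y in S, kernel y * f y := by
        refine setIntegral_mono_on (integrableOn_const hfin) (hint.mono_set hsub) hSm fun y hy => ?_
        exact mul_le_mul (hk y hy) (hfm y (hsub hy) hy.1.2) hm
          (kernel_nonneg (mem_quadrant_of_sub_mem_sector hx (hsub hy)))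
    _ ≤ Q α f x := by
        refine setIntegral_mono_set hint ?_ (Eventually.of_forall hsub)
        filter_upwards [ae_restrict_mem (measurableSet_translate_sector α x)] with y hy
        have hyq := mem_quadrant_of_sub_mem_sector hx hy
        exact mul_nonneg (kernel_nonneg hyq) (hf0 y hyq)

/-- The region behind the front at `β`. -/
def region (α δ β : ℝ) : Set (ℝ × ℝ) :=
  {x | 0 ≤ x.2 ∧ ((β < x.1 ∧ x.2 < 2 * α * (x.1 - β)) ∨ (δ < x.1 ∧ x.2 < 2 * α * x.1))}

section Region

variable {α δ β : ℝ}

theorem fst_pos_of_mem_region (hδ : 0 < δ) (hβ : 0 < β) {x : ℝ × ℝ} (hx : x ∈ region α δ β) :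
    0 < x.1 := by
  rcases hx.2 with h | h
  · exact hβ.trans h.1
  · exact hδ.trans h.1

theorem mem_quadrant_of_mem_region (hδ : 0 < δ) (hβ : 0 < β) {x : ℝ × ℝ}
    (hx : x ∈ region α δ β) : x ∈ quadrant :=
  ⟨(fst_pos_of_mem_region hδ hβ hx).le, hx.1⟩

theorem snd_le_of_mem_region (hα : 0 < α) (hβ : 0 < β) {x : ℝ × ℝ} (hx : x ∈ region α δ β) :
    x.2 ≤ 2 * α * x.1 := by
  rcases hx.2 with h | h
  · nlinarith [h.2, mul_pos hα hβ]
  · exact h.2.le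

/-- Both pieces are bounded above by lines of slope 2α, steeper than the sector, and unbounded to
the right. Hence Q at a point of the region is computed from values of the vorticity inside the
region alone. -/
theorem mem_region_of_sub_mem_sector (hα : 0 < α) {x y : ℝ × ℝ} (hx : x ∈ region α δ β)
    (hy : y - x ∈ sector α) : y ∈ region α δ β := by
  obtain ⟨h1, h2, h3⟩ := hy
  simp only [Prod.fst_sub, Prod.snd_sub] at h1 h2 h3
  have h4 := mul_nonneg hα.le h1
  refine ⟨by linarith [hx.1], ?_⟩
  rcases hx.2 with h | h
  · exact Or.inl ⟨by linarith [h.1], by nlinarith [h.2]⟩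
  · exact Or.inr ⟨by linarith [h.1], by nlinarith [h.2]⟩

end Region

/-- Bounds on the vorticity behind the front, up to a factor two. -/
structure WeakBounds (α δ β p₀ p₁ Φ : ℝ) (f : ℝ × ℝ → ℝ) : Prop where
  lower : ∀ x ∈ region α δ β, x.1 ≤ 5 / 2 → 1 / 2 * x.1 ^ (-p₀) ≤ f x
  upper : ∀ x ∈ region α δ β, x.1 < 1 → f x ≤ 2 * Φ * x.1 ^ (-p₁)
  upper' : ∀ x ∈ region α δ β, 1 ≤ x.1 → f x ≤ 2 * Φ

/-- Bounds on the vorticity behind the front. -/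
structure StrongBounds (α δ β p₀ p₁ Φ : ℝ) (f : ℝ × ℝ → ℝ) : Prop where
  lower : ∀ x ∈ region α δ β, x.1 < 11 / 4 → x.1 ^ (-p₀) < f x
  upper : ∀ x ∈ region α δ β, x.1 < 1 → f x < Φ * x.1 ^ (-p₁)
  upper' : ∀ x ∈ region α δ β, 1 ≤ x.1 → f x < Φ

theorem inv_mul_rpow_le {x k p : ℝ} (hx : 0 < x) (hk : 1 ≤ k) (hp : p ≤ 1) :
    k⁻¹ * x ^ (-p) ≤ (k * x) ^ (-p) := by
  have hk0 : 0 < k := one_pos.trans_le hk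
  rw [Real.mul_rpow hk0.le hx.le, ← Real.rpow_neg_one]
  exact mul_le_mul_of_nonneg_right (Real.rpow_le_rpow_of_exponent_le hk (by linarith))
    (Real.rpow_nonneg hx.le _)

namespace WeakBounds

variable {α δ β p₀ p₁ Φ : ℝ} {f : ℝ × ℝ → ℝ}

theorem le_Q (h : WeakBounds α δ β p₀ p₁ Φ f) (hα : 0 < α) (hδ : 0 < δ) (hβ : 0 < β)
    (hp : p₀ ≤ 1) (hp0 : 0 ≤ p₀) (hf : ContinuousOn f quadrant) (hf0 : ∀ y ∈ quadrant, 0 ≤ f y)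
    (hR : ∀ y ∈ quadrant, 4 < y.1 → f y = 0) {x : ℝ × ℝ} (hx : x ∈ region α δ β) (hx1 : x.1 ≤ 1) :
    rateConst α * x.1 ^ (-p₀) ≤ Q α f x := by
  have hpos := fst_pos_of_mem_region hδ hβ hx
  -- The factor 1/5 is 1/2 from the weak lower bound times 2/5 from comparing (5/2 · x₁)^(-p₀) with
  -- x₁^(-p₀). It cancels the 5 in `mul_le_Q`.
  refine le_of_eq_of_le (by ring) (mul_le_Q (m := 1 / 5 * x.1 ^ (-p₀)) hα hf hf0 hR
    (by positivity) (mem_quadrant_of_mem_region hδ hβ hx) hpos (snd_le_of_mem_region hα hβ hx)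
    fun y hy hy1 => ?_)
  have hyr := mem_region_of_sub_mem_sector hα hx hy
  have hy0 := fst_pos_of_mem_region hδ hβ hyr
  refine le_trans ?_ (h.lower y hyr (by linarith))
  have h1 := inv_mul_rpow_le (k := 5 / 2) hpos (by norm_num) hp
  have h2 : (5 / 2 * x.1) ^ (-p₀) ≤ y.1 ^ (-p₀) :=
    Real.rpow_le_rpow_of_nonpos hy0 hy1 (by linarith)
  norm_num at h1
  linarith

theorem Q_le (h : WeakBounds α δ β p₀ p₁ Φ f) (hα : 0 < α) (hδ : 0 < δ) (hβ : 0 < β)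
    (hp : p₁ ≤ 1) (hp2 : 1 / 2 ≤ p₁) (hΦ : 0 < Φ) (hf0 : ∀ y ∈ quadrant, 0 ≤ f y)
    (hR : ∀ y ∈ quadrant, 4 < y.1 → f y = 0) {x : ℝ × ℝ} (hx : x ∈ region α δ β) (hx1 : x.1 ≤ 4) :
    Q α f x ≤ 8 * Φ * x.1 ^ (-p₁) := by
  have hpos := fst_pos_of_mem_region hδ hβ hx
  have hc : ContinuousOn (fun s : ℝ => 8 * Φ * s ^ (-p₁)) (Icc x.1 4) := fun s hs =>
    (continuousAt_const.mul (Real.continuousAt_rpow_const _ _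
      (Or.inl (hpos.trans_le hs.1).ne'))).continuousWithinAt
  -- The majorant 8Φ s^(-p₁) also covers 1 ≤ s ≤ 4, since s^(-p₁) ≥ 1/4 there. Integrated against ds
  -- / (2s) it gives at most (4Φ / p₁) x₁^(-p₁), and p₁ ≥ 1/2.
  refine (Q_le_integral hα.le (mem_quadrant_of_mem_region hδ hβ hx) hpos hx1 hc
    (fun s hs => mul_nonneg (by linarith) (Real.rpow_nonneg (hpos.trans_le hs.1).le _)) hf0
    (fun y hy hy4 => ?_) hR).trans ?_
  · have hyr := mem_region_of_sub_mem_sector hα hx hy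
    have hy0 := fst_pos_of_mem_region hδ hβ hyr
    rcases lt_or_ge y.1 1 with h1 | h1
    · refine (h.upper y hyr h1).trans ?_
      have := Real.rpow_nonneg hy0.le (-p₁)
      nlinarith [mul_nonneg hΦ.le this]
    · refine (h.upper' y hyr h1).trans ?_
      have h2 := inv_mul_rpow_le (x := 1) (k := 4) one_pos (by norm_num) hp
      have h3 : (4 : ℝ) ^ (-p₁) ≤ y.1 ^ (-p₁) :=
        Real.rpow_le_rpow_of_nonpos hy0 hy4 (by linarith)
      rw [Real.one_rpow, mul_one, mul_one] at h2
      nlinarith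
  · have e : ∀ s ∈ Icc x.1 4, 8 * Φ * s ^ (-p₁) / (2 * s) = 4 * Φ * s ^ (-p₁ - 1) := by
      intro s hs
      have hs0 := hpos.trans_le hs.1
      rw [Real.rpow_sub_one hs0.ne']
      field_simp
      norm_num
    rw [setIntegral_congr_fun measurableSet_Icc e, integral_Icc_eq_integral_Ioc,
      ← intervalIntegral.integral_of_le hx1, intervalIntegral.integral_const_mul,
      integral_rpow (Or.inr ⟨by linarith, by
        rw [uIcc_of_le hx1]; exact fun h => (hpos.trans_le h.1).false⟩), sub_add_cancel]
    have h1 : 0 ≤ (4 : ℝ) ^ (-p₁) := by positivity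
    have h2 : 0 ≤ x.1 ^ (-p₁) := Real.rpow_nonneg hpos.le _
    have h3 : ((4 : ℝ) ^ (-p₁) - x.1 ^ (-p₁)) / -p₁ ≤ 2 * x.1 ^ (-p₁) := by
      rw [div_neg, ← neg_div, div_le_iff₀ (by linarith)]
      nlinarith
    nlinarith [mul_le_mul_of_nonneg_left h3 (by linarith : 0 ≤ 4 * Φ)]

end WeakBounds

/-- Parameters, front and initial data for which the bounds behind the front propagate. -/
structure Barrier (α δ p₀ p₁ Φ m τ : ℝ) (b : ℝ → ℝ) (ω₀ ρ₀ : ℝ × ℝ → ℝ) : Prop where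
  α_pos : 0 < α
  δ_pos : 0 < δ
  δ_lt : δ < 1
  p₀_pos : 0 < p₀
  p₀_le : p₀ ≤ 1 / 2
  sum : p₀ + p₁ = 1
  Φ_pos : 0 < Φ
  small : 8 * p₀ * Φ ≤ 1
  large : 1 ≤ Φ * p₁ * rateConst α
  time : 128 * Φ * τ < 1
  room : m + τ < Φ
  front_pos : ∀ t ∈ Ico 0 τ, 0 < b t
  front_deriv : ∀ t ∈ Ico 0 τ, HasDerivAt b (-rateConst α * b t ^ (1 - p₀)) t
  front_anti : AntitoneOn b (Ico 0 τ)
  memX_ω : MemX ω₀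
  memX_ρ : MemX ρ₀
  nonneg_ω : ∀ x ∈ quadrant, 0 ≤ ω₀ x
  nonneg_ρ : ∀ x ∈ quadrant, 0 ≤ ρ₀ x
  ρ_le_one : ∀ x ∈ quadrant, ρ₀ x ≤ 1
  supp : ∀ x ∈ quadrant, ω₀ x ≠ 0 ∨ ρ₀ x ≠ 0 → x.1 ≤ 4
  lower : ∀ x ∈ region α δ (b 0), x.1 < 3 → x.1 ^ (-p₀) < ω₀ x
  upper : ∀ x ∈ region α δ (b 0), x.1 < 1 → ω₀ x < Φ * x.1 ^ (-p₁)
  upper' : ∀ x ∈ region α δ (b 0), 1 ≤ x.1 → ω₀ x ≤ m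
  ρ_eq_one : ∀ x ∈ region α δ (b 0), x.1 < 3 → ρ₀ x = 1

namespace Barrier

variable {α δ p₀ p₁ Φ m τ : ℝ} {b : ℝ → ℝ} {ω₀ ρ₀ : ℝ × ℝ → ℝ} {T : ℝ} {ω ρ : ℝ → ℝ × ℝ → ℝ}
  {t : ℝ} {X : ℝ → ℝ × ℝ}

theorem le_Q (B : Barrier α δ p₀ p₁ Φ m τ b ω₀ ρ₀) (sol : IsSolution α ω₀ ρ₀ T ω ρ)
    (ht : t ∈ Ico 0 T) (htτ : t < τ) (hw : WeakBounds α δ (b t) p₀ p₁ Φ (ω t)) {x : ℝ × ℝ}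
    (hx : x ∈ region α δ (b t)) (hx1 : x.1 ≤ 1) : rateConst α * x.1 ^ (-p₀) ≤ Q α (ω t) x :=
  hw.le_Q B.α_pos B.δ_pos (B.front_pos t ⟨ht.1, htτ⟩) (by linarith [B.p₀_le]) B.p₀_pos.le
    (sol.continuous_ω.mem t ht).continuousOn
    (fun y hy => sol.ω_nonneg B.α_pos B.memX_ω B.memX_ρ B.nonneg_ω B.nonneg_ρ ht hy)
    (fun y hy h => sol.ω_eq_zero B.α_pos B.memX_ω B.memX_ρ B.nonneg_ω B.nonneg_ρ B.supp ht hy h)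
    hx hx1

theorem Q_le (B : Barrier α δ p₀ p₁ Φ m τ b ω₀ ρ₀) (sol : IsSolution α ω₀ ρ₀ T ω ρ)
    (ht : t ∈ Ico 0 T) (htτ : t < τ) (hw : WeakBounds α δ (b t) p₀ p₁ Φ (ω t)) {x : ℝ × ℝ}
    (hx : x ∈ region α δ (b t)) (hx1 : x.1 ≤ 4) : Q α (ω t) x ≤ 8 * Φ * x.1 ^ (-p₁) :=
  hw.Q_le B.α_pos B.δ_pos (B.front_pos t ⟨ht.1, htτ⟩) (by linarith [B.sum, B.p₀_pos])
    (by linarith [B.sum, B.p₀_le]) B.Φ_pos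
    (fun y hy => sol.ω_nonneg B.α_pos B.memX_ω B.memX_ρ B.nonneg_ω B.nonneg_ρ ht hy)
    (fun y hy h => sol.ω_eq_zero B.α_pos B.memX_ω B.memX_ρ B.nonneg_ω B.nonneg_ρ B.supp ht hy h)
    hx hx1

/-- Trajectories cannot enter the region behind the front. -/
theorem mem_region (B : Barrier α δ p₀ p₁ Φ m τ b ω₀ ρ₀) (sol : IsSolution α ω₀ ρ₀ T ω ρ)
    (ht : t ∈ Ico 0 T) (htτ : t < τ)
    (hw : ∀ s ∈ Ico 0 t, WeakBounds α δ (b s) p₀ p₁ Φ (ω s))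
    (hX : IsTrajectory α ω₀ ρ₀ ω ρ t X) (hXt : X t ∈ region α δ (b t)) :
    ∀ s ∈ Icc 0 t, X s ∈ region α δ (b s) := by
  have hα := B.α_pos
  have htt : t ∈ Icc 0 t := ⟨ht.1, le_rfl⟩
  have hbc : ContinuousOn b (Icc 0 t) := fun s hs =>
    (B.front_deriv s ⟨hs.1, hs.2.trans_lt htτ⟩).continuousAt.continuousWithinAt
  have hXc := hX.continuousOn_fst
  have hYc := hX.continuousOn_snd
  -- The maximum and minima encode the "or" and "and" in the definition of the region, so membership
  -- becomes positivity of a continuous function and the last time outside exists by compactness.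
  set F : ℝ → ℝ := fun s => max (min ((X s).1 - b s) (2 * α * ((X s).1 - b s) - (X s).2))
    (min ((X s).1 - δ) (2 * α * (X s).1 - (X s).2)) with hF
  have hFc : ContinuousOn F (Icc 0 t) := by
    have h1 := hXc.sub hbc
    exact (h1.inf ((continuousOn_const.mul h1).sub hYc)).sup
      ((hXc.sub continuousOn_const).inf ((continuousOn_const.mul hXc).sub hYc))
  have hiff : ∀ s ∈ Icc 0 t, (X s ∈ region α δ (b s) ↔ 0 < F s) := by
    intro s hs
    simp only [hF, region, mem_ofPred_eq, lt_max_iff, lt_min_iff, sub_pos,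
      (hX.mem s hs).2, true_and]
  by_contra hn
  push Not at hn
  obtain ⟨s₀, hs₀, hs₀n⟩ := hn
  have hcl : IsCompact (Icc 0 t ∩ F ⁻¹' Iic 0) :=
    isCompact_Icc.of_isClosed_subset (hFc.preimage_isClosed_of_isClosed isClosed_Icc isClosed_Iic)
      inter_subset_left
  obtain ⟨s, ⟨hs, hsF⟩, hgr⟩ := hcl.exists_isGreatest
    ⟨s₀, hs₀, not_lt.1 fun h => hs₀n ((hiff s₀ hs₀).2 h)⟩
  have hbetween : ∀ r ∈ Ioo s t, X r ∈ region α δ (b r) := by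
    intro r hr
    have hrI : r ∈ Icc 0 t := ⟨hs.1.trans hr.1.le, hr.2.le⟩
    refine (hiff r hrI).2 (not_le.1 fun h => ?_)
    exact absurd (hgr ⟨hrI, h⟩) (not_le.2 hr.1)
  have hmono : (X t).1 ≤ (X s).1 := hX.anti_fst hs htt hs.2
  have hmono2 : (X s).2 ≤ (X t).2 := hX.mono_snd hs htt hs.2
  refine absurd ((hiff s hs).1 ⟨(hX.mem s hs).2, ?_⟩) (not_lt.2 hsF)
  rcases hXt.2 with h | h
  · have hbt := B.front_pos t ⟨ht.1, htτ⟩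
    by_cases hδ : δ < (X s).1
    · exact Or.inr ⟨hδ, by nlinarith [h.2, mul_pos hα hbt]⟩
    · push Not at hδ
      -- After the last time outside, the path is in the region with b < x₁ ≤ δ < 1. There the lower
      -- bound on Q gives x₁Q ≥ c x₁^(1-p₀) ≥ c b^(1-p₀), so x₁ - b does not increase forward in
      -- time. Backward it is at least its final value, and x₂ is at most its final value.
      have hle := le_of_hasDerivAt_nonneg (f := fun r => b r - (X r).1)
        (f' := fun r => -rateConst α * b r ^ (1 - p₀) - -(Q α (ω r) (X r)) * (X r).1) hs.2
        ((hbc.sub hXc).mono (Icc_subset_Icc_left hs.1)) (fun r hr => ?_) fun r hr => ?_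
      · refine Or.inl ⟨by linarith [h.1], ?_⟩
        nlinarith [h.2]
      · have hr0 : r ∈ Ioo 0 t := ⟨hs.1.trans_lt hr.1, hr.2⟩
        exact (B.front_deriv r ⟨hr0.1.le, hr.2.trans htτ⟩).sub (hX.hasDerivAt_fst hr0)
      · have hr0 : r ∈ Ico 0 t := ⟨hs.1.trans hr.1.le, hr.2⟩
        have hrI : r ∈ Icc 0 t := ⟨hr0.1, hr.2.le⟩
        have hXr : (X r).1 ≤ (X s).1 := hX.anti_fst hs hrI hr.1.le
        have hpos := hX.pos r hrI
        have hlow := B.le_Q sol ⟨hr0.1, hr.2.trans ht.2⟩ (hr.2.trans htτ) (hw r hr0)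
          (hbetween r hr) (by linarith [B.δ_lt])
        have hbr : b r < (X r).1 := by
          rcases (hbetween r hr).2 with h' | h'
          · exact h'.1
          · linarith [h'.1]
        have hb0 := B.front_pos r ⟨hr0.1, hr.2.trans htτ⟩
        have h1 : b r ^ (1 - p₀) ≤ (X r).1 ^ (1 - p₀) :=
          Real.rpow_le_rpow hb0.le hbr.le (by linarith [B.p₀_le])
        have h2 : (X r).1 ^ (1 - p₀) = (X r).1 ^ (-p₀) * (X r).1 := by
          rw [← Real.rpow_add_one hpos.ne', neg_add_eq_sub]
        have h3 := mul_le_mul_of_nonneg_right hlow hpos.le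
        have h4 := mul_le_mul_of_nonneg_left h1 (rateConst_pos hα).le
        rw [h2] at h4
        linarith
  · exact Or.inr ⟨by linarith [h.1], by nlinarith [h.2]⟩

end Barrier

end BoussinesqModel

/-! ### Propagation of the bounds along trajectories and closing of the bootstrap. -/

namespace BoussinesqModel

namespace Barrier

variable {α δ p₀ p₁ Φ m τ : ℝ} {b : ℝ → ℝ} {ω₀ ρ₀ : ℝ × ℝ → ℝ} {T : ℝ} {ω ρ : ℝ → ℝ × ℝ → ℝ}
  {t : ℝ} {X : ℝ → ℝ × ℝ}

theorem mul_inv_le_one (B : Barrier α δ p₀ p₁ Φ m τ b ω₀ ρ₀)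
    (hX : IsTrajectory α ω₀ ρ₀ ω ρ t X) {r : ℝ} (hr : r ∈ Icc 0 t) :
    ρ₀ (X 0) * ((X r).1)⁻¹ ≤ ((X r).1)⁻¹ :=
  mul_le_of_le_one_left (inv_nonneg.2 (hX.pos r hr).le)
    (B.ρ_le_one _ (hX.mem 0 ⟨le_rfl, hr.1.trans hr.2⟩))

/-- To the right of `x₁ = 1` the vorticity grows at most at unit rate. -/
theorem ω_le_add (B : Barrier α δ p₀ p₁ Φ m τ b ω₀ ρ₀)
    (hX : IsTrajectory α ω₀ ρ₀ ω ρ t X) {s : ℝ} (hs : s ∈ Icc 0 t) (h1 : 1 ≤ (X s).1) :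
    ω s (X s) ≤ ω₀ (X 0) + s := by
  have hsub : Icc 0 s ⊆ Icc 0 t := Icc_subset_Icc_right hs.2
  have h := le_of_hasDerivAt_nonneg (f := fun r => r - ω r (X r))
    (f' := fun r => 1 - ρ₀ (X 0) * ((X r).1)⁻¹) hs.1
    (continuousOn_id.sub (hX.continuousOn_ω.mono hsub)) (fun r hr =>
      (hasDerivAt_id r).sub (hX.hasDerivAt_ω ⟨hr.1, hr.2.trans_le hs.2⟩)) fun r hr => ?_
  · rw [hX.initial] at h
    linarith
  · have hrI := hsub (Ioo_subset_Icc_self hr)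
    have h2 : 1 ≤ (X r).1 := h1.trans (hX.anti_fst hrI hs hr.2.le)
    linarith [B.mul_inv_le_one hX hrI, inv_le_one_of_one_le₀ h2]

/-- A path in the region at time t has been there throughout, so the upper bound on Q is available
on it. Then x₁^(-p₀) grows at rate at most 8p₀Φ / x₁ ≤ 1 / x₁, which is the growth rate of ω on
particles with ρ = 1. -/
theorem strong_lower (B : Barrier α δ p₀ p₁ Φ m τ b ω₀ ρ₀) (sol : IsSolution α ω₀ ρ₀ T ω ρ)
    (ht : t ∈ Ico 0 T) (htτ : t < τ)
    (hw : ∀ s ∈ Ico 0 t, WeakBounds α δ (b s) p₀ p₁ Φ (ω s))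
    (hX : IsTrajectory α ω₀ ρ₀ ω ρ t X) (hXt : X t ∈ region α δ (b t)) (h11 : (X t).1 < 11 / 4) :
    (X t).1 ^ (-p₀) < ω t (X t) := by
  have hreg := B.mem_region sol ht htτ hw hX hXt
  have h0 : (0 : ℝ) ∈ Icc 0 t := ⟨le_rfl, ht.1⟩
  have htt : t ∈ Icc 0 t := ⟨ht.1, le_rfl⟩
  have hΦ := B.Φ_pos
  have hp : -p₁ = p₀ - 1 := by linarith [B.sum]
  have hQ : ∀ r ∈ Ioo 0 t, (X r).1 ≤ 4 → Q α (ω r) (X r) ≤ 8 * Φ * (X r).1 ^ (p₀ - 1) := by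
    intro r hr h
    rw [← hp]
    exact B.Q_le sol ⟨hr.1.le, hr.2.trans ht.2⟩ (hr.2.trans htτ) (hw r ⟨hr.1.le, hr.2⟩)
      (hreg r (Ioo_subset_Icc_self hr)) h
  -- The assumptions ρ₀ = 1 and the initial lower bound hold only for x₁ < 3. Between 11/4 and 3 the
  -- speed is at most 24Φ, and 128Φτ < 1 gives 24Φτ < 1/4, so a particle below 11/4 at time t
  -- started below 3.
  have h3 : (X 0).1 < 3 := by
    by_contra hge
    push Not at hge
    obtain ⟨s, hs, hs3⟩ := intermediate_value_Icc' ht.1 hX.continuousOn_fst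
      (show (3 : ℝ) ∈ Icc (X t).1 (X 0).1 from ⟨by linarith, hge⟩)
    simp only at hs3
    have hle := le_of_hasDerivAt_nonneg (f := fun r => (X r).1 + 24 * Φ * r)
      (f' := fun r => -(Q α (ω r) (X r)) * (X r).1 + 24 * Φ * 1) hs.2
      ((hX.continuousOn_fst.add (by fun_prop)).mono (Icc_subset_Icc_left hs.1)) (fun r hr =>
        (hX.hasDerivAt_fst ⟨hs.1.trans_lt hr.1, hr.2⟩).add
          ((hasDerivAt_id r).const_mul (24 * Φ))) fun r hr => ?_
    · have h4 := B.time
      have h5 : Φ * t ≤ Φ * τ := mul_le_mul_of_nonneg_left htτ.le hΦ.le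
      have h6 : 0 ≤ Φ * s := mul_nonneg hΦ.le hs.1
      linarith
    · have hr0 : r ∈ Ioo 0 t := ⟨hs.1.trans_lt hr.1, hr.2⟩
      have hrI := Ioo_subset_Icc_self hr0
      have hpos := hX.pos r hrI
      have hr3 : (X r).1 ≤ 3 := by
        rw [← hs3]; exact hX.anti_fst hs hrI hr.1.le
      have h4 := mul_le_mul_of_nonneg_right (hQ r hr0 (by linarith)) hpos.le
      have h5 : (X r).1 ^ (p₀ - 1) * (X r).1 = (X r).1 ^ p₀ := by
        rw [← Real.rpow_add_one hpos.ne', sub_add_cancel]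
      have h6 : (X r).1 ^ p₀ ≤ 3 := by
        calc (X r).1 ^ p₀ ≤ (3 : ℝ) ^ p₀ := Real.rpow_le_rpow hpos.le hr3 B.p₀_pos.le
          _ ≤ (3 : ℝ) ^ (1 : ℝ) := Real.rpow_le_rpow_of_exponent_le (by norm_num)
              (by linarith [B.p₀_le])
          _ = 3 := Real.rpow_one 3
      rw [mul_assoc, h5] at h4
      have h7 := mul_le_mul_of_nonneg_left h6 (by linarith : 0 ≤ 8 * Φ)
      linarith
  have hle := le_of_hasDerivAt_nonneg (f := fun r => ω r (X r) - (X r).1 ^ (-p₀))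
    (f' := fun r => ρ₀ (X 0) * ((X r).1)⁻¹ -
      -(Q α (ω r) (X r)) * (X r).1 * (-p₀) * (X r).1 ^ (-p₀ - 1)) ht.1
    (hX.continuousOn_ω.sub (hX.continuousOn_fst.rpow_const fun r hr => Or.inl (hX.pos r hr).ne'))
    (fun r hr => (hX.hasDerivAt_ω hr).sub ((hX.hasDerivAt_fst hr).rpow_const
      (Or.inl (hX.pos r (Ioo_subset_Icc_self hr)).ne'))) fun r hr => ?_
  · simp only [hX.initial] at hle
    linarith [B.lower _ (hreg 0 h0) h3]
  · have hrI := Ioo_subset_Icc_self hr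
    have hpos := hX.pos r hrI
    have hr3 : (X r).1 ≤ (X 0).1 := hX.anti_fst h0 hrI hr.1.le
    rw [B.ρ_eq_one _ (hreg 0 h0) h3, one_mul]
    have e1 : (X r).1 * (X r).1 ^ (-p₀ - 1) = (X r).1 ^ (-p₀) := by
      rw [mul_comm, ← Real.rpow_add_one hpos.ne', sub_add_cancel]
    have e2 : (X r).1 ^ (p₀ - 1) * (X r).1 ^ (-p₀) = ((X r).1)⁻¹ := by
      rw [← Real.rpow_add hpos, ← Real.rpow_neg_one]; congr 1; ring
    have h4 := mul_le_mul_of_nonneg_right (hQ r hr (by linarith))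
      (Real.rpow_nonneg hpos.le (-p₀))
    rw [mul_assoc, e2] at h4
    have h5 := mul_le_mul_of_nonneg_left h4 B.p₀_pos.le
    have h6 := mul_le_mul_of_nonneg_right B.small (inv_pos.2 hpos).le
    have e3 : -(Q α (ω r) (X r)) * (X r).1 * (-p₀) * (X r).1 ^ (-p₀ - 1) =
        p₀ * (Q α (ω r) (X r) * (X r).1 ^ (-p₀)) := by rw [← e1]; ring
    rw [e3]
    linarith

/-- For x₁ ≤ 1 the lower bound on Q makes Φ x₁^(-p₁) grow at rate at least Φp₁c / x₁ ≥ 1 / x₁, and ω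
never grows faster because ρ₀ ≤ 1. -/
theorem strong_upper (B : Barrier α δ p₀ p₁ Φ m τ b ω₀ ρ₀) (sol : IsSolution α ω₀ ρ₀ T ω ρ)
    (ht : t ∈ Ico 0 T) (htτ : t < τ)
    (hw : ∀ s ∈ Ico 0 t, WeakBounds α δ (b s) p₀ p₁ Φ (ω s))
    (hX : IsTrajectory α ω₀ ρ₀ ω ρ t X) (hXt : X t ∈ region α δ (b t)) (h1 : (X t).1 < 1) :
    ω t (X t) < Φ * (X t).1 ^ (-p₁) := by
  have hreg := B.mem_region sol ht htτ hw hX hXt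
  have h0 : (0 : ℝ) ∈ Icc 0 t := ⟨le_rfl, ht.1⟩
  have hp : -p₁ = p₀ - 1 := by linarith [B.sum]
  -- The comparison starts when the particle is first known to satisfy x₁ ≤ 1: at time 0, or at a
  -- crossing of x₁ = 1, where ω ≤ m + s < Φ.
  obtain ⟨s, hs, hs1, hsω⟩ : ∃ s ∈ Icc 0 t, (X s).1 ≤ 1 ∧ ω s (X s) < Φ * (X s).1 ^ (-p₁) := by
    by_cases hlt : (X 0).1 < 1
    · exact ⟨0, h0, hlt.le, by rw [hX.initial]; exact B.upper _ (hreg 0 h0) hlt⟩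
    · push Not at hlt
      obtain ⟨s, hs, hs1⟩ := intermediate_value_Icc' ht.1 hX.continuousOn_fst
        (show (1 : ℝ) ∈ Icc (X t).1 (X 0).1 from ⟨h1.le, hlt⟩)
      simp only at hs1
      refine ⟨s, hs, hs1.le, ?_⟩
      rw [hs1, Real.one_rpow, mul_one]
      have h2 := B.ω_le_add hX hs hs1.ge
      linarith [B.upper' _ (hreg 0 h0) hlt, B.room, hs.2]
  have hle := le_of_hasDerivAt_nonneg (f := fun r => Φ * (X r).1 ^ (-p₁) - ω r (X r))
    (f' := fun r => Φ * (-(Q α (ω r) (X r)) * (X r).1 * (-p₁) * (X r).1 ^ (-p₁ - 1)) -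
      ρ₀ (X 0) * ((X r).1)⁻¹) hs.2
    (((continuousOn_const.mul (hX.continuousOn_fst.rpow_const fun r hr =>
      Or.inl (hX.pos r hr).ne')).sub hX.continuousOn_ω).mono (Icc_subset_Icc_left hs.1))
    (fun r hr => ?_) fun r hr => ?_
  · linarith
  · have hr0 : r ∈ Ioo 0 t := ⟨hs.1.trans_lt hr.1, hr.2⟩
    exact (((hX.hasDerivAt_fst hr0).rpow_const
      (Or.inl (hX.pos r (Ioo_subset_Icc_self hr0)).ne')).const_mul Φ).sub (hX.hasDerivAt_ω hr0)
  · have hr0 : r ∈ Ioo 0 t := ⟨hs.1.trans_lt hr.1, hr.2⟩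
    have hrI := Ioo_subset_Icc_self hr0
    have hpos := hX.pos r hrI
    have hr1 : (X r).1 ≤ 1 := (show (X r).1 ≤ (X s).1 from hX.anti_fst hs hrI hr.1.le).trans hs1
    have hQ := B.le_Q sol ⟨hr0.1.le, hr.2.trans ht.2⟩ (hr.2.trans htτ) (hw r ⟨hr0.1.le, hr.2⟩)
      (hreg r hrI) hr1
    have e1 : (X r).1 * (X r).1 ^ (-p₁ - 1) = (X r).1 ^ (-p₁) := by
      rw [mul_comm, ← Real.rpow_add_one hpos.ne', sub_add_cancel]
    have e2 : (X r).1 ^ (-p₀) * (X r).1 ^ (-p₁) = ((X r).1)⁻¹ := by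
      rw [← Real.rpow_add hpos, ← Real.rpow_neg_one]; congr 1; linarith [B.sum]
    have h4 := mul_le_mul_of_nonneg_right hQ (Real.rpow_nonneg hpos.le (-p₁))
    rw [mul_assoc, e2] at h4
    have hp1 : 0 ≤ p₁ := by linarith [B.sum, B.p₀_le]
    have h5 := mul_le_mul_of_nonneg_left h4 (mul_nonneg B.Φ_pos.le hp1)
    have h6 := mul_le_mul_of_nonneg_right B.large (inv_pos.2 hpos).le
    have e3 : Φ * (-(Q α (ω r) (X r)) * (X r).1 * (-p₁) * (X r).1 ^ (-p₁ - 1)) =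
        Φ * p₁ * (Q α (ω r) (X r) * (X r).1 ^ (-p₁)) := by rw [← e1]; ring
    rw [e3]
    linarith [B.mul_inv_le_one hX hrI]

theorem strongBounds (B : Barrier α δ p₀ p₁ Φ m τ b ω₀ ρ₀) (sol : IsSolution α ω₀ ρ₀ T ω ρ)
    (ht : t ∈ Ico 0 T) (htτ : t < τ)
    (hw : ∀ s ∈ Ico 0 t, WeakBounds α δ (b s) p₀ p₁ Φ (ω s)) :
    StrongBounds α δ (b t) p₀ p₁ Φ (ω t) := by
  have hb := B.front_pos t ⟨ht.1, htτ⟩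
  have hex : ∀ x ∈ region α δ (b t), ∃ X, X t = x ∧ IsTrajectory α ω₀ ρ₀ ω ρ t X := fun x hx =>
    sol.exists_trajectory B.α_pos B.memX_ω B.memX_ρ B.nonneg_ω B.nonneg_ρ ht
      (mem_quadrant_of_mem_region B.δ_pos hb hx) (fst_pos_of_mem_region B.δ_pos hb hx)
  refine ⟨fun x hx h => ?_, fun x hx h => ?_, fun x hx h => ?_⟩ <;>
    obtain ⟨X, rfl, hX⟩ := hex x hx
  · exact B.strong_lower sol ht htτ hw hX hx h
  · exact B.strong_upper sol ht htτ hw hX hx h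
  · have h0 : (0 : ℝ) ∈ Icc 0 t := ⟨le_rfl, ht.1⟩
    have h1 : 1 ≤ (X 0).1 := h.trans (hX.anti_fst h0 ⟨ht.1, le_rfl⟩ ht.1)
    have h2 := B.ω_le_add hX ⟨ht.1, le_rfl⟩ h
    linarith [B.upper' _ (B.mem_region sol ht htτ hw hX hx 0 h0) h1, B.room]

/-- A point of the region at a later time is close to a point of the region at an earlier one. -/
theorem exists_near {δ β β' : ℝ} (hβ : β' ≤ β) {x : ℝ × ℝ} (hx : x ∈ region α δ β') :
    ∃ x' ∈ region α δ β, x.1 ≤ x'.1 ∧ x'.1 ≤ x.1 + (β - β') ∧ dist x x' ≤ β - β' := by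
  rcases hx.2 with h | h
  · refine ⟨(x.1 + (β - β'), x.2), ⟨hx.1, Or.inl ⟨by simp only; linarith [h.1], ?_⟩⟩, ?_,
      le_rfl, ?_⟩
    · simp only
      rw [show x.1 + (β - β') - β = x.1 - β' by ring]
      exact h.2
    · simp only; linarith
    · rw [Prod.dist_eq, dist_self, Real.dist_eq, max_eq_left (abs_nonneg _)]
      simp only [sub_add_cancel_left, abs_neg]
      rw [abs_of_nonneg (by linarith)]
  · exact ⟨x, ⟨hx.1, Or.inr h⟩, le_rfl, by linarith, by rw [dist_self]; linarith⟩

theorem _root_.BoussinesqModel.MemX.uniformContinuousOn {f : ℝ × ℝ → ℝ} (hf : MemX f) :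
    UniformContinuousOn f quadrant := by
  obtain ⟨g, h1, h2, -, h3⟩ := hf
  exact (h2.uniformContinuous_of_continuous h1.continuous).uniformContinuousOn.congr h3.symm

theorem eventually_weakBounds (B : Barrier α δ p₀ p₁ Φ m τ b ω₀ ρ₀)
    (sol : IsSolution α ω₀ ρ₀ T ω ρ) (ht : t ∈ Ico 0 T) (htτ : t < τ)
    (hs : StrongBounds α δ (b t) p₀ p₁ Φ (ω t)) :
    ∀ᶠ s in 𝓝[≥] t, WeakBounds α δ (b s) p₀ p₁ Φ (ω s) := by
  have hΦ := B.Φ_pos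
  have hbt := B.front_pos t ⟨ht.1, htτ⟩
  -- The total error is 2ε. For the upper bounds 2ε ≤ Φ suffices. For the lower bound, shifting by
  -- at most x₁/3 costs a factor 3/4, leaving a margin of x₁^(-p₀)/4 ≥ 1/10 ≥ 2ε when x₁ ≤ 5/2.
  set ε := min (1 / 20) (Φ / 2) with hε
  have hε0 : 0 < ε := lt_min (by norm_num) (by linarith)
  obtain ⟨θ, hθ, hunif⟩ := Metric.uniformContinuousOn_iff.1
    (sol.continuous_ω.mem t ht).uniformContinuousOn ε hε0
  have htime := Metric.tendstoUniformlyOn_iff.1 (sol.continuous_ω.tendsto t ht) ε hε0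
  have hnhds : 𝓝[≥] t ≤ 𝓝[Ico 0 T] t := by
    refine nhdsWithin_le_iff.2 ?_
    filter_upwards [self_mem_nhdsWithin, mem_nhdsWithin_of_mem_nhds (Iio_mem_nhds ht.2)] with s h h'
    exact ⟨ht.1.trans h, h'⟩
  have hbc : ContinuousAt b t := (B.front_deriv t ⟨ht.1, htτ⟩).continuousAt
  -- The front may move by less than b/4 and δ/3, so the horizontal shift is below x₁/3; by less
  -- than θ, for uniform continuity; and by less than 1/4, so that x₁ ≤ 5/2 is shifted below 11/4.
  have hb : ∀ᶠ s in 𝓝[≥] t, b t - min (b t / 4) (min θ (min (1 / 4) (δ / 3))) < b s :=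
    mem_nhdsWithin_of_mem_nhds (hbc.eventually (lt_mem_nhds (by
      have : 0 < min (b t / 4) (min θ (min (1 / 4) (δ / 3))) :=
        lt_min (by linarith) (lt_min hθ (lt_min (by norm_num) (by linarith [B.δ_pos])))
      linarith)))
  filter_upwards [self_mem_nhdsWithin, mem_nhdsWithin_of_mem_nhds (Iio_mem_nhds htτ), hb,
    hnhds htime] with s hts hsτ hbs hdist
  have hsI : s ∈ Ico 0 τ := ⟨ht.1.trans hts, hsτ⟩
  have hbs0 := B.front_pos s hsI
  have hanti : b s ≤ b t := B.front_anti ⟨ht.1, htτ⟩ hsI hts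
  have d0 := sub_lt_comm.1 hbs
  have d1 : b t - b s < b t / 4 := d0.trans_le (min_le_left _ _)
  have d5 := d0.trans_le (min_le_right _ _)
  have d2 : b t - b s < θ := d5.trans_le (min_le_left _ _)
  have d3 : b t - b s < 1 / 4 := (d5.trans_le (min_le_right _ _)).trans_le (min_le_left _ _)
  have d4 : b t - b s < δ / 3 := (d5.trans_le (min_le_right _ _)).trans_le (min_le_right _ _)
  have ε1 : ε ≤ 1 / 20 := min_le_left _ _
  have ε2 : ε ≤ Φ / 2 := min_le_right _ _
  have key : ∀ x ∈ region α δ (b s), ∃ x' ∈ region α δ (b t), x.1 ≤ x'.1 ∧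
      x'.1 ≤ x.1 + (b t - b s) ∧ ω t x' - 2 * ε ≤ ω s x ∧ ω s x ≤ ω t x' + 2 * ε := by
    intro x hx
    obtain ⟨x', hx', h1, h2, h3⟩ := exists_near hanti hx
    have hxq := mem_quadrant_of_mem_region B.δ_pos hbs0 hx
    have hxq' := mem_quadrant_of_mem_region B.δ_pos hbt hx'
    have h4 := hunif x hxq x' hxq' (h3.trans_lt d2)
    have h5 := hdist x hxq
    rw [Real.dist_eq, abs_lt] at h4 h5
    exact ⟨x', hx', h1, h2, by linarith, by linarith⟩
  refine ⟨fun x hx h => ?_, fun x hx h => ?_, fun x hx h => ?_⟩ <;>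
    obtain ⟨x', hx', h1, h2, h3, h4⟩ := key x hx
  · have hpos := fst_pos_of_mem_region B.δ_pos hbs0 hx
    have hpos' := fst_pos_of_mem_region B.δ_pos hbt hx'
    have h5 := hs.lower x' hx' (by linarith)
    have hp := B.p₀_pos
    have h7 : x'.1 ≤ 4 / 3 * x.1 := by
      rcases hx.2 with h6 | h6 <;> linarith [h6.1]
    have h8 : (4 / 3 * x.1) ^ (-p₀) ≤ x'.1 ^ (-p₀) :=
      Real.rpow_le_rpow_of_nonpos hpos' h7 (by linarith)
    have h9 := inv_mul_rpow_le (k := 4 / 3) hpos (by norm_num) (by linarith [B.p₀_le] : p₀ ≤ 1)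
    have h10 := inv_mul_rpow_le (x := 1) (k := 5 / 2) one_pos (by norm_num)
      (by linarith [B.p₀_le] : p₀ ≤ 1)
    have h11 : (5 / 2 : ℝ) ^ (-p₀) ≤ x.1 ^ (-p₀) :=
      Real.rpow_le_rpow_of_nonpos hpos h (by linarith)
    rw [Real.one_rpow, mul_one, mul_one] at h10
    norm_num at h9 h10
    linarith
  · have hpos := fst_pos_of_mem_region B.δ_pos hbs0 hx
    have h5 : 1 ≤ x.1 ^ (-p₁) :=
      Real.one_le_rpow_of_pos_of_le_one_of_nonpos hpos h.le (by linarith [B.sum, B.p₀_le])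
    have h6 := mul_le_mul_of_nonneg_left h5 hΦ.le
    rcases lt_or_ge x'.1 1 with h7 | h7
    · have h8 := hs.upper x' hx' h7
      have h9 := mul_le_mul_of_nonneg_left
        (Real.rpow_le_rpow_of_nonpos hpos h1 (by linarith [B.sum, B.p₀_le] : -p₁ ≤ 0)) hΦ.le
      linarith
    · linarith [hs.upper' x' hx' h7]
  · linarith [hs.upper' x' hx' (h.trans h1)]

/-- The bounds behind the front hold as long as the solution and the front exist. -/
theorem strongBounds_of_lt (B : Barrier α δ p₀ p₁ Φ m τ b ω₀ ρ₀)
    (sol : IsSolution α ω₀ ρ₀ T ω ρ) (ht : t ∈ Ico 0 T) (htτ : t < τ) :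
    StrongBounds α δ (b t) p₀ p₁ Φ (ω t) := by
  suffices hw : ∀ s ∈ Icc 0 t, WeakBounds α δ (b s) p₀ p₁ Φ (ω s) from
    B.strongBounds sol ht htτ fun s hs => hw s (Ico_subset_Icc_self hs)
  by_contra hn
  push Not at hn
  set Z : Set ℝ := {s | s ∈ Icc 0 t ∧ ¬ WeakBounds α δ (b s) p₀ p₁ Φ (ω s)} with hZ
  have hne : Z.Nonempty := hn
  have hbdd : BddBelow Z := ⟨0, fun s hs => hs.1.1⟩
  obtain ⟨z, hz⟩ := hne
  have hi0 : 0 ≤ sInf Z := le_csInf ⟨z, hz⟩ fun s hs => hs.1.1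
  have hit : sInf Z ≤ t := (csInf_le hbdd hz).trans hz.1.2
  have hiT : sInf Z ∈ Ico 0 T := ⟨hi0, hit.trans_lt ht.2⟩
  have hiτ : sInf Z < τ := hit.trans_lt htτ
  -- The weak bounds hold strictly before the infimum of the bad times, so the strong ones hold at
  -- it. These imply the weak bounds on a right neighbourhood, contradicting the infimum.
  have hs := B.strongBounds sol hiT hiτ fun s hs => by
    by_contra hbad
    exact absurd (csInf_le hbdd (show s ∈ Z from ⟨⟨hs.1, hs.2.le.trans hit⟩, hbad⟩)) (not_le.2 hs.2)
  have hev := B.eventually_weakBounds sol hiT hiτ hs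
  obtain ⟨u, hu, hsub⟩ := mem_nhdsGE_iff_exists_Ico_subset.1 hev
  obtain ⟨y, hy, hyu⟩ := exists_lt_of_csInf_lt ⟨z, hz⟩ hu
  exact hy.2 (hsub ⟨csInf_le hbdd hy, hyu⟩)

end Barrier

end BoussinesqModel

/-! ### The explicit front, finiteness of the lifespan, and preparation of the data. -/

namespace BoussinesqModel

/-- The position of the front: the solution of `b' = -c b ^ (1 - p)` vanishing at time `τ`. -/
noncomputable def front (p c τ t : ℝ) : ℝ := (p * c * (τ - t)) ^ (1 / p)

section Front

variable {p c τ : ℝ}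

theorem front_arg_pos (hp : 0 < p) (hc : 0 < c) {t : ℝ} (ht : t < τ) : 0 < p * c * (τ - t) :=
  mul_pos (mul_pos hp hc) (sub_pos.2 ht)

theorem front_pos (hp : 0 < p) (hc : 0 < c) {t : ℝ} (ht : t < τ) : 0 < front p c τ t :=
  Real.rpow_pos_of_pos (front_arg_pos hp hc ht) _

theorem hasDerivAt_front (hp : 0 < p) (hc : 0 < c) {t : ℝ} (ht : t < τ) :
    HasDerivAt (front p c τ) (-c * front p c τ t ^ (1 - p)) t := by
  have hy := front_arg_pos hp hc ht
  have h1 : HasDerivAt (fun t => p * c * (τ - t)) (p * c * -1) t :=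
    ((hasDerivAt_id t).const_sub τ).const_mul (p * c)
  refine (h1.rpow_const (p := 1 / p) (Or.inl hy.ne')).congr_deriv ?_
  rw [front, ← Real.rpow_mul hy.le, show 1 / p * (1 - p) = 1 / p - 1 by field_simp]
  field_simp

theorem contDiffOn_front (hp : 0 < p) (hc : 0 < c) {n : WithTop ℕ∞} :
    ContDiffOn ℝ n (front p c τ) (Ico 0 τ) :=
  ContDiffOn.rpow_const_of_ne (by fun_prop) fun _ ht => (front_arg_pos hp hc ht.2).ne'

theorem strictAntiOn_front (hp : 0 < p) (hc : 0 < c) : StrictAntiOn (front p c τ) (Ico 0 τ) :=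
  fun s _ t ht hst => Real.rpow_lt_rpow (front_arg_pos hp hc ht.2).le
    (mul_lt_mul_of_pos_left (by linarith) (mul_pos hp hc)) (by positivity)

theorem tendsto_front (hp : 0 < p) : Tendsto (front p c τ) (𝓝[<] τ) (𝓝 0) := by
  have hc : ContinuousAt (front p c τ) τ :=
    ContinuousAt.rpow_const (by fun_prop) (Or.inr (by positivity))
  have h := hc.tendsto.mono_left (nhdsWithin_le_nhds (s := Iio τ))
  rwa [front, sub_self, mul_zero, Real.zero_rpow (by positivity)] at h

end Front

/-- The solution breaks down before the front reaches the origin. -/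
theorem Barrier.lifespan_le {α δ p₀ p₁ Φ m τ : ℝ} {b : ℝ → ℝ} {ω₀ ρ₀ : ℝ × ℝ → ℝ} {T : ℝ}
    {ω ρ : ℝ → ℝ × ℝ → ℝ} (B : Barrier α δ p₀ p₁ Φ m τ b ω₀ ρ₀) (hτ : 0 < τ)
    (hb : Tendsto b (𝓝[<] τ) (𝓝 0)) (sol : IsSolution α ω₀ ρ₀ T ω ρ) : T ≤ τ := by
  by_contra hlt
  push Not at hlt
  have hτI : τ ∈ Ico 0 T := ⟨hτ.le, hlt⟩
  obtain ⟨a, R, M, ha, -, hbox⟩ := sol.exists_box hτI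
  set r := min (a / 2) 1 with hr
  have hr0 : 0 < r := lt_min (by linarith) one_pos
  have hrq : (r, (0 : ℝ)) ∈ quadrant := ⟨hr0.le, le_rfl⟩
  have hz : ω τ (r, 0) = 0 := by
    by_contra hne
    have h1 : a ≤ r := ((hbox τ ⟨hτ.le, le_rfl⟩ _ hrq).2 (Or.inl hne)).1
    linarith [min_le_left (a / 2) 1]
  have hev : ∀ᶠ t in 𝓝[<] τ, t ∈ Ioo 0 τ := Ioo_mem_nhdsLT hτ
  have hle : 𝓝[<] τ ≤ 𝓝[Ici 0] τ :=
    nhdsWithin_le_iff.2 (by filter_upwards [hev] with t ht using ht.1.le)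
  have hlim : Tendsto (fun t => ω t (r, 0)) (𝓝[<] τ) (𝓝 (ω τ (r, 0))) :=
    ((sol.eq_ω τ hτI _ hrq).continuousWithinAt).mono_left hle
  rw [hz] at hlim
  -- At time τ the vorticity vanishes at (r, 0), left of the support. Yet once b < r it exceeds
  -- r^(-p₀) there, and this survives the limit t → τ.
  have hge : r ^ (-p₀) ≤ 0 := by
    refine ge_of_tendsto hlim ?_
    filter_upwards [hev, hb.eventually (gt_mem_nhds hr0)] with t ht hbt
    refine ((B.strongBounds_of_lt sol ⟨ht.1.le, ht.2.trans hlt⟩ ht.2).lower (r, 0)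
      ⟨le_rfl, Or.inl ⟨hbt, ?_⟩⟩ ?_).le
    · exact mul_pos (mul_pos two_pos B.α_pos) (sub_pos.2 hbt)
    · simp only
      linarith [min_le_right (a / 2) 1]
  exact absurd hge (not_le.2 (Real.rpow_pos_of_pos hr0 _))

theorem mem_D₀_of_mem_region {α b₀ δ : ℝ} (hα : 0 < α) (hb : 0 < b₀) {x : ℝ × ℝ}
    (hx : x ∈ region α δ b₀) (h4 : x.1 < 4) : x ∈ D₀ α b₀ δ := by
  refine ⟨hx.1, ?_⟩
  rcases hx.2 with h | h
  · rcases le_or_gt x.1 δ with hδ | hδ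
    · exact Or.inl ⟨h.1, hδ, h.2.le⟩
    · exact Or.inr ⟨hδ, h4, by nlinarith [h.2, mul_pos hα hb]⟩
  · exact Or.inr ⟨h.1, h4, h.2.le⟩

theorem SuitablyPrepared.lt_four {α b₀ p₀ p₁ δ φ₀ φ₁ : ℝ} {ω₀ ρ₀ : ℝ × ℝ → ℝ}
    (h : SuitablyPrepared α b₀ p₀ p₁ δ φ₀ φ₁ ω₀ ρ₀) {x : ℝ × ℝ} (hx : x ∈ quadrant)
    (hne : ω₀ x ≠ 0 ∨ ρ₀ x ≠ 0) : x.1 < 4 := by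
  rcases hne with hne | hne
  · exact (h.supp_ω (subset_closure ⟨hne, hx⟩)).2
  · exact (h.supp_ρ (subset_closure ⟨hne, hx⟩)).2

/-- Suitably prepared data satisfy the assumptions of the barrier argument. -/
theorem SuitablyPrepared.barrier {α p₀ p₁ δ φ₁ Φ m τ : ℝ} {ω₀ ρ₀ : ℝ × ℝ → ℝ}
    (h : SuitablyPrepared α (front p₀ (rateConst α) τ 0) p₀ p₁ δ 1 φ₁ ω₀ ρ₀) (hα : 0 < α)
    (hδ : 0 < δ) (hδ1 : δ < 1) (hp : 0 < p₀) (hp' : p₀ ≤ 1 / 2) (hsum : p₀ + p₁ = 1)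
    (hΦ0 : 0 < Φ) (hΦ : φ₁ ≤ Φ) (hsmall : 8 * p₀ * Φ ≤ 1) (hlarge : 1 ≤ Φ * p₁ * rateConst α)
    (hτ : 0 < τ) (htime : 128 * Φ * τ < 1) (hm0 : 0 ≤ m) (hroom : m + τ < Φ)
    (hm : ∀ x ∈ D₀ α (front p₀ (rateConst α) τ 0) δ, 1 ≤ x.1 → x.1 < 4 → ω₀ x ≤ m) :
    Barrier α δ p₀ p₁ Φ m τ (front p₀ (rateConst α) τ) ω₀ ρ₀ := by
  have hc := rateConst_pos hα
  have hb := front_pos hp hc hτ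
  have hD : ∀ {x : ℝ × ℝ}, x ∈ region α δ (front p₀ (rateConst α) τ 0) → x.1 < 4 →
      x ∈ D₀ α (front p₀ (rateConst α) τ 0) δ := fun hx h4 => mem_D₀_of_mem_region hα hb hx h4
  refine
    { α_pos := hα
      δ_pos := hδ
      δ_lt := hδ1
      p₀_pos := hp
      p₀_le := hp'
      sum := hsum
      Φ_pos := hΦ0
      small := hsmall
      large := hlarge
      time := htime
      room := hroom
      front_pos := fun t ht => front_pos hp hc ht.2
      front_deriv := fun t ht => hasDerivAt_front hp hc ht.2
      front_anti := (strictAntiOn_front hp hc).antitoneOn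
      memX_ω := h.memX_ω
      memX_ρ := h.memX_ρ
      nonneg_ω := h.nonneg_ω
      nonneg_ρ := h.nonneg_ρ
      ρ_le_one := h.ρ_le_one
      supp := fun x hx hne => (h.lt_four hx hne).le
      lower := fun x hx h3 => ?_
      upper := fun x hx h1 => ?_
      upper' := fun x hx h1 => ?_
      ρ_eq_one := fun x hx h3 => h.ρ_eq_one x (hD hx (by linarith)) h3 }
  · rcases lt_or_ge x.1 1 with h1 | h1
    · have := h.lower x (hD hx (by linarith)) h1
      rwa [one_mul] at this
    · exact (Real.rpow_le_one_of_one_le_of_nonpos h1 (by linarith)).trans_lt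
        (h.lower' x (hD hx (by linarith)) h1 h3)
  · refine (h.upper x (hD hx (by linarith)) h1).trans_le (mul_le_mul_of_nonneg_right hΦ ?_)
    exact Real.rpow_nonneg (fst_pos_of_mem_region hδ hb hx).le _
  · rcases lt_or_ge x.1 4 with h4 | h4
    · exact hm x (hD hx h4) h1 h4
    · by_contra hlt
      push Not at hlt
      have := h.lt_four (mem_quadrant_of_mem_region hδ hb hx) (Or.inl (hm0.trans_lt hlt).ne')
      linarith

end BoussinesqModel

theorem theorem2 (α : ℝ) (hα : 0 < α) :
    ∃ p₀ p₁ δ φ₀ φ₁ : ℝ,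
      0 < p₀ ∧ p₀ < 1 / 2 ∧ p₀ + p₁ = 1 ∧ 0 < δ ∧ δ < 1 ∧ 0 < φ₀ ∧ φ₀ < φ₁ ∧
      ∀ M : ℝ, M < φ₁ → ∃ b₀ : ℝ, 0 < b₀ ∧ b₀ < δ ∧
        ∀ ω₀ ρ₀ : ℝ × ℝ → ℝ,
          BoussinesqModel.SuitablyPrepared α b₀ p₀ p₁ δ φ₀ φ₁ ω₀ ρ₀ →
          ∃ (Ts : ℝ) (ω ρ : ℝ → ℝ × ℝ → ℝ),
            0 < Ts ∧
            BoussinesqModel.IsMaximalSolution α ω₀ ρ₀ Ts ω ρ ∧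
            Tendsto (fun t => eLpNorm (ω t) ⊤ (volume.restrict BoussinesqModel.quadrant))
              (𝓝[<] Ts) (𝓝 ⊤) ∧
            ∃ (Tstar : ℝ) (b : ℝ → ℝ),
              0 < Tstar ∧ Ts ≤ Tstar ∧
              ContDiffOn ℝ ((⊤ : ℕ∞) : WithTop ℕ∞) b (Ico 0 Tstar) ∧
              b 0 = b₀ ∧
              (∀ t ∈ Ico 0 Tstar, 0 < b t) ∧
              StrictAntiOn b (Ico 0 Tstar) ∧
              Tendsto b (𝓝[<] Tstar) (𝓝 0) ∧
              ∀ t ∈ Ico 0 Ts, ∀ x₁ : ℝ, b t < x₁ → x₁ < 1 →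
                φ₀ * x₁ ^ (-p₀) < ω t (x₁, 0) ∧
                ((∀ x ∈ BoussinesqModel.D₀ α b₀ δ, 1 ≤ x.1 → ω₀ x ≤ M) →
                  ω t (x₁, 0) < φ₁ * x₁ ^ (-p₁)) := by
  have hc := BoussinesqModel.rateConst_pos hα
  set c := BoussinesqModel.rateConst α with hc_def
  -- Φ = φ₁ must give Φp₁c ≥ 1; since p₁ ≥ 1/2, the bound φ₁c ≥ 2 is enough.
  set φ₁ : ℝ := max 2 (2 / c) with hφ₁
  have hφ2 : 2 ≤ φ₁ := le_max_left _ _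
  have hφc : 2 ≤ φ₁ * c := by
    rw [← div_le_iff₀ hc]; exact le_max_right _ _
  -- The condition 8p₀Φ ≤ 1 is needed up to Φ = 2φ₁, hence the 16.
  set p₀ : ℝ := 1 / (16 * φ₁) with hp₀
  have hp : 0 < p₀ := by positivity
  have hpφ : 16 * p₀ * φ₁ = 1 := by rw [hp₀]; field_simp
  have hp' : p₀ ≤ 1 / 32 := by nlinarith
  refine ⟨p₀, 1 - p₀, 1 / 2, 1, φ₁, hp, by linarith, by ring, by norm_num, by norm_num, one_pos,
    by linarith, fun M hM => ?_⟩
  -- A nonnegative bound is needed because it must also hold for x₁ ≥ 4, where ω₀ vanishes.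
  set m : ℝ := max M 0 with hm
  have hm0 : 0 ≤ m := le_max_right _ _
  have hmφ : m < φ₁ := max_lt hM (by linarith)
  -- The three entries secure 128Φτ < 1 for both values of Φ, the room m + τ < φ₁, and b₀ < 1/2.
  set τ : ℝ := min (1 / (512 * φ₁)) (min ((φ₁ - m) / 2) (1 / (4 * (p₀ * c)))) with hτ_def
  have hτ : 0 < τ :=
    lt_min (by positivity) (lt_min (by linarith) (by positivity))
  have hτ1 : 512 * φ₁ * τ ≤ 1 := by
    have h : τ ≤ 1 / (512 * φ₁) := min_le_left _ _
    rw [le_div_iff₀ (by positivity)] at h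
    linarith
  have hτ2 : τ ≤ (φ₁ - m) / 2 := (min_le_right _ _).trans (min_le_left _ _)
  have hτ3 : p₀ * c * τ ≤ 1 / 4 := by
    have h : τ ≤ 1 / (4 * (p₀ * c)) := (min_le_right _ _).trans (min_le_right _ _)
    rw [le_div_iff₀ (by positivity)] at h
    linarith
  have hτ4 : τ < φ₁ := by nlinarith
  have hb₀ : BoussinesqModel.front p₀ c τ 0 < 1 / 2 := by
    have h0 : 0 < p₀ * c * τ := by positivity
    rw [BoussinesqModel.front, sub_zero]
    calc (p₀ * c * τ) ^ (1 / p₀) ≤ (p₀ * c * τ) ^ (1 : ℝ) :=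
          Real.rpow_le_rpow_of_exponent_ge h0 (by linarith) (by
            rw [le_div_iff₀ hp]; linarith)
      _ < 1 / 2 := by rw [Real.rpow_one]; linarith
  refine ⟨BoussinesqModel.front p₀ c τ 0, BoussinesqModel.front_pos hp hc hτ, hb₀,
    fun ω₀ ρ₀ h => ?_⟩
  have hlarge : ∀ Φ, φ₁ ≤ Φ → 1 ≤ Φ * (1 - p₀) * c := by
    intro Φ hΦ
    have h1 : 2 ≤ Φ * c := hφc.trans (mul_le_mul_of_nonneg_right hΦ hc.le)
    nlinarith
  -- Without the hypothesis involving M only ω₀ < φ₁ is known on x₁ ≥ 1, leaving no room for growth.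
  -- Doubling Φ provides the room and still yields the lower bound and the finite lifespan.
  have B := h.barrier (Φ := 2 * φ₁) (m := φ₁) hα (by norm_num) (by norm_num) hp (by linarith)
    (by ring) (by linarith) (by linarith) (by linarith) (hlarge _ (by linarith)) hτ (by linarith)
    (by linarith) (by linarith) fun x hx h1 h4 => (h.upper' x hx h1 h4).le
  obtain ⟨Ts, ω, ρ, hTs, hmax⟩ := BoussinesqModel.exists_isMaximalSolution hα h.memX_ω h.memX_ρ
    fun T ω ρ sol => B.lifespan_le hτ (BoussinesqModel.tendsto_front hp) sol
  have hTsτ := B.lifespan_le hτ (BoussinesqModel.tendsto_front hp) hmax.isSolution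
  refine ⟨Ts, ω, ρ, hTs, hmax, hmax.tendsto_eLpNorm hα h.memX_ω h.memX_ρ h.nonneg_ω h.nonneg_ρ hTs,
    τ, BoussinesqModel.front p₀ c τ, hτ, hTsτ, BoussinesqModel.contDiffOn_front hp hc, rfl,
    fun t ht => BoussinesqModel.front_pos hp hc ht.2, BoussinesqModel.strictAntiOn_front hp hc,
    BoussinesqModel.tendsto_front hp, fun t ht x₁ hbx hx1 => ?_⟩
  have htτ := ht.2.trans_le hTsτ
  have hmem : (x₁, (0 : ℝ)) ∈ BoussinesqModel.region α (1 / 2) (BoussinesqModel.front p₀ c τ t) :=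
    ⟨le_rfl, Or.inl ⟨hbx, mul_pos (mul_pos two_pos hα) (sub_pos.2 hbx)⟩⟩
  refine ⟨?_, fun hM' => ?_⟩
  · rw [one_mul]
    exact (B.strongBounds_of_lt hmax.isSolution ht htτ).lower _ hmem
      (show x₁ < 11 / 4 by linarith)
  -- With ω₀ ≤ M < φ₁ on x₁ ≥ 1 the barrier works with Φ = φ₁ itself, which is the sharp upper
  -- bound. The front is the same.
  · have B' := h.barrier (Φ := φ₁) (m := m) hα (by norm_num) (by norm_num) hp (by linarith)
      (by ring) (by linarith) le_rfl (by linarith) (hlarge _ le_rfl) hτ (by linarith)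
      hm0 (by linarith) fun x hx h1 _ => (hM' x hx h1).trans (le_max_left _ _)
    exact (B'.strongBounds_of_lt hmax.isSolution ht htτ).upper _ hmem hx1
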